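/- Let $\mathbb F$ be a field of characteristic $p>3$, let $m,n\ge 3$ be integers and let $\underline t=(t_1,\dots,t_m)$ be an $m$-tuple of positive integers. Let $\mathfrak A=\mathfrak A(m,n;\underline t)$ be the tensor product of the truncated divided power algebra with basis $x^{(\alpha)}$, $0\le\alpha_i<p^{t_i}$ ($1\le i\le m$), where $x^{(\alpha)}x^{(\beta)}=\binom{\alpha+\beta}{\alpha}x^{(\alpha+\beta)}$, and of the exterior superalgebra in the odd variables $x_{m+1},\dots,x_{m+n}$. Write $x_i=x^{(\varepsilon_i)}$ for $i\le m$, and $\tau(r)=\bar 0$ for $r\le m$, $\tau(r)=\bar 1$ for $r>m$. Let $D_1,\dots,D_{m+n}$ be the superderivations of $\mathfrak A$ given by $D_i(x^{(\alpha)}x^u)=x^{(\alpha-\varepsilon_i)}x^u$ for $i\le m$ (zero if $\alpha_i=0$) and by the left partial derivatives $\partial/\partial x_k$ for $k>m$. Let $W=\{\sum_r f_rD_r : f_r\in\mathfrak A\}$, $\operatorname{div}(\sum_r f_rD_r)=\sum_r(-1)^{\tau(r)\mathrm p(f_r)}D_r(f_r)$, $\overline S=\{D\in W:\operatorname{div}D=0\}$,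 and let $S$ be the span of all $$D_{rs}(f)=(-1)^{\tau(r)\tau(s)}D_r(f)D_s-(-1)^{(\tau(r)+\tau(s))\mathrm p(f)}D_s(f)D_r,\qquad 1\le r,s\le m+n,\ f\in\mathfrak A,$$ where $\mathrm p(f)$ is the parity of $f$ and expressions that contain $\mathrm p(f)$ are extended linearly from homogeneous $f$. Let $\mathcal S=S_{\bar 0}$ and $\overline{\mathcal S}=\overline S_{\bar 0}$ be the even parts, $\mathcal T=\operatorname{span}\{x_rD_r: 1\le r\le m+n\}$, $\mathcal J=\operatorname{span}\{D_i^{p^{r}}: 1\le i\le m,\ 1\le r<t_i\}$, and $\widetilde{\mathcal S}=\overline{\mathcal S}+\mathcal T+\mathcal J$. Then $\widetilde{\mathcal S}$ is a Lie subalgebra of the even part $\mathrm{Der}_{\bar 0}(\mathfrak A)$ of the superderivation algebra of $\mathfrak A$ (with the commutator as bracket), $\mathcal S$ is a Lie subalgebra and is an ideal of $\widetilde{\mathcal S}$, the centralizer of $\mathcal S$ in $\widetilde{\mathcal S}$ is zero, and there is an isomorphism of Lie algebras $$\mathrm{Der}_{\mathrm{out}}(\mathcal S):=\mathrm{Der}(\mathcal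 S)/\mathrm{ad}\,\mathcal S\;\cong\;\widetilde{\mathcal S}/\mathcal S,$$ namely the one induced by $E\mapsto(\mathrm{ad}\,E)|_{\mathcal S}$, $E\in\widetilde{\mathcal S}$. -/

import Mathlib

namespace ModularCartan

/-- The index set of the standard basis `x^(α) x^u` of `𝔄(m,n;t)`: multi-indices `α` with
`α i < p ^ t i` for all `i`, and sets `u` of odd variables. -/
abbrev Idx (p : ℕ) {m : ℕ} (n : ℕ) (t : Fin m → ℕ) : Type :=
  {α : Fin m → ℕ // ∀ i, α i < p ^ t i} × Finset (Fin n)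

/-- The underlying vector space of `𝔄 = 𝔄(m,n;t)`, with basis `x^(α) x^u`. -/
abbrev Alg (F : Type*) [Field F] (p : ℕ) {m : ℕ} (n : ℕ) (t : Fin m → ℕ) : Type _ :=
  Idx p n t →₀ F

/-- The index set `Y` of all variables: `inl i` is the `i`-th even variable and `inr k` the
`k`-th odd one. -/
abbrev Var (m n : ℕ) : Type := Fin m ⊕ Fin n

/-- The parity `τ` of a variable. -/
def tau {m n : ℕ} : Var m n → ZMod 2 := Sum.elim (fun _ => 0) (fun _ => 1)

/-- The sign `(-1)^(a b)` for parities `a`, `b`. -/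
def sgn (F : Type*) [Field F] (a b : ZMod 2) : F := (-1) ^ (a.val * b.val)

/-- The parity of the basis element `x^(α) x^u`, that is `|u|` modulo 2. -/
def par {p m n : ℕ} {t : Fin m → ℕ} (b : Idx p n t) : ZMod 2 := (b.2.card : ZMod 2)

/-- The sign in `x^u x^v = ± x^(u ∪ v)` for disjoint `u`, `v`: the number of transpositions
needed to sort the concatenation is the number of pairs `(a, b) ∈ u × v` with `b < a`. -/
def extSign (F : Type*) [Field F] {n : ℕ} (u v : Finset (Fin n)) : F :=
  (-1) ^ ((u ×ˢ v).filter (fun q => q.2 < q.1)).card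

/-- The coefficient in `x^(α) x^(β) = binom(α + β, α) x^(α + β)`. -/
def dpCoeff (F : Type*) [Field F] {m : ℕ} (α β : Fin m → ℕ) : F :=
  ((∏ i, (α i + β i).choose (α i) : ℕ) : F)

/-- In characteristic `p` the coefficient of `x^(α + β)` in `x^(α) x^(β)` vanishes as soon as
`α + β` leaves the truncated range, so the multiplication of the full divided power algebra
restricts to the truncated one. -/
theorem dpCoeff_eq_zero (F : Type*) [Field F] (p : ℕ) [CharP F p] (hp : p.Prime) {m : ℕ}
    (t : Fin m → ℕ) (α β : Fin m → ℕ) (hα : ∀ i, α i < p ^ t i) (hβ : ∀ i, β i < p ^ t i)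
    (h : ¬ ∀ i, (α + β) i < p ^ t i) : dpCoeff F α β = 0 := by
  push Not at h
  obtain ⟨i, hi⟩ := h
  rw [Pi.add_apply] at hi
  unfold dpCoeff
  rw [CharP.cast_eq_zero_iff F p]
  refine dvd_trans ?_ (Finset.dvd_prod_of_mem _ (Finset.mem_univ i))
  rw [add_comm (α i)]
  have hpos : 0 < (β i + α i).choose (α i) := Nat.choose_pos (Nat.le_add_left _ _)
  have hti : t i ≠ 0 := by
    intro h0
    have h1 := hα i
    have h2 := hβ i
    rw [h0, pow_zero] at h1 h2 hi
    omega
  have hf := Nat.factorization_choose' (p := p) (n := β i) (k := α i)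
    (b := max (Nat.log p (β i + α i) + 1) (t i + 1)) hp (by omega)
  refine (hp.dvd_iff_one_le_factorization hpos.ne').2 ?_
  rw [hf]
  refine Finset.card_pos.2 ⟨t i, ?_⟩
  rw [Finset.mem_filter, Finset.mem_Ico, Nat.mod_eq_of_lt (hα i), Nat.mod_eq_of_lt (hβ i)]
  omega

section
variable (F : Type*) [Field F] (p : ℕ) {m : ℕ} (n : ℕ) (t : Fin m → ℕ)

/-- The element `x^(α) x^u` of `𝔄` (zero by convention when `α` is out of range). -/
noncomputable def mon (α : Fin m → ℕ) (u : Finset (Fin n)) : Alg F p n t :=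
  open scoped Classical in
  if h : ∀ i, α i < p ^ t i then Finsupp.single (⟨α, h⟩, u) 1 else 0

/-- The product of two basis elements of `𝔄`. -/
noncomputable def mulBasis (b c : Idx p n t) : Alg F p n t :=
  if Disjoint b.2 c.2 then
    (dpCoeff F b.1.1 c.1.1 * extSign F b.2 c.2) • mon F p n t (b.1.1 + c.1.1) (b.2 ∪ c.2)
  else 0

/-- The multiplication of `𝔄`, as a bilinear map. -/
noncomputable def mul : Alg F p n t →ₗ[F] Alg F p n t →ₗ[F] Alg F p n t :=
  Finsupp.linearCombination F (fun b => Finsupp.linearCombination F (mulBasis F p n t b))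

/-- The homogeneous component `𝔄_θ` of the superspace `𝔄`. -/
noncomputable def homog (θ : ZMod 2) : Submodule F (Alg F p n t) :=
  Finsupp.supported F F {b | par b = θ}

/-- The linear map `f ↦ (-1)^(θ p(f)) f`. -/
noncomputable def twist (θ : ZMod 2) : Module.End F (Alg F p n t) :=
  Finsupp.linearCombination F (fun b => Finsupp.single b (sgn F θ (par b)))

/-- The value of `D_r` on a basis element. For an even variable,
`D_i (x^(α) x^u) = x^(α - ε_i) x^u` (zero if `α i = 0`); for an odd variable,
`D_k (x^(α) x^u) = x^(α) ∂x^u/∂x_k` with the left partial derivative. -/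
noncomputable def partialBasis (r : Var m n) (b : Idx p n t) : Alg F p n t :=
  match r with
  | Sum.inl i => if b.1.1 i = 0 then 0 else mon F p n t (b.1.1 - Pi.single i 1) b.2
  | Sum.inr k =>
      if k ∈ b.2 then
        ((-1 : F) ^ (b.2.filter (fun a => a < k)).card) • mon F p n t b.1.1 (b.2.erase k)
      else 0

/-- The operator `D_r` on `𝔄`. -/
noncomputable def partialD (r : Var m n) : Module.End F (Alg F p n t) :=
  Finsupp.linearCombination F (partialBasis F p n t r)

/-- The variable `x_r`, as an element of `𝔄`. -/
noncomputable def gen (r : Var m n) : Alg F p n t :=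
  match r with
  | Sum.inl i => mon F p n t (Pi.single i 1) ∅
  | Sum.inr k => mon F p n t 0 {k}

/-- The operator `f D_r` on `𝔄`, linear in `f`. -/
noncomputable def mulD (r : Var m n) : Alg F p n t →ₗ[F] Module.End F (Alg F p n t) :=
  (LinearMap.lcomp F (Alg F p n t) (partialD F p n t r)).comp (mul F p n t)

/-- The linear map sending a family of coefficients `(f_r)` to `∑ f_r D_r`. -/
noncomputable def vectorField : (Var m n → Alg F p n t) →ₗ[F] Module.End F (Alg F p n t) :=
  ∑ r, (mulD F p n t r).comp (LinearMap.proj r)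

/-- The divergence of `∑ f_r D_r`, in terms of the (uniquely determined) coefficients `f_r`:
`∑ (-1)^(τ(r) p(f_r)) D_r(f_r)`. -/
noncomputable def divergence : (Var m n → Alg F p n t) →ₗ[F] Alg F p n t :=
  ∑ r, ((partialD F p n t r).comp (twist F p n t (tau r))).comp (LinearMap.proj r)

/-- The component `pl_θ(𝔄)` of the linear maps of parity `θ`. -/
def plPart (θ : ZMod 2) : Submodule F (Module.End F (Alg F p n t)) where
  carrier := {A | ∀ μ, ∀ f ∈ homog F p n t μ, A f ∈ homog F p n t (θ + μ)}
  add_mem' ha hb μ f hf := Submodule.add_mem _ (ha μ f hf) (hb μ f hf)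
  zero_mem' _ _ _ := Submodule.zero_mem _
  smul_mem' c _ ha μ f hf := Submodule.smul_mem _ c (ha μ f hf)

/-- The superderivations of `𝔄` of parity `θ`. -/
def superDer (θ : ZMod 2) : Submodule F (Module.End F (Alg F p n t)) where
  carrier := {D | D ∈ plPart F p n t θ ∧ ∀ μ, ∀ f ∈ homog F p n t μ, ∀ g,
    D (mul F p n t f g) = mul F p n t (D f) g + sgn F θ μ • mul F p n t f (D g)}
  add_mem' ha hb := by
    refine ⟨Submodule.add_mem _ ha.1 hb.1, fun μ f hf g => ?_⟩
    simp only [LinearMap.add_apply, ha.2 μ f hf g, hb.2 μ f hf g, map_add, smul_add]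
    abel
  zero_mem' := ⟨Submodule.zero_mem _, fun μ f hf g => by simp⟩
  smul_mem' c D hD := by
    refine ⟨Submodule.smul_mem _ c hD.1, fun μ f hf g => ?_⟩
    simp only [LinearMap.smul_apply, hD.2 μ f hf g, map_smul, smul_add, smul_comm c]

/-- The operator
`D_rs(f) = (-1)^(τ(r) τ(s)) D_r(f) D_s - (-1)^((τ(r) + τ(s)) p(f)) D_s(f) D_r`. -/
noncomputable def Drs (r s : Var m n) (f : Alg F p n t) : Module.End F (Alg F p n t) :=
  sgn F (tau r) (tau s) • mulD F p n t s (partialD F p n t r f)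
    - mulD F p n t r (partialD F p n t s (twist F p n t (tau r + tau s) f))

/-- The even part `𝒮` of the special superalgebra `S(m,n;t) = span {D_rs(f)}`. -/
noncomputable def evenS : Submodule F (Module.End F (Alg F p n t)) :=
  Submodule.span F {E | ∃ r s f, E = Drs F p n t r s f} ⊓ plPart F p n t 0

/-- The even part of the algebra `S̄(m,n;t)` of all `D ∈ W(m,n;t)` with `div D = 0`. -/
noncomputable def evenSbar : Submodule F (Module.End F (Alg F p n t)) :=
  (LinearMap.ker (divergence F p n t)).map (vectorField F p n t) ⊓ plPart F p n t 0

/-- The canonical torus `𝒯`, spanned by the operators `Γ_r = x_r D_r`. -/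
noncomputable def torus : Submodule F (Module.End F (Alg F p n t)) :=
  Submodule.span F (Set.range (fun r => mulD F p n t r (gen F p n t r)))

/-- The space `𝒥` spanned by the operators `D_i ^ (p ^ r)` with `i` an even variable and
`1 ≤ r < t i`. -/
noncomputable def spanJ : Submodule F (Module.End F (Alg F p n t)) :=
  Submodule.span F {E | ∃ (i : Fin m) (r : ℕ), 1 ≤ r ∧ r < t i ∧
    E = partialD F p n t (Sum.inl i) ^ (p ^ r)}

/-- `S̃`, the sum of the even part of `S̄`, of `𝒯` and of `𝒥`. -/
noncomputable def Stilde : Submodule F (Module.End F (Alg F p n t)) :=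
  evenSbar F p n t ⊔ torus F p n t ⊔ spanJ F p n t

end

/-- The ideal of inner derivations of a Lie algebra. -/
def innerDer (R L : Type*) [CommRing R] [LieRing L] [LieAlgebra R L] :
    LieIdeal R (LieDerivation R L L) where
  toSubmodule := LinearMap.range (LieDerivation.ad R L : L →ₗ[R] LieDerivation R L L)
  lie_mem := by
    rintro D _ ⟨x, rfl⟩
    exact ⟨D x, (LieDerivation.lie_der_ad_eq_ad_der D x).symm⟩

/-- The outer derivation algebra `Der(L) / ad L` of a Lie algebra. -/
abbrev OuterDer (R L : Type*) [CommRing R] [LieRing L] [LieAlgebra R L] : Type _ :=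
  LieDerivation R L L ⧸ innerDer R L

end ModularCartan

attribute [local instance 100] LieRing.ofAssociativeRing

set_option linter.unusedSectionVars false

namespace ModularCartan

variable {F : Type*} [Field F] {p m n : ℕ} {t : Fin m → ℕ}

/-! Write ξ_k for the odd variables. An even field ∑ f_r D_r has f_r of the parity of D_r, so it is
an ordinary derivation of 𝔄 and is determined by its values on the variables; identities between
even fields are checked there. The sum of the even part of S̄ and 𝒯 is the space of even fields of
constant divergence (`mem_Stilde`). Integration by parts writes [E, E'], for div E = c and div E' =
0, as a signed sum of D_rs(E(x_r) E'(x_s)) minus c E' (`lie_eq_sum_Drs`). An element j of 𝒥 is a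
derivation commuting with every D_r, so [j, D_rs(f)] = D_rs(j f). Hence 𝒮 is an ideal of 𝒮̃.

The main point is that every derivation of 𝒮 is induced by 𝒮̃. Regard it as a map φ with values in
even fields, and subtract inner derivations by even fields and by 𝒥 until it vanishes on generators.

On the D_i: the relations [D_i, D_j] = 0 make the φ(D_i) closed, and the Poincaré lemma
(`exists_partial_eq`) integrates them. The only obstruction is (ad D_i)^(p^t_i - 1) φ(D_i); because
p^t_i = 0 in F it centralizes the torus and the fields ξ_k D_l and ξ_a ξ_b D_j, and it commutes with
the D_j, so it is zero (`eq_zero_of_centralizes`).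

On the torus spanned by h_ik = x_i D_i + ξ_k D_k: components of nonzero weight are inner, and what
is left of φ(h_ik) is diagonal and must act by zero on eigenvectors. After this φ preserves weights.
On ξ_k D_l it is a scalar d_k - d_l, on x_i D_j (i ≠ j) it is zero, and on all ξ_a ξ_b D_i it is one
common scalar; diagonal fields remove these scalars (`IsSDer.exists_isNormalized`).

On f ξ_k D_l, with f a polynomial in the even variables: weights force φ(f ξ_k D_l) = δ(f) ξ_k D_l,
where δ does not depend on k and l. It is a derivation commuting with the D_i and killing the x_i.
Since x^(β) is a multiple of a nontrivial product unless β = p^r ε_i, such a δ is a combination of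
the D_i^(p^r), that is, it comes from 𝒥 (`exists_mem_spanJ`).

The fields killed so far, together with C = f D_i + D_i(f) ξ_k D_k, generate 𝒮
(`VerticalClosed.evenS_le`). An induction on degree shows that φ(C) is a combination of the ξ_1⋯ξ_n
D_j; comparing weights and moving exponents with x_a D_l gives φ(C) = 0
(`IsReduced.map_cField_mon`).

So the derivation is ad(E + j) with E an even field and j in 𝒥. As E normalizes 𝒮, its divergence is
annihilated by 𝒮, hence constant, and E + j lies in 𝒮̃. Triviality of the centralizer identifies the
kernel of 𝒮̃ → Der_out(𝒮) with 𝒮. -/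

/-- The ring structure of `End 𝔄`, as a shortcut for the instance search. -/
noncomputable abbrev endRing : Ring (Module.End F (Alg F p n t)) :=
  @Module.End.instRing F (Alg F p n t) _ Finsupp.instAddCommGroup _

/-- The additive group `End 𝔄`, as a shortcut for the instance search. -/
noncomputable abbrev endAddCommGroup : AddCommGroup (Module.End F (Alg F p n t)) :=
  @LinearMap.addCommGroup F F (Alg F p n t) (Alg F p n t) _ _ _ Finsupp.instAddCommGroup _ _ _

/-- The commutator bracket of `End 𝔄`. -/
noncomputable abbrev endLieRing : LieRing (Module.End F (Alg F p n t)) :=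
  @LieRing.ofAssociativeRing _ endRing

attribute [local instance] endRing
attribute [local instance] endLieRing
attribute [local instance] endAddCommGroup

local notation:70 a:70 " ⋆ " b:71 => mul _ _ _ _ a b
local notation "𝔡" => partialD _ _ _ _

/-! ### The algebra `𝔄` -/

theorem single_eq_mon (b : Idx p n t) :
    (Finsupp.single b 1 : Alg F p n t) = mon F p n t b.1.1 b.2 := by
  unfold mon
  rw [dif_pos b.1.2]

theorem mon_of_not {α : Fin m → ℕ} (h : ¬ ∀ i, α i < p ^ t i) (u : Finset (Fin n)) :
    mon F p n t α u = 0 := by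
  unfold mon
  rw [dif_neg h]

theorem mon_of_mem {α : Fin m → ℕ} (h : ∀ i, α i < p ^ t i) (u : Finset (Fin n)) :
    mon F p n t α u = Finsupp.single (⟨α, h⟩, u) 1 := by
  unfold mon
  rw [dif_pos h]

@[elab_as_elim]
theorem alg_ind {P : Alg F p n t → Prop} (f : Alg F p n t) (zero : P 0)
    (add : ∀ f g, P f → P g → P (f + g)) (smul : ∀ (c : F) f, P f → P (c • f))
    (mon : ∀ (α : Fin m → ℕ) (_ : ∀ i, α i < p ^ t i) (u : Finset (Fin n)),
      P (mon F p n t α u)) : P f := by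
  induction f using Finsupp.induction_linear with
  | zero => exact zero
  | add f g hf hg => exact add f g hf hg
  | single b a =>
    have := smul a _ (mon b.1.1 b.1.2 b.2)
    rwa [← single_eq_mon, Finsupp.smul_single, smul_eq_mul, mul_one] at this

theorem mul_mon (α β : Fin m → ℕ) (u v : Finset (Fin n)) (hα : ∀ i, α i < p ^ t i)
    (hβ : ∀ i, β i < p ^ t i) : mon F p n t α u ⋆ mon F p n t β v =
      if Disjoint u v then (dpCoeff F α β * extSign F u v) • mon F p n t (α + β) (u ∪ v)
      else 0 := by
  rw [mon_of_mem hα, mon_of_mem hβ]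
  simp [mul, mulBasis]

theorem extSign_union_left {u v : Finset (Fin n)} (w : Finset (Fin n)) (h : Disjoint u v) :
    extSign F (u ∪ v) w = extSign F u w * extSign F v w := by
  unfold extSign
  rw [← pow_add, Finset.union_product, Finset.filter_union, Finset.card_union_of_disjoint]
  refine Finset.disjoint_filter_filter ?_
  rw [Finset.disjoint_product]
  exact Or.inl h

theorem extSign_union_right {v w : Finset (Fin n)} (u : Finset (Fin n)) (h : Disjoint v w) :
    extSign F u (v ∪ w) = extSign F u v * extSign F u w := by
  unfold extSign
  rw [← pow_add, Finset.product_union, Finset.filter_union, Finset.card_union_of_disjoint]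
  refine Finset.disjoint_filter_filter ?_
  rw [Finset.disjoint_product]
  exact Or.inr h

theorem extSign_empty_left (u : Finset (Fin n)) : extSign F ∅ u = 1 := by
  simp [extSign]

theorem extSign_empty_right (u : Finset (Fin n)) : extSign F u ∅ = 1 := by
  simp [extSign]

theorem extSign_mul_self (u v : Finset (Fin n)) : extSign F u v * extSign F u v = 1 := by
  unfold extSign
  rw [← mul_pow]; simp

/-- The pairs in u × v are split by which entry is larger; disjointness excludes ties, so the
inversions of (u, v) and those of (v, u) together exhaust the product. -/
theorem extSign_comm {u v : Finset (Fin n)} (h : Disjoint u v) :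
    extSign F u v = (-1) ^ (u.card * v.card) * extSign F v u := by
  have key : extSign F u v * extSign F v u = (-1) ^ (u.card * v.card) := by
    unfold extSign
    rw [← pow_add, ← Finset.card_product, ← Finset.card_filter_add_card_filter_not (s := u ×ˢ v)
      (fun q => q.2 < q.1)]
    congr 2
    refine Finset.card_bij (fun q _ => (q.2, q.1)) ?_ ?_ ?_
    · rintro ⟨a, b⟩ hq
      simp only [Finset.mem_filter, Finset.mem_product] at hq ⊢
      exact ⟨⟨hq.1.2, hq.1.1⟩, not_lt.2 hq.2.le⟩
    · rintro ⟨a, b⟩ _ ⟨c, d⟩ _ h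
      simp only [Prod.mk.injEq] at h ⊢
      exact ⟨h.2, h.1⟩
    · rintro ⟨a, b⟩ hq
      simp only [Finset.mem_filter, Finset.mem_product, not_lt] at hq
      refine ⟨(b, a), ?_, rfl⟩
      simp only [Finset.mem_filter, Finset.mem_product]
      refine ⟨⟨hq.1.2, hq.1.1⟩, lt_of_le_of_ne hq.2 ?_⟩
      rintro rfl
      exact Finset.disjoint_left.1 h hq.1.1 hq.1.2
  rw [← key, mul_assoc, extSign_mul_self, mul_one]

/-- Both sides are the multinomial coefficient of (α, β, γ), factor by factor. -/
theorem dpCoeff_assoc (α β γ : Fin m → ℕ) :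
    dpCoeff F α β * dpCoeff F (α + β) γ = dpCoeff F β γ * dpCoeff F α (β + γ) := by
  unfold dpCoeff
  rw [← Nat.cast_mul, ← Nat.cast_mul, ← Finset.prod_mul_distrib, ← Finset.prod_mul_distrib]
  congr 1
  refine Finset.prod_congr rfl fun i _ => ?_
  simp only [Pi.add_apply]
  have h := Nat.choose_mul (n := α i + β i + γ i) (k := α i + β i) (s := α i)
    (Nat.le_add_right _ _)
  rw [mul_comm, h, mul_comm, add_assoc]
  congr 2 <;> omega

theorem dpCoeff_comm (α β : Fin m → ℕ) : dpCoeff F α β = dpCoeff F β α := by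
  unfold dpCoeff
  congr 1
  refine Finset.prod_congr rfl fun i _ => ?_
  rw [add_comm]
  exact Nat.choose_symm_of_eq_add (add_comm _ _)

theorem dpCoeff_zero_left (α : Fin m → ℕ) : dpCoeff F 0 α = 1 := by
  simp [dpCoeff]

theorem dpCoeff_zero_right (α : Fin m → ℕ) : dpCoeff F α 0 = 1 := by
  simp [dpCoeff]

/-- The characteristic plays no role: a monomial with exponent out of range is zero, and α + β + γ
in range forces α + β and β + γ in range, so outside the range both sides vanish. -/
theorem alg_mul_assoc (f g h : Alg F p n t) : f ⋆ g ⋆ h = f ⋆ (g ⋆ h) := by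
  induction f using alg_ind with
  | zero => simp
  | add f f' hf hf' => simp [hf, hf']
  | smul c f hf => simp [hf]
  | mon α hα u =>
  induction g using alg_ind with
  | zero => simp
  | add f f' hf hf' => simp [hf, hf']
  | smul c f hf => simp [hf]
  | mon β hβ v =>
  induction h using alg_ind with
  | zero => simp
  | add f f' hf hf' => simp [hf, hf']
  | smul c f hf => simp [hf]
  | mon γ hγ w =>
  rw [mul_mon _ _ _ _ hα hβ, mul_mon _ _ _ _ hβ hγ]
  by_cases huv : Disjoint u v
  swap
  · rw [if_neg huv]
    split_ifs with hvw
    · by_cases hβγ : ∀ i, (β + γ) i < p ^ t i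
      · rw [map_smul, mul_mon _ _ _ _ hα hβγ, if_neg, smul_zero, map_zero, LinearMap.zero_apply]
        rw [Finset.disjoint_union_right]; tauto
      · simp [mon_of_not hβγ]
    · simp
  by_cases hvw : Disjoint v w
  swap
  · rw [if_neg hvw, if_pos huv]
    by_cases hβγ : ∀ i, (α + β) i < p ^ t i
    · rw [map_smul, LinearMap.smul_apply, mul_mon _ _ _ _ hβγ hγ, if_neg, smul_zero, map_zero]
      rw [Finset.disjoint_union_left]; tauto
    · simp [mon_of_not hβγ]
  rw [if_pos huv, if_pos hvw]
  by_cases huw : Disjoint u w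
  swap
  · trans 0
    · by_cases hβγ : ∀ i, (α + β) i < p ^ t i
      · rw [map_smul, LinearMap.smul_apply, mul_mon _ _ _ _ hβγ hγ, if_neg, smul_zero]
        rw [Finset.disjoint_union_left]; tauto
      · simp [mon_of_not hβγ]
    · by_cases hβγ : ∀ i, (β + γ) i < p ^ t i
      · rw [map_smul, mul_mon _ _ _ _ hα hβγ, if_neg, smul_zero]
        rw [Finset.disjoint_union_right]; tauto
      · simp [mon_of_not hβγ]
  by_cases hall : ∀ i, (α + β + γ) i < p ^ t i
  · have h1 : ∀ i, (α + β) i < p ^ t i := fun i =>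
      lt_of_le_of_lt (by simp) (hall i)
    have h2 : ∀ i, (β + γ) i < p ^ t i := fun i =>
      lt_of_le_of_lt (by simp [add_assoc]) (hall i)
    rw [map_smul, map_smul, LinearMap.smul_apply, mul_mon _ _ _ _ h1 hγ, mul_mon _ _ _ _ hα h2,
      if_pos (Finset.disjoint_union_left.2 ⟨huw, hvw⟩),
      if_pos (Finset.disjoint_union_right.2 ⟨huv, huw⟩), smul_smul, smul_smul,
      extSign_union_left _ huv, extSign_union_right _ hvw, Finset.union_assoc, add_assoc]
    congr 1
    have := dpCoeff_assoc (F := F) α β γ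
    linear_combination (extSign F u v * extSign F u w * extSign F v w) * this
  · trans 0
    · by_cases h1 : ∀ i, (α + β) i < p ^ t i
      · rw [map_smul, LinearMap.smul_apply, mul_mon _ _ _ _ h1 hγ, mon_of_not hall]
        simp
      · simp [mon_of_not h1]
    · by_cases h1 : ∀ i, (β + γ) i < p ^ t i
      · rw [map_smul, mul_mon _ _ _ _ hα h1, ← add_assoc, mon_of_not hall]
        simp
      · simp [mon_of_not h1]

variable (F p n t) in
/-- The unit of `𝔄`. -/
noncomputable def one : Alg F p n t := mon F p n t 0 ∅

theorem one_mul' (f : Alg F p n t) : one F p n t ⋆ f = f := by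
  induction f using alg_ind with
  | zero => simp
  | add f f' hf hf' => simp [hf, hf']
  | smul c f hf => simp [hf]
  | mon α hα u =>
  have h0 : ∀ i, (0 : Fin m → ℕ) i < p ^ t i := fun i => lt_of_le_of_lt (Nat.zero_le _) (hα i)
  rw [one, mul_mon _ _ _ _ h0 hα]
  simp [dpCoeff_zero_left, extSign_empty_left]

theorem mul_one' (f : Alg F p n t) : f ⋆ one F p n t = f := by
  induction f using alg_ind with
  | zero => simp
  | add f f' hf hf' => simp [hf, hf']
  | smul c f hf => simp [hf]
  | mon α hα u =>
  have h0 : ∀ i, (0 : Fin m → ℕ) i < p ^ t i := fun i => lt_of_le_of_lt (Nat.zero_le _) (hα i)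
  rw [one, mul_mon _ _ _ _ hα h0]
  simp [dpCoeff_zero_right, extSign_empty_right]

/-! ### Parities -/

theorem zmod_two_cases (a : ZMod 2) : a = 0 ∨ a = 1 := by
  revert a; decide

theorem sgn_zero_left (a : ZMod 2) : sgn F 0 a = 1 := by simp [sgn]

theorem sgn_zero_right (a : ZMod 2) : sgn F a 0 = 1 := by simp [sgn]

theorem sgn_one_one : sgn F 1 1 = -1 := by simp [sgn, ZMod.val_one]

theorem sgn_comm (a b : ZMod 2) : sgn F a b = sgn F b a := by rw [sgn, sgn, Nat.mul_comm]

theorem sgn_mul_self (a b : ZMod 2) : sgn F a b * sgn F a b = 1 := by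
  rw [sgn, ← mul_pow]; simp

theorem sgn_add_right (a b c : ZMod 2) : sgn F a (b + c) = sgn F a b * sgn F a c := by
  have h2 : (1 + 1 : ZMod 2) = 0 := by decide
  rcases zmod_two_cases a with rfl | rfl <;> rcases zmod_two_cases b with rfl | rfl <;>
    rcases zmod_two_cases c with rfl | rfl <;>
    simp [sgn_zero_left, sgn_zero_right, sgn_one_one, h2]

theorem sgn_add_left (a b c : ZMod 2) : sgn F (a + b) c = sgn F a c * sgn F b c := by
  rw [sgn_comm, sgn_add_right, sgn_comm c, sgn_comm c]

theorem sgn_natCast (a b : ℕ) : sgn F (a : ZMod 2) (b : ZMod 2) = (-1) ^ (a * b) := by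
  unfold sgn
  rw [ZMod.val_natCast, ZMod.val_natCast]
  rcases Nat.even_or_odd a with ha | ha
  · rw [Nat.even_iff.1 ha, zero_mul, pow_zero, Even.neg_one_pow (ha.mul_right b)]
  · rw [Nat.odd_iff.1 ha, one_mul, pow_mul, ha.neg_one_pow]
    exact (neg_one_pow_eq_pow_mod_two _).symm

theorem twist_mon (θ : ZMod 2) (α : Fin m → ℕ) (u : Finset (Fin n)) :
    twist F p n t θ (mon F p n t α u) = sgn F θ (u.card : ZMod 2) • mon F p n t α u := by
  by_cases h : ∀ i, α i < p ^ t i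
  · rw [mon_of_mem h]
    simp [twist, par]
  · simp [mon_of_not h]

theorem twist_apply (θ : ZMod 2) (f : Alg F p n t) (b : Idx p n t) :
    twist F p n t θ f b = sgn F θ (par b) * f b := by
  induction f using Finsupp.induction_linear with
  | zero => simp
  | add f g hf hg => rw [map_add, Finsupp.add_apply, hf, hg, Finsupp.add_apply, mul_add]
  | single c a =>
    by_cases h : c = b
    · subst h; simp [twist, mul_comm]
    · simp [twist, h]

theorem mem_homog {θ : ZMod 2} {f : Alg F p n t} :
    f ∈ homog F p n t θ ↔ ∀ b, f b ≠ 0 → par b = θ := by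
  rw [homog, Finsupp.mem_supported]
  constructor
  · intro h b hb
    exact h (Finset.mem_coe.2 (Finsupp.mem_support_iff.2 hb))
  · intro h b hb
    exact h b (Finsupp.mem_support_iff.1 (Finset.mem_coe.1 hb))

theorem twist_of_mem {θ μ : ZMod 2} {f : Alg F p n t} (hf : f ∈ homog F p n t μ) :
    twist F p n t θ f = sgn F θ μ • f := by
  ext b
  rw [twist_apply, Finsupp.smul_apply, smul_eq_mul]
  by_cases h : f b = 0
  · simp [h]
  · rw [mem_homog.1 hf b h]

theorem mon_mem_homog (α : Fin m → ℕ) (u : Finset (Fin n)) :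
    mon F p n t α u ∈ homog F p n t (u.card : ZMod 2) := by
  by_cases h : ∀ i, α i < p ^ t i
  · rw [mon_of_mem h, mem_homog]
    intro b hb
    rw [Finsupp.single_apply_ne_zero] at hb
    rw [hb.1]; rfl
  · rw [mon_of_not h]; exact Submodule.zero_mem _

theorem one_mem_homog : one F p n t ∈ homog F p n t 0 := by
  simpa [one] using mon_mem_homog (F := F) (p := p) (t := t) 0 (∅ : Finset (Fin n))

theorem gen_mem_homog (r : Var m n) : gen F p n t r ∈ homog F p n t (tau r) := by
  rcases r with i | k
  · simpa [tau, gen] using mon_mem_homog (F := F) (p := p) (t := t) (Pi.single i 1) (∅ : Finset (Fin n))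
  · simpa [tau, gen] using mon_mem_homog (F := F) (p := p) (t := t) 0 ({k} : Finset (Fin n))

theorem homog_ind {θ : ZMod 2} {P : Alg F p n t → Prop} {f : Alg F p n t}
    (hf : f ∈ homog F p n t θ) (zero : P 0)
    (add : ∀ f g, P f → P g → P (f + g)) (smul : ∀ (c : F) f, P f → P (c • f))
    (mon : ∀ (α : Fin m → ℕ) (_ : ∀ i, α i < p ^ t i) (u : Finset (Fin n)),
      (u.card : ZMod 2) = θ → P (mon F p n t α u)) : P f := by
  rw [homog, Finsupp.supported_eq_span_single] at hf
  induction hf using Submodule.span_induction with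
  | mem x hx =>
    obtain ⟨b, hb, rfl⟩ := hx
    dsimp only
    rw [single_eq_mon]
    exact mon _ b.1.2 _ hb
  | zero => exact zero
  | add f g _ _ hf hg => exact add f g hf hg
  | smul c f _ hf => exact smul c f hf

theorem mul_mem_homog {θ μ : ZMod 2} {f g : Alg F p n t} (hf : f ∈ homog F p n t θ)
    (hg : g ∈ homog F p n t μ) : f ⋆ g ∈ homog F p n t (θ + μ) := by
  refine homog_ind (P := fun f => f ⋆ g ∈ homog F p n t (θ + μ)) hf (by simp) ?_ ?_ ?_
  · intro f f' h h'
    rw [map_add]; exact Submodule.add_mem _ h h'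
  · intro c f h
    rw [map_smul]; exact Submodule.smul_mem _ c h
  intro α hα u hu
  refine homog_ind (P := fun g => _ ⋆ g ∈ homog F p n t (θ + μ)) hg (by simp) ?_ ?_ ?_
  · intro f f' h h'
    rw [map_add]; exact Submodule.add_mem _ h h'
  · intro c f h
    rw [map_smul]; exact Submodule.smul_mem _ c h
  intro β hβ v hv
  rw [mul_mon _ _ _ _ hα hβ]
  split_ifs with h
  · refine Submodule.smul_mem _ _ ?_
    rw [← hu, ← hv, ← Nat.cast_add, ← Finset.card_union_of_disjoint h]
    exact mon_mem_homog _ _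
  · exact Submodule.zero_mem _

/-- Expressing the sign through `twist` lets the second factor be inhomogeneous. -/
theorem mul_comm_twist {θ : ZMod 2} {f : Alg F p n t} (hf : f ∈ homog F p n t θ)
    (g : Alg F p n t) : f ⋆ g = twist F p n t θ g ⋆ f := by
  refine homog_ind (P := fun f => f ⋆ g = twist F p n t θ g ⋆ f) hf (by simp) ?_ ?_ ?_
  · intro f f' h h'
    simp [h, h']
  · intro c f h
    simp [h]
  intro α hα u hu
  induction g using alg_ind with
  | zero => simp
  | add f f' hf hf' => simp [hf, hf']
  | smul c f hf => simp [hf]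
  | mon β hβ v =>
  rw [twist_mon, ← hu, sgn_natCast, map_smul, LinearMap.smul_apply, mul_mon _ _ _ _ hα hβ,
    mul_mon _ _ _ _ hβ hα]
  by_cases h : Disjoint u v
  · rw [if_pos h, if_pos h.symm, add_comm, Finset.union_comm, dpCoeff_comm, extSign_comm h,
      smul_smul]
    congr 1; ring
  · rw [if_neg h, if_neg (fun h' => h h'.symm), smul_zero]

theorem twist_twist (θ : ZMod 2) (f : Alg F p n t) :
    twist F p n t θ (twist F p n t θ f) = f := by
  ext b
  rw [twist_apply, twist_apply, ← mul_assoc, sgn_mul_self, one_mul]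

theorem twist_zero (f : Alg F p n t) : twist F p n t 0 f = f := by
  ext b
  rw [twist_apply, sgn_zero_left, one_mul]

theorem twist_add_apply (θ μ : ZMod 2) (f : Alg F p n t) :
    twist F p n t (θ + μ) f = twist F p n t θ (twist F p n t μ f) := by
  ext b
  rw [twist_apply, twist_apply, twist_apply, sgn_add_left, mul_assoc]

theorem mul_twist_comm {θ : ZMod 2} {f : Alg F p n t} (hf : f ∈ homog F p n t θ)
    (g : Alg F p n t) : f ⋆ twist F p n t θ g = g ⋆ f := by
  rw [mul_comm_twist hf, twist_twist]

theorem even_mul_comm {f : Alg F p n t} (hf : f ∈ homog F p n t 0) (g : Alg F p n t) :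
    f ⋆ g = g ⋆ f := by
  rw [mul_comm_twist hf, twist_zero]

theorem odd_mul_comm {f g : Alg F p n t} (hf : f ∈ homog F p n t 1) (hg : g ∈ homog F p n t 1) :
    f ⋆ g = -(g ⋆ f) := by
  rw [mul_comm_twist hf, twist_of_mem hg, sgn_one_one]; simp

theorem twist_mul (θ : ZMod 2) (f g : Alg F p n t) :
    twist F p n t θ (f ⋆ g) = twist F p n t θ f ⋆ twist F p n t θ g := by
  induction f using alg_ind with
  | zero => simp
  | add f f' hf hf' => simp [hf, hf']
  | smul c f hf => simp [hf]
  | mon α hα u =>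
  induction g using alg_ind with
  | zero => simp
  | add f f' hf hf' => simp [hf, hf']
  | smul c f hf => simp [hf]
  | mon β hβ v =>
  rw [twist_of_mem (mul_mem_homog (mon_mem_homog _ _) (mon_mem_homog _ _)), twist_mon, twist_mon,
    sgn_add_right]
  simp [smul_smul, mul_comm]

/-! ### The operators `D_r` -/

local notation "ξ" k:max => gen _ _ _ _ (Sum.inr k)

theorem partial_inr_mon (k : Fin n) (α : Fin m → ℕ) (u : Finset (Fin n)) :
    partialD F p n t (Sum.inr k) (mon F p n t α u) =
      if k ∈ u then ((-1 : F) ^ (u.filter (fun a => a < k)).card) • mon F p n t α (u.erase k)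
      else 0 := by
  by_cases hα : ∀ i, α i < p ^ t i
  · rw [mon_of_mem hα, partialD, Finsupp.linearCombination_single, one_smul]
    rfl
  · simp [mon_of_not hα]

theorem partial_inl_mon (i : Fin m) {α : Fin m → ℕ} (hα : ∀ i, α i < p ^ t i)
    (u : Finset (Fin n)) : partialD F p n t (Sum.inl i) (mon F p n t α u) =
      if α i = 0 then 0 else mon F p n t (α - Pi.single i 1) u := by
  rw [mon_of_mem hα, partialD, Finsupp.linearCombination_single, one_smul]
  rfl

theorem extSign_singleton (k : Fin n) (u : Finset (Fin n)) :
    extSign F {k} u = (-1) ^ (u.filter (fun a => a < k)).card := by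
  unfold extSign
  congr 1
  refine Finset.card_bij (fun q _ => q.2) ?_ ?_ ?_
  · rintro ⟨a, b⟩ h
    simp only [Finset.mem_filter, Finset.mem_product, Finset.mem_singleton] at h ⊢
    exact ⟨h.1.2, h.1.1 ▸ h.2⟩
  · rintro ⟨a, b⟩ h ⟨c, d⟩ h' e
    simp only [Finset.mem_filter, Finset.mem_product, Finset.mem_singleton] at h h' e ⊢
    rw [h.1.1, h'.1.1, e]
  · intro b h
    simp only [Finset.mem_filter] at h
    exact ⟨(k, b), by simpa using h, rfl⟩

theorem zero_lt_of_lt {α : Fin m → ℕ} (hα : ∀ i, α i < p ^ t i) :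
    ∀ i, (0 : Fin m → ℕ) i < p ^ t i :=
  fun i => lt_of_le_of_lt (Nat.zero_le _) (hα i)

theorem xi_mul_mon (k : Fin n) (α : Fin m → ℕ) (u : Finset (Fin n)) :
    gen F p n t (Sum.inr k) ⋆ mon F p n t α u =
      if k ∈ u then 0 else extSign F {k} u • mon F p n t α (insert k u) := by
  by_cases hα : ∀ i, α i < p ^ t i
  · rw [gen, mul_mon _ _ _ _ (zero_lt_of_lt hα) hα, dpCoeff_zero_left, one_mul, zero_add,
      Finset.insert_eq]
    simp only [Finset.disjoint_singleton_left, ite_not]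
  · simp [mon_of_not hα]

theorem mon_insert {k : Fin n} (α : Fin m → ℕ) {u : Finset (Fin n)} (hk : k ∉ u) :
    mon F p n t α (insert k u) = extSign F {k} u • (ξ k ⋆ mon F p n t α u) := by
  rw [xi_mul_mon, if_neg hk, smul_smul, extSign_mul_self, one_smul]

/-- Building monomials by left multiplication with one ξ_k at a time reduces sign computations for
arbitrary subsets to the relation between D_k and a single ξ_s. -/
theorem xi_ind {P : Alg F p n t → Prop} (f : Alg F p n t) (zero : P 0)
    (add : ∀ f g, P f → P g → P (f + g)) (smul : ∀ (c : F) f, P f → P (c • f))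
    (mon : ∀ (α : Fin m → ℕ) (_ : ∀ i, α i < p ^ t i), P (mon F p n t α ∅))
    (xi : ∀ (k : Fin n) f, P f → P (ξ k ⋆ f)) : P f := by
  induction f using alg_ind with
  | zero => exact zero
  | add f f' hf hf' => exact add f f' hf hf'
  | smul c f hf => exact smul c f hf
  | mon α hα u =>
  induction u using Finset.induction_on with
  | empty => exact mon α hα
  | insert k u hk ih =>
    rw [mon_insert α hk]
    exact smul _ _ (xi k _ ih)

/-- The Clifford relation D_k ξ_s + ξ_s D_k = δ_ks. Later sign rules for the odd derivatives are
derived from it, without returning to position counts. -/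
theorem partial_inr_xi_mul (k s : Fin n) (f : Alg F p n t) :
    𝔡 (Sum.inr k) (ξ s ⋆ f) = (if k = s then f else 0) - ξ s ⋆ 𝔡 (Sum.inr k) f := by
  induction f using alg_ind with
  | zero => simp
  | add f f' hf hf' =>
    simp only [map_add, hf, hf']
    split_ifs
    · abel
    · abel
  | smul c f hf =>
    simp only [map_smul, hf, smul_sub]
    split_ifs <;> simp
  | mon α hα u =>
  rw [xi_mul_mon, partial_inr_mon]
  by_cases hs : s ∈ u
  · rw [if_pos hs, map_zero]
    by_cases hk : k ∈ u
    · rw [if_pos hk, map_smul, xi_mul_mon]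
      by_cases hks : k = s
      · subst hks
        rw [if_pos rfl, if_neg (Finset.notMem_erase _ _), Finset.insert_erase hk, smul_smul,
          extSign_singleton, Finset.filter_erase, Finset.erase_eq_of_notMem (by simp), ← mul_pow]
        simp
      · rw [if_neg hks, if_pos (Finset.mem_erase.2 ⟨fun h => hks h.symm, hs⟩)]
        simp
    · rw [if_neg hk, if_neg (fun h : k = s => hk (h ▸ hs))]; simp
  · rw [if_neg hs, map_smul, partial_inr_mon]
    by_cases hks : k = s
    · subst hks
      rw [if_pos (Finset.mem_insert_self _ _), if_pos rfl, if_neg hs, map_zero, sub_zero,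
        Finset.erase_insert hs, smul_smul, extSign_singleton, Finset.filter_insert, if_neg
          (lt_irrefl _), ← mul_pow]
      simp
    · by_cases hk : k ∈ u
      · rw [if_pos (Finset.mem_insert_of_mem hk), if_neg hks, if_pos hk, map_smul, xi_mul_mon,
          if_neg (fun h => hs (Finset.mem_of_mem_erase h)), smul_smul, smul_smul, zero_sub,
          ← neg_smul, Finset.erase_insert_of_ne (fun h => hks h.symm)]
        congr 1
        rw [extSign_singleton, extSign_singleton, Finset.filter_insert]
        -- The two operations are done in opposite order, and exactly one of the two position counts
        -- changes by one: that of s loses k if k < s, that of k gains s if s < k.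
        rcases lt_or_gt_of_ne hks with hlt | hlt
        · rw [if_neg (not_lt.2 hlt.le), Finset.filter_erase]
          have h1 : k ∈ u.filter (fun a => a < s) := Finset.mem_filter.2 ⟨hk, hlt⟩
          rw [← Finset.card_erase_add_one h1, pow_succ]
          ring
        · rw [if_pos hlt, Finset.filter_erase, Finset.card_insert_of_notMem (by simp [hs]),
            pow_succ, Finset.erase_eq_of_notMem (by simp [hlt.le])]
          ring
      · have : k ∉ insert s u := by simp [hks, hk]
        rw [if_neg this, if_neg hks, if_neg hk]; simp

theorem partial_inl_xi_mul (i : Fin m) (s : Fin n) (f : Alg F p n t) :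
    𝔡 (Sum.inl i) (ξ s ⋆ f) = ξ s ⋆ 𝔡 (Sum.inl i) f := by
  induction f using alg_ind with
  | zero => simp
  | add f f' hf hf' => simp [hf, hf']
  | smul c f hf => simp [hf]
  | mon α hα u =>
  rw [xi_mul_mon, partial_inl_mon i hα]
  by_cases hs : s ∈ u
  · rw [if_pos hs, map_zero]
    split_ifs
    · simp
    · rw [xi_mul_mon, if_pos hs]
  · rw [if_neg hs, map_smul, partial_inl_mon i hα]
    split_ifs
    · simp
    · rw [xi_mul_mon, if_neg hs]

theorem mon_empty_mem_homog (α : Fin m → ℕ) : mon F p n t α ∅ ∈ homog F p n t 0 := by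
  simpa using mon_mem_homog (F := F) (p := p) (t := t) α (∅ : Finset (Fin n))

theorem xi_mem_homog (k : Fin n) : gen F p n t (Sum.inr k) ∈ homog F p n t 1 :=
  gen_mem_homog (Sum.inr k)

theorem mul_left_comm_of_even {f : Alg F p n t} (hf : f ∈ homog F p n t 0) (g h : Alg F p n t) :
    g ⋆ (f ⋆ h) = f ⋆ (g ⋆ h) := by
  rw [← alg_mul_assoc, ← even_mul_comm hf, alg_mul_assoc]

theorem partial_inr_mon_empty (k : Fin n) (α : Fin m → ℕ) :
    partialD F p n t (Sum.inr k) (mon F p n t α ∅) = 0 := by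
  rw [partial_inr_mon, if_neg (Finset.notMem_empty _)]

theorem partial_inr_mon_empty_mul (k : Fin n) (α : Fin m → ℕ) (g : Alg F p n t) :
    𝔡 (Sum.inr k) (mon F p n t α ∅ ⋆ g) = mon F p n t α ∅ ⋆ 𝔡 (Sum.inr k) g := by
  by_cases hα : ∀ i, α i < p ^ t i
  swap
  · simp [mon_of_not hα]
  induction g using xi_ind with
  | zero => simp
  | add f f' hf hf' => simp [hf, hf']
  | smul c f hf => simp [hf]
  | mon β hβ =>
    rw [mul_mon _ _ _ _ hα hβ, partial_inr_mon_empty]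
    simp [partial_inr_mon_empty]
  | xi s f hf =>
    have h0 := mon_empty_mem_homog (F := F) (p := p) (n := n) (t := t) α
    rw [← mul_left_comm_of_even h0, partial_inr_xi_mul, hf, partial_inr_xi_mul, map_sub,
      mul_left_comm_of_even h0]
    split_ifs <;> simp

theorem partial_inr_mul (k : Fin n) (f g : Alg F p n t) :
    𝔡 (Sum.inr k) (f ⋆ g) = 𝔡 (Sum.inr k) f ⋆ g + twist _ _ _ _ 1 f ⋆ 𝔡 (Sum.inr k) g := by
  induction f using xi_ind with
  | zero => simp
  | add f f' hf hf' => simp only [map_add, LinearMap.add_apply, hf, hf']; abel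
  | smul c f hf => simp [hf]
  | mon α hα =>
    rw [partial_inr_mon_empty_mul, partial_inr_mon_empty, twist_mon]
    simp [sgn_zero_right]
  | xi s f hf =>
    rw [alg_mul_assoc, partial_inr_xi_mul, hf, partial_inr_xi_mul, twist_mul,
      twist_of_mem (xi_mem_homog s), sgn_one_one, map_add]
    simp only [map_sub, map_smul, LinearMap.sub_apply, LinearMap.smul_apply, alg_mul_assoc]
    split_ifs <;> simp <;> abel

/-! ### Leibniz rules for the D_r -/

section CharP

variable [CharP F p] [Fact p.Prime]

/-- Pascal's rule in the i-th binomial factor; the other factors agree in all three terms. -/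
theorem dpCoeff_leibniz (i : Fin m) (α β : Fin m → ℕ) :
    ((if α i = 0 then 0 else dpCoeff F (α - Pi.single i 1) β) +
      (if β i = 0 then 0 else dpCoeff F α (β - Pi.single i 1)) : F) =
      if α i + β i = 0 then 0 else dpCoeff F α β := by
  unfold dpCoeff
  have hsplit : ∀ a b : Fin m → ℕ, (∏ j, (a j + b j).choose (a j) : ℕ) =
      (a i + b i).choose (a i) * ∏ j ∈ Finset.univ.erase i, (a j + b j).choose (a j) := fun a b =>
    (Finset.mul_prod_erase Finset.univ (fun j => (a j + b j).choose (a j))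
      (Finset.mem_univ i)).symm
  have h1 : ∏ j ∈ Finset.univ.erase i, ((α - Pi.single i 1 : Fin m → ℕ) j + β j).choose ((α - Pi.single i 1 : Fin m → ℕ) j)
      = ∏ j ∈ Finset.univ.erase i, (α j + β j).choose (α j) := by
    refine Finset.prod_congr rfl fun j hj => ?_
    simp [Finset.ne_of_mem_erase hj]
  have h2 : ∏ j ∈ Finset.univ.erase i, (α j + (β - Pi.single i 1 : Fin m → ℕ) j).choose (α j)
      = ∏ j ∈ Finset.univ.erase i, (α j + β j).choose (α j) := by
    refine Finset.prod_congr rfl fun j hj => ?_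
    simp [Finset.ne_of_mem_erase hj]
  rw [hsplit, hsplit, hsplit, h1, h2]
  simp only [Pi.sub_apply, Pi.single_eq_same]
  generalize α i = a
  generalize β i = b
  rcases a with _ | a <;> rcases b with _ | b
  · simp
  · simp
  · simp
  · have : (a + 1 + (b + 1)).choose (a + 1) = (a + (b + 1)).choose a +
        (a + 1 + b).choose (a + 1) := by
      rw [show a + 1 + (b + 1) = (a + b + 1) + 1 by ring, Nat.choose_succ_succ,
        show a + (b + 1) = a + b + 1 by ring, show a + 1 + b = a + b + 1 by ring]
    simp [this, add_mul]

theorem partial_inl_mon_empty_mul (i : Fin m) (α : Fin m → ℕ) (hα : ∀ i, α i < p ^ t i)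
    (g : Alg F p n t) : 𝔡 (Sum.inl i) (mon F p n t α ∅ ⋆ g) =
      𝔡 (Sum.inl i) (mon F p n t α ∅) ⋆ g + mon F p n t α ∅ ⋆ 𝔡 (Sum.inl i) g := by
  induction g using alg_ind with
  | zero => simp
  | add f f' hf hf' => simp only [map_add, hf, hf']; abel
  | smul c f hf => simp [hf]
  | mon β hβ v =>
    have hle : ∀ (γ : Fin m → ℕ), (∀ i, γ i < p ^ t i) →
        ∀ j, (γ - Pi.single i 1 : Fin m → ℕ) j < p ^ t j :=
      fun γ hγ j => lt_of_le_of_lt (Nat.sub_le _ _) (hγ j)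
    have hmul : ∀ a b : Fin m → ℕ, (∀ i, a i < p ^ t i) → (∀ i, b i < p ^ t i) →
        mon F p n t a ∅ ⋆ mon F p n t b v = dpCoeff F a b • mon F p n t (a + b) v := by
      intro a b ha hb
      rw [mul_mon _ _ _ _ ha hb]
      simp [extSign_empty_left]
    have e1 : (if α i = 0 then (0 : Alg F p n t) else mon F p n t (α - Pi.single i 1) ∅) ⋆
        mon F p n t β v = (if α i = 0 then 0 else dpCoeff F (α - Pi.single i 1) β) •
          mon F p n t (α + β - Pi.single i 1) v := by
      split_ifs with h
      · simp
      · rw [hmul _ _ (hle α hα) hβ]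
        congr 2
        rw [tsub_add_eq_add_tsub]
        intro j
        by_cases hj : j = i
        · subst hj; simp; omega
        · simp [hj]
    have e2 : mon F p n t α ∅ ⋆ (if β i = 0 then (0 : Alg F p n t) else
        mon F p n t (β - Pi.single i 1) v) =
        (if β i = 0 then 0 else dpCoeff F α (β - Pi.single i 1)) •
          mon F p n t (α + β - Pi.single i 1) v := by
      split_ifs with h
      · simp
      · rw [hmul _ _ hα (hle β hβ)]
        congr 2
        rw [add_tsub_assoc_of_le]
        intro j
        by_cases hj : j = i
        · subst hj; simp; omega
        · simp [hj]
    rw [partial_inl_mon i hα, partial_inl_mon i hβ, e1, e2, ← add_smul, dpCoeff_leibniz,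
      hmul α β hα hβ, map_smul]
    by_cases hall : ∀ j, (α + β) j < p ^ t j
    · rw [partial_inl_mon i hall, Pi.add_apply]
      split_ifs <;> simp
    -- The characteristic is needed here: when α_i + β_i = p^t_i the product on the left is zero,
    -- although α + β - ε_i may be in range, so the right side must vanish through its coefficient.
    · rw [dpCoeff_eq_zero F p (Fact.out) t α β hα hβ hall]
      simp

theorem partial_inl_mul (i : Fin m) (f g : Alg F p n t) :
    𝔡 (Sum.inl i) (f ⋆ g) = 𝔡 (Sum.inl i) f ⋆ g + f ⋆ 𝔡 (Sum.inl i) g := by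
  induction f using xi_ind with
  | zero => simp
  | add f f' hf hf' => simp only [map_add, LinearMap.add_apply, hf, hf']; abel
  | smul c f hf => simp [hf]
  | mon α hα => exact partial_inl_mon_empty_mul i α hα g
  | xi s f hf =>
    rw [alg_mul_assoc, partial_inl_xi_mul, hf, partial_inl_xi_mul, map_add, alg_mul_assoc,
      alg_mul_assoc]

theorem partial_mul (r : Var m n) (f g : Alg F p n t) :
    𝔡 r (f ⋆ g) = 𝔡 r f ⋆ g + twist _ _ _ _ (tau r) f ⋆ 𝔡 r g := by
  rcases r with i | k
  · rw [partial_inl_mul, tau, Sum.elim_inl, twist_zero]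
  · exact partial_inr_mul k f g

end CharP

/-! ### Commutation, parity and coefficients of the D_r -/

theorem partial_inl_comm (i j : Fin m) (f : Alg F p n t) :
    𝔡 (Sum.inl i) (𝔡 (Sum.inl j) f) = 𝔡 (Sum.inl j) (𝔡 (Sum.inl i) f) := by
  induction f using alg_ind with
  | zero => simp
  | add f f' hf hf' => simp [hf, hf']
  | smul c f hf => simp [hf]
  | mon α hα u =>
  by_cases hij : i = j
  · rw [hij]
  have hle : ∀ i, ∀ j, (α - Pi.single i 1 : Fin m → ℕ) j < p ^ t j :=
    fun i j => lt_of_le_of_lt (Nat.sub_le _ _) (hα j)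
  rw [partial_inl_mon i hα, partial_inl_mon j hα, apply_ite (partialD F p n t (Sum.inl i)),
    apply_ite (partialD F p n t (Sum.inl j)), map_zero, map_zero, partial_inl_mon i (hle j),
    partial_inl_mon j (hle i), tsub_right_comm]
  simp only [Pi.sub_apply, Pi.single_eq_of_ne hij, Pi.single_eq_of_ne (Ne.symm hij), Nat.sub_zero]
  split_ifs <;> rfl

theorem partial_inl_inr_comm (i : Fin m) (k : Fin n) (f : Alg F p n t) :
    𝔡 (Sum.inl i) (𝔡 (Sum.inr k) f) = 𝔡 (Sum.inr k) (𝔡 (Sum.inl i) f) := by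
  induction f using alg_ind with
  | zero => simp
  | add f f' hf hf' => simp [hf, hf']
  | smul c f hf => simp [hf]
  | mon α hα u =>
  rw [partial_inl_mon i hα, partial_inr_mon, apply_ite (partialD F p n t (Sum.inl i)),
    apply_ite (partialD F p n t (Sum.inr k)), map_zero, map_zero, partial_inr_mon, map_smul,
    partial_inl_mon i hα]
  split_ifs <;> simp

theorem partial_inr_anticomm (k l : Fin n) (f : Alg F p n t) :
    𝔡 (Sum.inr k) (𝔡 (Sum.inr l) f) = -𝔡 (Sum.inr l) (𝔡 (Sum.inr k) f) := by
  induction f using xi_ind with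
  | zero => simp
  | add f f' hf hf' => simp only [map_add, hf, hf']; abel
  | smul c f hf => simp [hf]
  | mon α hα => simp [partial_inr_mon_empty]
  | xi s f hf =>
    rw [partial_inr_xi_mul, partial_inr_xi_mul, map_sub, map_sub, partial_inr_xi_mul,
      partial_inr_xi_mul, hf, apply_ite (partialD F p n t (Sum.inr k)),
      apply_ite (partialD F p n t (Sum.inr l)), map_zero, map_zero, map_neg]
    abel

theorem partial_comm (r s : Var m n) (f : Alg F p n t) :
    𝔡 r (𝔡 s f) = sgn F (tau r) (tau s) • 𝔡 s (𝔡 r f) := by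
  rcases r with i | k <;> rcases s with j | l
  · simp [tau, sgn_zero_left, partial_inl_comm i j]
  · simp [tau, sgn_zero_left, partial_inl_inr_comm]
  · simp [tau, sgn_zero_right, partial_inl_inr_comm]
  · simp [tau, sgn_one_one, partial_inr_anticomm k l]

theorem partial_twist (θ : ZMod 2) (r : Var m n) (f : Alg F p n t) :
    𝔡 r (twist _ _ _ _ θ f) = sgn F θ (tau r) • twist _ _ _ _ θ (𝔡 r f) := by
  induction f using alg_ind with
  | zero => simp
  | add f f' hf hf' => simp [hf, hf']
  | smul c f hf => simp [hf, smul_comm c]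
  | mon α hα u =>
  rcases r with i | k
  · rw [twist_mon, map_smul, partial_inl_mon i hα]
    split_ifs
    · simp
    · rw [twist_mon]; simp [tau, sgn_zero_right]
  · rw [twist_mon, map_smul, partial_inr_mon]
    split_ifs with h
    · rw [map_smul, twist_mon, smul_smul, smul_smul, smul_smul]
      congr 1
      rw [← Finset.card_erase_add_one h, Nat.cast_add, sgn_add_right]
      simp [tau]; ring
    · simp

theorem partial_mem_homog {θ : ZMod 2} {f : Alg F p n t} (r : Var m n)
    (hf : f ∈ homog F p n t θ) : 𝔡 r f ∈ homog F p n t (θ + tau r) := by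
  refine homog_ind (P := fun f => 𝔡 r f ∈ homog F p n t (θ + tau r)) hf (by simp) ?_ ?_ ?_
  · intro f f' h h'
    rw [map_add]; exact Submodule.add_mem _ h h'
  · intro c f h
    rw [map_smul]; exact Submodule.smul_mem _ c h
  intro α hα u hu
  rcases r with i | k
  · rw [partial_inl_mon i hα]
    split_ifs
    · simp
    · rw [← hu]; simpa [tau] using mon_mem_homog _ _
  · rw [partial_inr_mon]
    split_ifs with h
    · refine Submodule.smul_mem _ _ ?_
      have : θ + tau (Sum.inr k : Var m n) = ((u.erase k).card : ZMod 2) := by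
        rw [← hu, ← Finset.card_erase_add_one h, tau, Sum.elim_inr, Nat.cast_add, Nat.cast_one,
          add_assoc, show (1 + 1 : ZMod 2) = 0 by decide, add_zero]
      rw [this]
      exact mon_mem_homog _ _
    · simp

theorem partial_inl_coeff (i : Fin m) (f : Alg F p n t) (α : Fin m → ℕ) (hα : ∀ i, α i < p ^ t i)
    (u : Finset (Fin n)) : partialD F p n t (Sum.inl i) f (⟨α, hα⟩, u) =
      if h : ∀ j, (α + Pi.single i 1 : Fin m → ℕ) j < p ^ t j then f (⟨α + Pi.single i 1, h⟩, u) else 0 := by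
  induction f using alg_ind with
  | zero => simp
  | add f f' hf hf' =>
    simp only [map_add, hf, hf', Finsupp.add_apply]
    split_ifs <;> simp
  | smul c f hf =>
    simp only [map_smul, hf, Finsupp.smul_apply]
    split_ifs <;> simp
  | mon β hβ v =>
    have hle : ∀ j, (β - Pi.single i 1 : Fin m → ℕ) j < p ^ t j :=
      fun j => lt_of_le_of_lt (Nat.sub_le _ _) (hβ j)
    rw [partial_inl_mon i hβ, mon_of_mem hle, mon_of_mem hβ]
    have key : β i ≠ 0 → (β - Pi.single i 1 = α ↔ β = α + Pi.single i 1) := by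
      intro h
      refine tsub_eq_iff_eq_add_of_le ?_
      intro j
      by_cases hj : j = i
      · subst hj; simp; omega
      · simp [hj]
    by_cases h0 : β i = 0
    · rw [if_pos h0]
      split_ifs with h
      · rw [Finsupp.single_apply, if_neg]
        · rfl
        · intro h'
          have h2 := congrArg (fun x => x.1.1 i) h'
          simp [h0] at h2
      · rfl
    · rw [if_neg h0, Finsupp.single_apply]
      split_ifs with h1 h2 h2
      · rw [Prod.mk.injEq, Subtype.mk.injEq, key h0] at h1
        rw [Finsupp.single_apply, if_pos]
        simp [h1]
      · rw [Prod.mk.injEq, Subtype.mk.injEq, key h0] at h1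
        rw [h1.1] at hβ
        exact absurd hβ h2
      · rw [Finsupp.single_apply, if_neg]
        intro h'
        rw [Prod.mk.injEq, Subtype.mk.injEq, ← key h0] at h'
        exact h1 (by simp [h'])
      · rfl


/-! ### Even vector fields -/

theorem end_lie_apply (A B : Module.End F (Alg F p n t)) (f : Alg F p n t) :
    ⁅A, B⁆ f = A (B f) - B (A f) := rfl

theorem mulD_apply (r : Var m n) (f g : Alg F p n t) : mulD F p n t r f g = f ⋆ 𝔡 r g := rfl

theorem vectorField_apply (f : Var m n → Alg F p n t) (g : Alg F p n t) :
    vectorField F p n t f g = ∑ r, f r ⋆ 𝔡 r g := by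
  simp [vectorField, LinearMap.sum_apply, mulD_apply]

theorem vectorField_single (r : Var m n) (f : Alg F p n t) :
    vectorField F p n t (Pi.single r f) = mulD F p n t r f := by
  refine LinearMap.ext fun g => ?_
  rw [vectorField_apply, Finset.sum_eq_single r, Pi.single_eq_same, mulD_apply]
  · intro s _ hs
    simp [Pi.single_eq_of_ne hs]
  · simp

variable (F p n t) in
/-- The even vector fields `∑ f_r D_r`, with `f_r` of the parity of the variable `r`. -/
noncomputable def evenFields : Submodule F (Module.End F (Alg F p n t)) :=
  (Submodule.pi Set.univ (fun r : Var m n => homog F p n t (tau r))).map (vectorField F p n t)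

theorem mem_evenFields_iff_exists {E : Module.End F (Alg F p n t)} :
    E ∈ evenFields F p n t ↔
      ∃ f, (∀ r, f r ∈ homog F p n t (tau r)) ∧ vectorField F p n t f = E := by
  simp [evenFields, Submodule.mem_map, Submodule.mem_pi]

theorem mulD_mem_evenFields {r : Var m n} {f : Alg F p n t} (hf : f ∈ homog F p n t (tau r)) :
    mulD F p n t r f ∈ evenFields F p n t := by
  rw [mem_evenFields_iff_exists]
  refine ⟨Pi.single r f, fun s => ?_, vectorField_single r f⟩
  by_cases h : s = r
  · subst h; rwa [Pi.single_eq_same]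
  · rw [Pi.single_eq_of_ne h]; exact Submodule.zero_mem _

theorem mul_twist_mul {r : Var m n} {f : Alg F p n t} (hf : f ∈ homog F p n t (tau r))
    (g h : Alg F p n t) : f ⋆ (twist _ _ _ _ (tau r) g ⋆ h) = g ⋆ (f ⋆ h) := by
  rw [← alg_mul_assoc, mul_twist_comm hf, alg_mul_assoc]

theorem evenField_mem_homog {E : Module.End F (Alg F p n t)} (hE : E ∈ evenFields F p n t)
    {μ : ZMod 2} {f : Alg F p n t} (hf : f ∈ homog F p n t μ) : E f ∈ homog F p n t μ := by
  obtain ⟨f', hf', rfl⟩ := mem_evenFields_iff_exists.1 hE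
  rw [vectorField_apply]
  refine Submodule.sum_mem _ fun r _ => ?_
  have := mul_mem_homog (hf' r) (partial_mem_homog r hf)
  have h2 : ∀ a b : ZMod 2, a + (b + a) = b := by decide
  rwa [h2] at this

theorem evenFields_le_plPart : evenFields F p n t ≤ plPart F p n t 0 := by
  intro E hE μ f hf
  rw [zero_add]
  exact evenField_mem_homog hE hf

theorem partialD_eq_mulD (r : Var m n) : partialD F p n t r = mulD F p n t r (one F p n t) := by
  refine LinearMap.ext fun g => ?_
  rw [mulD_apply, one_mul']

theorem partial_inl_mem_evenFields (i : Fin m) :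
    partialD F p n t (Sum.inl i) ∈ evenFields F p n t := by
  rw [partialD_eq_mulD]
  exact mulD_mem_evenFields one_mem_homog

/-- The sign from moving D_s past f_r, of parity τ(r), is the sign from exchanging D_s and D_r, so
an even field and D_s have a commutator without signs. -/
theorem evenField_partial {E : Module.End F (Alg F p n t)} (f : Var m n → Alg F p n t)
    (hf : ∀ r, f r ∈ homog F p n t (tau r)) (hE : vectorField F p n t f = E)
    [CharP F p] [Fact p.Prime] (s : Var m n) (g : Alg F p n t) :
    E (𝔡 s g) = 𝔡 s (E g) - ∑ r, 𝔡 s (f r) ⋆ 𝔡 r g := by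
  subst hE
  rw [vectorField_apply, vectorField_apply, map_sum, ← Finset.sum_sub_distrib]
  refine Finset.sum_congr rfl fun r _ => ?_
  rw [partial_mul, add_sub_cancel_left, twist_of_mem (hf r), partial_comm r s, sgn_comm, map_smul,
    map_smul, LinearMap.smul_apply]

variable (F p n t) in
/-- The divergence of a vector field, as a function of the operator. -/
noncomputable def dv : Module.End F (Alg F p n t) →ₗ[F] Alg F p n t :=
  (divergence F p n t).comp (LinearMap.pi fun r => LinearMap.applyₗ (gen F p n t r))

theorem dv_apply (E : Module.End F (Alg F p n t)) :
    dv F p n t E = ∑ r, 𝔡 r (twist _ _ _ _ (tau r) (E (gen F p n t r))) := by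
  simp [dv, divergence, LinearMap.sum_apply]

theorem Drs_eq_vectorField (r s : Var m n) (f : Alg F p n t) :
    Drs F p n t r s f = vectorField F p n t
      (Pi.single s (sgn F (tau r) (tau s) • 𝔡 r f) -
        Pi.single r (𝔡 s (twist _ _ _ _ (tau r + tau s) f))) := by
  rw [map_sub, vectorField_single, vectorField_single, map_smul, Drs]

theorem twist_partial (θ : ZMod 2) (r : Var m n) (f : Alg F p n t) :
    twist _ _ _ _ θ (𝔡 r f) = sgn F θ (tau r) • 𝔡 r (twist _ _ _ _ θ f) := by
  rw [partial_twist, smul_smul, sgn_mul_self, one_smul]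

/-! ### Even fields as derivations of 𝔄, closed under the bracket -/

section

variable [CharP F p] [Fact p.Prime]

/-- The coefficient of D_r has the parity of D_r; moving it past the twisted first factor undoes the
twist in the superderivation rule. -/
theorem evenField_mul {E : Module.End F (Alg F p n t)} (hE : E ∈ evenFields F p n t)
    (f g : Alg F p n t) : E (f ⋆ g) = E f ⋆ g + f ⋆ E g := by
  obtain ⟨f', hf', rfl⟩ := mem_evenFields_iff_exists.1 hE
  rw [vectorField_apply, vectorField_apply, vectorField_apply, map_sum, map_sum,
    LinearMap.sum_apply, ← Finset.sum_add_distrib]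
  refine Finset.sum_congr rfl fun r _ => ?_
  rw [partial_mul, map_add, alg_mul_assoc, mul_twist_mul (hf' r)]

theorem lie_mulD_apply {E : Module.End F (Alg F p n t)} (f : Var m n → Alg F p n t)
    (hf : ∀ r, f r ∈ homog F p n t (tau r)) (hE : vectorField F p n t f = E)
    (g : Var m n → Alg F p n t) :
    ⁅E, vectorField F p n t g⁆ =
      vectorField F p n t (fun r => E (g r) - vectorField F p n t g (f r)) := by
  refine LinearMap.ext fun h => ?_
  have hE' : E ∈ evenFields F p n t := mem_evenFields_iff_exists.2 ⟨f, hf, hE⟩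
  rw [end_lie_apply, vectorField_apply g h, map_sum, vectorField_apply _ h,
    vectorField_apply g (E h)]
  simp only [evenField_mul hE', evenField_partial f hf hE, map_sub, LinearMap.sub_apply, map_sum]
  rw [Finset.sum_add_distrib, Finset.sum_sub_distrib, Finset.sum_sub_distrib]
  have : ∑ r, vectorField F p n t g (f r) ⋆ 𝔡 r h = ∑ s, ∑ r, g s ⋆ (𝔡 s (f r) ⋆ 𝔡 r h) := by
    rw [Finset.sum_comm]
    refine Finset.sum_congr rfl fun r _ => ?_
    rw [vectorField_apply, map_sum, LinearMap.sum_apply]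
    simp only [alg_mul_assoc]
  rw [this]
  abel

theorem lie_mem_evenFields {E E' : Module.End F (Alg F p n t)} (hE : E ∈ evenFields F p n t)
    (hE' : E' ∈ evenFields F p n t) : ⁅E, E'⁆ ∈ evenFields F p n t := by
  obtain ⟨f, hf, rfl⟩ := mem_evenFields_iff_exists.1 hE
  obtain ⟨g, hg, rfl⟩ := mem_evenFields_iff_exists.1 hE'
  rw [lie_mulD_apply f hf rfl g, mem_evenFields_iff_exists]
  exact ⟨_, fun r => Submodule.sub_mem _ (evenField_mem_homog hE (hg r))
    (evenField_mem_homog hE' (hf r)), rfl⟩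

theorem evenFields_le_superDer : evenFields F p n t ≤ superDer F p n t 0 := by
  intro E hE
  refine ⟨evenFields_le_plPart hE, fun μ f _ g => ?_⟩
  rw [sgn_zero_left, one_smul, evenField_mul hE]

variable [Fact (∀ i, 1 ≤ t i)]

theorem one_lt_pow (i : Fin m) : 1 < p ^ t i :=
  Nat.one_lt_pow (Nat.one_le_iff_ne_zero.1 (Fact.out (p := ∀ i, 1 ≤ t i) i))
    (Fact.out (p := p.Prime)).one_lt

theorem zero_range : ∀ i, (0 : Fin m → ℕ) i < p ^ t i :=
  fun i => (Nat.zero_lt_one.trans (one_lt_pow i))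

theorem single_range (i : Fin m) : ∀ j, (Pi.single i 1 : Fin m → ℕ) j < p ^ t j := by
  intro j
  by_cases h : j = i
  · subst h; rw [Pi.single_eq_same]; exact one_lt_pow j
  · rw [Pi.single_eq_of_ne h]; exact zero_range j

theorem partial_gen (r s : Var m n) :
    𝔡 r (gen F p n t s) = if r = s then one F p n t else 0 := by
  rcases s with j | l <;> rcases r with i | k
  · rw [gen, partial_inl_mon _ (single_range j)]
    by_cases h : i = j
    · subst h; simp [one]
    · simp [h]
  · rw [gen, partial_inr_mon_empty]; simp
  · rw [gen, partial_inl_mon _ zero_range]; simp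
  · have := partial_inr_xi_mul (F := F) (p := p) (t := t) k l (one F p n t)
    rw [mul_one', one, partial_inr_mon_empty, map_zero, sub_zero] at this
    rw [this]
    simp [one]

theorem vectorField_gen (f : Var m n → Alg F p n t) (r : Var m n) :
    vectorField F p n t f (gen F p n t r) = f r := by
  rw [vectorField_apply, Finset.sum_eq_single r]
  · rw [partial_gen, if_pos rfl, mul_one']
  · intro s _ hs
    rw [partial_gen, if_neg hs, map_zero]
  · simp

theorem mulD_gen (r s : Var m n) (f : Alg F p n t) :
    mulD F p n t r f (gen F p n t s) = if r = s then f else 0 := by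
  rw [mulD_apply, partial_gen]
  split_ifs
  · exact mul_one' f
  · exact map_zero _

theorem mem_evenFields_iff {E : Module.End F (Alg F p n t)} :
    E ∈ evenFields F p n t ↔ (∀ r, E (gen F p n t r) ∈ homog F p n t (tau r)) ∧
      E = vectorField F p n t (fun r => E (gen F p n t r)) := by
  rw [mem_evenFields_iff_exists]
  constructor
  · rintro ⟨f, hf, rfl⟩
    simp only [vectorField_gen]
    exact ⟨hf, trivial⟩
  · intro h
    exact ⟨_, h.1, h.2.symm⟩

theorem evenFields_ext {E E' : Module.End F (Alg F p n t)} (hE : E ∈ evenFields F p n t)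
    (hE' : E' ∈ evenFields F p n t) (h : ∀ r, E (gen F p n t r) = E' (gen F p n t r)) :
    E = E' := by
  rw [(mem_evenFields_iff.1 hE).2, (mem_evenFields_iff.1 hE').2]
  simp only [h]

theorem evenField_apply {E : Module.End F (Alg F p n t)} (hE : E ∈ evenFields F p n t)
    (g : Alg F p n t) : E g = ∑ r, E (gen F p n t r) ⋆ 𝔡 r g := by
  conv_lhs => rw [(mem_evenFields_iff.1 hE).2]
  rw [vectorField_apply]

theorem evenField_partial' {E : Module.End F (Alg F p n t)} (hE : E ∈ evenFields F p n t)
    (s : Var m n) (g : Alg F p n t) :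
    E (𝔡 s g) = 𝔡 s (E g) - ∑ r, 𝔡 s (E (gen F p n t r)) ⋆ 𝔡 r g :=
  evenField_partial _ (mem_evenFields_iff.1 hE).1 (mem_evenFields_iff.1 hE).2.symm s g

/-! ### The divergence -/

theorem dv_evenField {E : Module.End F (Alg F p n t)} (hE : E ∈ evenFields F p n t) :
    dv F p n t E = ∑ r, sgn F (tau r) (tau r) • 𝔡 r (E (gen F p n t r)) := by
  rw [dv_apply]
  refine Finset.sum_congr rfl fun r _ => ?_
  rw [twist_of_mem ((mem_evenFields_iff.1 hE).1 r), map_smul]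

/-- Integration by parts. Applied to both terms of a bracket, it produces the first-order
expressions that make up the D_rs. -/
theorem evenField_apply_eq_sub {E : Module.End F (Alg F p n t)} (hE : E ∈ evenFields F p n t)
    (g : Alg F p n t) : E g =
      ∑ r, sgn F (tau r) (tau r) • 𝔡 r (E (gen F p n t r) ⋆ g) - dv F p n t E ⋆ g := by
  rw [evenField_apply hE, dv_evenField hE, map_sum, LinearMap.sum_apply, ← Finset.sum_sub_distrib]
  refine Finset.sum_congr rfl fun r _ => ?_
  rw [partial_mul, twist_of_mem ((mem_evenFields_iff.1 hE).1 r), map_smul, map_smul,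
    LinearMap.smul_apply, LinearMap.smul_apply, smul_add, smul_smul, sgn_mul_self, one_smul]
  abel

theorem dv_lie {E E' : Module.End F (Alg F p n t)} (hE : E ∈ evenFields F p n t)
    (hE' : E' ∈ evenFields F p n t) :
    dv F p n t ⁅E, E'⁆ = E (dv F p n t E') - E' (dv F p n t E) := by
  rw [dv_evenField (lie_mem_evenFields hE hE'), dv_evenField hE, dv_evenField hE', map_sum, map_sum]
  simp only [end_lie_apply, map_smul, evenField_partial' hE, evenField_partial' hE', map_sub,
    smul_sub, Finset.sum_sub_distrib]
  -- The supertrace of the product of the two Jacobian matrices is symmetric, so the terms with two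
  -- first derivatives cancel.
  have : ∑ r, sgn F (tau r) (tau r) • ∑ s, 𝔡 r (E (gen F p n t s)) ⋆ 𝔡 s (E' (gen F p n t r)) =
      ∑ r, sgn F (tau r) (tau r) • ∑ s, 𝔡 r (E' (gen F p n t s)) ⋆ 𝔡 s (E (gen F p n t r)) := by
    simp only [Finset.smul_sum]
    rw [Finset.sum_comm]
    refine Finset.sum_congr rfl fun s _ => Finset.sum_congr rfl fun r _ => ?_
    have h1 := partial_mem_homog r ((mem_evenFields_iff.1 hE).1 s)
    have h2 := partial_mem_homog s ((mem_evenFields_iff.1 hE').1 r)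
    rw [mul_comm_twist h1, twist_of_mem h2, map_smul, LinearMap.smul_apply, smul_smul]
    congr 1
    rcases zmod_two_cases (tau r) with h | h <;> rcases zmod_two_cases (tau s) with h' | h' <;>
      simp [h, h', sgn_zero_right, sgn_one_one,
        show (1 + 1 : ZMod 2) = 0 by decide]
  rw [this]
  abel

/-! ### The operators `D_rs(f)` -/

theorem Drs_gen (r s q : Var m n) (f : Alg F p n t) :
    Drs F p n t r s f (gen F p n t q) =
      sgn F (tau r) (tau s) • (if s = q then 𝔡 r f else 0) -
        if r = q then 𝔡 s (twist _ _ _ _ (tau r + tau s) f) else 0 := by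
  rw [Drs, LinearMap.sub_apply, LinearMap.smul_apply, mulD_gen, mulD_gen]

/-- The two contributions are the same mixed second derivative, once at s and once at r, with
opposite signs. -/
theorem dv_Drs (r s : Var m n) (f : Alg F p n t) : dv F p n t (Drs F p n t r s f) = 0 := by
  rw [dv_apply]
  have h1 : ∀ q, 𝔡 q (twist _ _ _ _ (tau q) (Drs F p n t r s f (gen F p n t q))) =
      (if s = q then 𝔡 s (𝔡 r (twist _ _ _ _ (tau s) f)) else 0) -
        (if r = q then 𝔡 s (𝔡 r (twist _ _ _ _ (tau s) f)) else 0) := by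
    intro q
    have h2 : ∀ a b : ZMod 2, a + (a + b) = b := by decide
    rw [Drs_gen, map_sub, map_sub]
    congr 1
    · split_ifs with h
      · subst h
        rw [map_smul, map_smul, twist_partial, map_smul, smul_smul, sgn_comm, sgn_mul_self,
          one_smul]
      · simp
    · split_ifs with h
      · subst h
        rw [twist_partial, map_smul, ← twist_add_apply, h2, partial_comm r s, smul_smul,
          sgn_mul_self, one_smul]
      · simp
  simp only [h1, Finset.sum_sub_distrib, Finset.sum_ite_eq, Finset.mem_univ, if_true, sub_self]

theorem Drs_mem_evenFields {r s : Var m n} {f : Alg F p n t}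
    (hf : f ∈ homog F p n t (tau r + tau s)) : Drs F p n t r s f ∈ evenFields F p n t := by
  have h1 : ∀ a b : ZMod 2, a + b + a = b := by decide
  have h2 : ∀ a b : ZMod 2, a + b + b = a := by decide
  refine Submodule.sub_mem _ (Submodule.smul_mem _ _ (mulD_mem_evenFields ?_))
    (mulD_mem_evenFields ?_)
  · have := partial_mem_homog r hf
    rwa [h1] at this
  · rw [twist_of_mem hf, map_smul]
    have := partial_mem_homog s hf
    rw [h2] at this
    exact Submodule.smul_mem _ _ this

theorem mem_evenSbar {E : Module.End F (Alg F p n t)} :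
    E ∈ evenSbar F p n t ↔ E ∈ evenFields F p n t ∧ dv F p n t E = 0 := by
  rw [evenSbar, Submodule.mem_inf]
  constructor
  · rintro ⟨⟨f, hf, rfl⟩, h⟩
    refine ⟨mem_evenFields_iff_exists.2 ⟨f, fun r => ?_, rfl⟩, ?_⟩
    · have := h (tau r) _ (gen_mem_homog r)
      rwa [zero_add, vectorField_gen] at this
    · rw [dv, LinearMap.comp_apply]
      have : (LinearMap.pi fun r => LinearMap.applyₗ (gen F p n t r))
          (vectorField F p n t f) = f := by
        funext r
        simp [vectorField_gen]
      rw [this]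
      exact hf
  · rintro ⟨h1, h2⟩
    exact ⟨⟨_, h2, (mem_evenFields_iff.1 h1).2.symm⟩, evenFields_le_plPart h1⟩

theorem evenS_le_evenSbar : evenS F p n t ≤ evenSbar F p n t := by
  refine inf_le_inf_right _ (Submodule.span_le.2 ?_)
  rintro E ⟨r, s, f, rfl⟩
  refine ⟨_, ?_, (Drs_eq_vectorField r s f).symm⟩
  have h1 := dv_Drs r s f
  rw [Drs_eq_vectorField, dv, LinearMap.comp_apply] at h1
  have h2 : ∀ g, (LinearMap.pi fun r => LinearMap.applyₗ (gen F p n t r))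
      (vectorField F p n t g) = g := by
    intro g
    funext r
    simp [vectorField_gen]
  rwa [h2] at h1

theorem Drs_mem_evenS {r s : Var m n} {f : Alg F p n t}
    (hf : f ∈ homog F p n t (tau r + tau s)) : Drs F p n t r s f ∈ evenS F p n t :=
  ⟨Submodule.subset_span ⟨r, s, f, rfl⟩, evenFields_le_plPart (Drs_mem_evenFields hf)⟩

theorem evenS_le_evenFields : evenS F p n t ≤ evenFields F p n t :=
  fun _ h => (mem_evenSbar.1 (evenS_le_evenSbar h)).1

/-- Evaluate at x_q and integrate by parts in both E(E'(x_q)) and E'(E(x_q)). The boundary terms are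
the coefficients of the D_rs, and the divergence of E leaves the term with c. This gives the ideal
property also for fields of constant nonzero divergence, such as those in 𝒯. -/
theorem lie_eq_sum_Drs {E E' : Module.End F (Alg F p n t)} (hE : E ∈ evenFields F p n t)
    (hE' : E' ∈ evenFields F p n t) {c : F} (hd : dv F p n t E = c • one F p n t)
    (hd' : dv F p n t E' = 0) :
    ⁅E, E'⁆ = ∑ r, ∑ s, (sgn F (tau r) (tau s) * sgn F (tau r) (tau r)) •
      Drs F p n t r s (E (gen F p n t r) ⋆ E' (gen F p n t s)) - c • E' := by
  have hf := (mem_evenFields_iff.1 hE).1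
  have hg := (mem_evenFields_iff.1 hE').1
  refine evenFields_ext (lie_mem_evenFields hE hE') (Submodule.sub_mem _
    (Submodule.sum_mem _ fun r _ => Submodule.sum_mem _ fun s _ => Submodule.smul_mem _ _
      (Drs_mem_evenFields (mul_mem_homog (hf r) (hg s)))) (Submodule.smul_mem _ _ hE')) fun q => ?_
  rw [end_lie_apply, evenField_apply_eq_sub hE (E' _), evenField_apply_eq_sub hE' (E _), hd, hd',
    LinearMap.sub_apply, LinearMap.smul_apply, LinearMap.sum_apply]
  simp only [LinearMap.sum_apply, LinearMap.smul_apply, Drs_gen, smul_sub,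
    Finset.sum_sub_distrib, map_zero, LinearMap.zero_apply, sub_zero, map_smul, one_mul']
  have h1 : ∀ r, ∑ s, (sgn F (tau r) (tau s) * sgn F (tau r) (tau r)) • sgn F (tau r) (tau s) •
      (if s = q then 𝔡 r (E (gen F p n t r) ⋆ E' (gen F p n t s)) else 0) =
      sgn F (tau r) (tau r) • 𝔡 r (E (gen F p n t r) ⋆ E' (gen F p n t q)) := by
    intro r
    rw [Finset.sum_eq_single q]
    · rw [if_pos rfl, smul_smul]
      congr 1
      linear_combination sgn F (tau r) (tau r) * sgn_mul_self (F := F) (tau r) (tau q)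
    · intro s _ hs
      simp [hs]
    · simp
  have h2 : ∑ r, ∑ s, (sgn F (tau r) (tau s) * sgn F (tau r) (tau r)) •
      (if r = q then 𝔡 s (twist F p n t (tau r + tau s)
        (E (gen F p n t r) ⋆ E' (gen F p n t s))) else 0) =
      ∑ s, sgn F (tau s) (tau s) • 𝔡 s (E' (gen F p n t s) ⋆ E (gen F p n t q)) := by
    rw [Finset.sum_eq_single q]
    · refine Finset.sum_congr rfl fun s _ => ?_
      rw [if_pos rfl, twist_of_mem (mul_mem_homog (hf q) (hg s)), mul_comm_twist (hf q),
        twist_of_mem (hg s)]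
      simp only [map_smul, LinearMap.smul_apply, smul_smul]
      congr 1
      rcases zmod_two_cases (tau q) with h | h <;> rcases zmod_two_cases (tau s) with h' | h' <;>
        simp [h, h', sgn_zero_right, sgn_zero_left, sgn_one_one,
          show (1 + 1 : ZMod 2) = 0 by decide]
    · intro r _ hr
      simp [hr]
    · simp
  rw [Finset.sum_congr rfl fun r _ => h1 r, h2]
  abel

theorem lie_mem_evenS {E E' : Module.End F (Alg F p n t)} (hE : E ∈ evenFields F p n t)
    {c : F} (hd : dv F p n t E = c • one F p n t) (hE' : E' ∈ evenS F p n t) :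
    ⁅E, E'⁆ ∈ evenS F p n t := by
  have h := mem_evenSbar.1 (evenS_le_evenSbar hE')
  rw [lie_eq_sum_Drs hE h.1 hd h.2]
  exact Submodule.sub_mem _ (Submodule.sum_mem _ fun r _ => Submodule.sum_mem _ fun s _ =>
    Submodule.smul_mem _ _ (Drs_mem_evenS (mul_mem_homog ((mem_evenFields_iff.1 hE).1 r)
      ((mem_evenFields_iff.1 h.1).1 s)))) (Submodule.smul_mem _ _ hE')

/-! ### The homogeneous spanning set of `𝒮` -/

theorem twist_mulD_twist (θ : ZMod 2) (r : Var m n) (f : Alg F p n t) :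
    twist F p n t θ * mulD F p n t r f * twist F p n t θ =
      sgn F θ (tau r) • mulD F p n t r (twist F p n t θ f) := by
  refine LinearMap.ext fun g => ?_
  rw [Module.End.mul_apply, Module.End.mul_apply, mulD_apply, LinearMap.smul_apply, mulD_apply,
    twist_mul, twist_partial, twist_twist, map_smul]

theorem twist_Drs_twist (θ : ZMod 2) (r s : Var m n) (f : Alg F p n t) :
    twist F p n t θ * Drs F p n t r s f * twist F p n t θ =
      sgn F θ (tau r + tau s) • Drs F p n t r s (twist F p n t θ f) := by
  rw [Drs, mul_sub, sub_mul, mul_smul_comm, smul_mul_assoc, twist_mulD_twist, twist_mulD_twist,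
    twist_partial, twist_partial, ← twist_add_apply, add_comm θ, twist_add_apply, Drs, smul_sub,
    sgn_add_right]
  simp only [map_smul, smul_smul]
  congr 2
  · ring

theorem twist_mul_mul_twist_of_even {E : Module.End F (Alg F p n t)} (hE : E ∈ plPart F p n t 0)
    (θ : ZMod 2) : twist F p n t θ * E * twist F p n t θ = E := by
  refine LinearMap.ext fun f => ?_
  rw [Module.End.mul_apply, Module.End.mul_apply]
  induction f using alg_ind with
  | zero => simp
  | add f f' hf hf' => simp only [map_add, hf, hf']
  | smul c f hf => simp only [map_smul, hf]
  | mon α hα u =>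
    have h1 := mon_mem_homog (F := F) (p := p) (t := t) α u
    have h2 := hE _ _ h1
    rw [zero_add] at h2
    rw [twist_of_mem h1, map_smul, map_smul, twist_of_mem h2, smul_smul, sgn_mul_self, one_smul]

/-- Conjugation by the parity involution sends D_rs(f) to ± D_rs of the twist of f and fixes even
operators. Averaging over it fixes an element of 𝒮 and replaces each generator by one with
homogeneous coefficient; this divides by 2. -/
theorem evenS_le_span (h2 : (2 : F) ≠ 0) : evenS F p n t ≤
    Submodule.span F {E | ∃ r s, ∃ f ∈ homog F p n t (tau r + tau s), E = Drs F p n t r s f} := by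
  intro E hE
  let π : Module.End F (Alg F p n t) →ₗ[F] Module.End F (Alg F p n t) :=
    (2⁻¹ : F) • (LinearMap.id + (LinearMap.mulRight F (twist F p n t 1)).comp
      (LinearMap.mulLeft F (twist F p n t 1)))
  have hπ : ∀ A, π A = (2⁻¹ : F) • (A + twist F p n t 1 * A * twist F p n t 1) := fun A => rfl
  have hE1 : π E = E := by
    rw [hπ, twist_mul_mul_twist_of_even hE.2, ← two_smul F, smul_smul, inv_mul_cancel₀ h2, one_smul]
  rw [← hE1]
  have : Submodule.span F {E | ∃ r s f, E = Drs F p n t r s f} ≤ (Submodule.span F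
      {E | ∃ r s, ∃ f ∈ homog F p n t (tau r + tau s), E = Drs F p n t r s f}).comap π := by
    rw [Submodule.span_le]
    rintro A ⟨r, s, f, rfl⟩
    refine Submodule.subset_span ⟨r, s,
      (2⁻¹ : F) • (f + sgn F 1 (tau r + tau s) • twist F p n t 1 f), ?_, ?_⟩
    · rw [mem_homog]
      intro b hb
      rw [Finsupp.smul_apply, Finsupp.add_apply, Finsupp.smul_apply, twist_apply] at hb
      generalize tau r + tau s = a at hb
      generalize par b = c at hb
      rcases zmod_two_cases a with rfl | rfl <;> rcases zmod_two_cases c with rfl | rfl <;>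
        simp_all [sgn_zero_right, sgn_one_one]
    · rw [hπ, twist_Drs_twist]
      simp only [Drs, map_smul, map_add, smul_add, smul_sub, smul_smul]
      rw [← sub_eq_zero]
      module
  exact this hE.1

end

section
theorem end_lie_smul (c : F) (A B : Module.End F (Alg F p n t)) : ⁅A, c • B⁆ = c • ⁅A, B⁆ := by
  rw [LieRing.of_associative_ring_bracket, LieRing.of_associative_ring_bracket, mul_smul_comm,
    smul_mul_assoc, smul_sub]

theorem end_smul_lie (c : F) (A B : Module.End F (Alg F p n t)) : ⁅c • A, B⁆ = c • ⁅A, B⁆ := by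
  rw [LieRing.of_associative_ring_bracket, LieRing.of_associative_ring_bracket, mul_smul_comm,
    smul_mul_assoc, smul_sub]

variable [CharP F p] [Fact p.Prime]

/-! ### The space `𝒥` -/

theorem derivation_one {E : Module.End F (Alg F p n t)}
    (hE : ∀ f g, E (f ⋆ g) = E f ⋆ g + f ⋆ E g) : E (one F p n t) = 0 := by
  have h := hE (one F p n t) (one F p n t)
  rw [mul_one', mul_one', one_mul'] at h
  exact left_eq_add.1 h

variable [Fact (∀ i, 1 ≤ t i)]

theorem one_ne_zero' : one F p n t ≠ 0 := by
  rw [one, mon_of_mem zero_range]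
  exact Finsupp.single_ne_zero.2 one_ne_zero

/-- Left and right multiplication by a commute, so Frobenius gives (ad a)^(p^r) = ad(a^(p^r)). -/
theorem pow_commutator (a b : Module.End F (Alg F p n t)) (r : ℕ) :
    a ^ p ^ r * b - b * a ^ p ^ r =
      ((LinearMap.mulLeft F a - LinearMap.mulRight F a) ^ p ^ r) b := by
  have : Nontrivial (Alg F p n t) := ⟨⟨_, _, one_ne_zero'⟩⟩
  have : Nontrivial (Module.End F (Alg F p n t)) := Module.End.instNontrivial
  have : CharP (Module.End F (Module.End F (Alg F p n t))) p :=
    charP_of_injective_algebraMap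
      (algebraMap F (Module.End F (Module.End F (Alg F p n t)))).injective p
  rw [sub_pow_char_pow_of_commute p _ (LinearMap.commute_mulLeft_right a a),
    LinearMap.pow_mulLeft, LinearMap.pow_mulRight]
  rfl

/-- The Leibniz rule says that ad D_i sends multiplication by f to multiplication by D_i(f).
Iterating p^r times turns (ad D_i)^(p^r) into the commutator with D_i^(p^r). -/
theorem partial_pow_mul (i : Fin m) (r : ℕ) (f g : Alg F p n t) :
    (partialD F p n t (Sum.inl i) ^ p ^ r) (f ⋆ g) =
      (partialD F p n t (Sum.inl i) ^ p ^ r) f ⋆ g +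
        f ⋆ (partialD F p n t (Sum.inl i) ^ p ^ r) g := by
  have h1 : ∀ N : ℕ, ((LinearMap.mulLeft F (partialD F p n t (Sum.inl i)) -
      LinearMap.mulRight F (partialD F p n t (Sum.inl i))) ^ N) (mul F p n t f) =
      mul F p n t ((partialD F p n t (Sum.inl i) ^ N) f) := by
    intro N
    induction N with
    | zero => simp
    | succ N ih =>
      rw [pow_succ', Module.End.mul_apply, ih, pow_succ', Module.End.mul_apply]
      refine LinearMap.ext fun h => ?_
      rw [LinearMap.sub_apply, LinearMap.mulLeft_apply, LinearMap.mulRight_apply,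
        LinearMap.sub_apply, Module.End.mul_apply, Module.End.mul_apply, partial_inl_mul,
        add_sub_cancel_right]
  have h2 := congrArg (fun A => A g) (h1 (p ^ r))
  rw [← pow_commutator] at h2
  rw [LinearMap.sub_apply, Module.End.mul_apply, Module.End.mul_apply, sub_eq_iff_eq_add] at h2
  exact h2

theorem partial_commute (i : Fin m) (r : Var m n) :
    Commute (partialD F p n t (Sum.inl i)) (partialD F p n t r) := by
  refine LinearMap.ext fun f => ?_
  rw [Module.End.mul_apply, Module.End.mul_apply, partial_comm, tau, Sum.elim_inl, sgn_zero_left,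
    one_smul]

/-- The properties of the elements of `𝒥` that are used: they are even derivations with constant
coefficients that vanish on the variables. -/
structure IsHigherPartial (j : Module.End F (Alg F p n t)) : Prop where
  map_mul : ∀ f g, j (f ⋆ g) = j f ⋆ g + f ⋆ j g
  commute : ∀ r, Commute j (partialD F p n t r)
  map_gen : ∀ r, j (gen F p n t r) = 0
  mem_homog : ∀ θ, ∀ f ∈ homog F p n t θ, j f ∈ homog F p n t θ

theorem pow_mem_homog (i : Fin m) (N : ℕ) {θ : ZMod 2} {f : Alg F p n t}
    (hf : f ∈ homog F p n t θ) : (partialD F p n t (Sum.inl i) ^ N) f ∈ homog F p n t θ := by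
  induction N with
  | zero => simpa using hf
  | succ N ih =>
    rw [pow_succ', Module.End.mul_apply]
    exact evenField_mem_homog (partial_inl_mem_evenFields i) ih

theorem isHigherPartial_pow (i : Fin m) {r : ℕ} (hr : 1 ≤ r) :
    IsHigherPartial (partialD F p n t (Sum.inl i) ^ p ^ r) where
  map_mul := partial_pow_mul i r
  commute s := (partial_commute i s).pow_left _
  map_gen s := by
    -- The assumption r ≥ 1 enters here: two applications of D_i kill every variable, one does not.
    have h2 : 2 ≤ p ^ r :=
      (Fact.out (p := p.Prime)).two_le.trans (Nat.le_self_pow (by omega) p)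
    obtain ⟨k, hk⟩ := Nat.exists_eq_add_of_le h2
    rw [hk, add_comm, pow_add, Module.End.mul_apply, pow_two, Module.End.mul_apply, partial_gen]
    rw [apply_ite (partialD F p n t (Sum.inl i)), one,
      partial_inl_mon _ zero_range]
    simp
  mem_homog θ f hf := pow_mem_homog i _ hf

theorem isHigherPartial_of_mem {j : Module.End F (Alg F p n t)} (hj : j ∈ spanJ F p n t) :
    IsHigherPartial j := by
  induction hj using Submodule.span_induction with
  | mem x hx =>
    obtain ⟨i, r, hr, _, rfl⟩ := hx
    exact isHigherPartial_pow i hr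
  | zero => exact ⟨by simp, fun r => Commute.zero_left _, by simp, fun θ f _ => by simp⟩
  | add a b _ _ ha hb =>
    refine ⟨fun f g => ?_, fun r => (ha.commute r).add_left (hb.commute r), fun r => ?_,
      fun θ f hf => Submodule.add_mem _ (ha.mem_homog θ f hf) (hb.mem_homog θ f hf)⟩
    · simp only [LinearMap.add_apply, ha.map_mul, hb.map_mul, map_add]
      abel
    · rw [LinearMap.add_apply, ha.map_gen, hb.map_gen, add_zero]
  | smul c a _ ha =>
    refine ⟨fun f g => ?_, fun r => (ha.commute r).smul_left c, fun r => ?_,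
      fun θ f hf => Submodule.smul_mem _ _ (ha.mem_homog θ f hf)⟩
    · simp only [LinearMap.smul_apply, ha.map_mul, map_smul, smul_add]
    · rw [LinearMap.smul_apply, ha.map_gen, smul_zero]

namespace IsHigherPartial

variable {j : Module.End F (Alg F p n t)}

theorem partial_apply (hj : IsHigherPartial j) (r : Var m n) (f : Alg F p n t) : j (𝔡 r f) = 𝔡 r (j f) :=
  congrArg (fun A => A f) (hj.commute r)

theorem lie_mulD (hj : IsHigherPartial j) (r : Var m n) (f : Alg F p n t) :
    ⁅j, mulD F p n t r f⁆ = mulD F p n t r (j f) := by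
  refine LinearMap.ext fun g => ?_
  rw [end_lie_apply, mulD_apply, mulD_apply, mulD_apply, hj.map_mul, hj.partial_apply,
    add_sub_cancel_right]

theorem lie_apply_gen (hj : IsHigherPartial j) (E : Module.End F (Alg F p n t)) (r : Var m n) :
    ⁅j, E⁆ (gen F p n t r) = j (E (gen F p n t r)) := by
  rw [end_lie_apply, hj.map_gen, map_zero, sub_zero]

theorem lie_mem_evenFields (hj : IsHigherPartial j) {E : Module.End F (Alg F p n t)} (hE : E ∈ evenFields F p n t) :
    ⁅j, E⁆ ∈ evenFields F p n t := by
  rw [mem_evenFields_iff]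
  refine ⟨fun r => ?_, ?_⟩
  · rw [hj.lie_apply_gen]
    exact hj.mem_homog _ _ ((mem_evenFields_iff.1 hE).1 r)
  · refine LinearMap.ext fun g => ?_
    rw [vectorField_apply, end_lie_apply, evenField_apply hE, evenField_apply hE, map_sum,
      ← Finset.sum_sub_distrib]
    refine Finset.sum_congr rfl fun r _ => ?_
    rw [hj.map_mul, hj.partial_apply, add_sub_cancel_right, hj.lie_apply_gen]

theorem dv_lie (hj : IsHigherPartial j) {E : Module.End F (Alg F p n t)} (hE : E ∈ evenFields F p n t) :
    dv F p n t ⁅j, E⁆ = j (dv F p n t E) := by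
  rw [dv_evenField (hj.lie_mem_evenFields hE), dv_evenField hE, map_sum]
  refine Finset.sum_congr rfl fun r _ => ?_
  rw [hj.lie_apply_gen, map_smul, hj.partial_apply]

theorem lie_Drs (hj : IsHigherPartial j) (r s : Var m n) {f : Alg F p n t} (hf : f ∈ homog F p n t (tau r + tau s)) :
    ⁅j, Drs F p n t r s f⁆ = Drs F p n t r s (j f) := by
  rw [Drs, Drs, twist_of_mem hf, twist_of_mem (hj.mem_homog _ _ hf), lie_sub]
  rw [end_lie_smul, hj.lie_mulD, hj.lie_mulD, hj.partial_apply, hj.partial_apply, map_smul]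

theorem lie_mem_evenS (hj : IsHigherPartial j) (h2 : (2 : F) ≠ 0) {E : Module.End F (Alg F p n t)}
    (hE : E ∈ evenS F p n t) : ⁅j, E⁆ ∈ evenS F p n t := by
  replace hE := evenS_le_span h2 hE
  induction hE using Submodule.span_induction with
  | mem x hx =>
    obtain ⟨r, s, f, hf, rfl⟩ := hx
    rw [hj.lie_Drs r s hf]
    exact Drs_mem_evenS (hj.mem_homog _ _ hf)
  | zero => rw [lie_zero]; exact Submodule.zero_mem _
  | add a b _ _ ha hb => rw [lie_add]; exact Submodule.add_mem _ ha hb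
  | smul c a _ ha => rw [end_lie_smul]; exact Submodule.smul_mem _ _ ha

end IsHigherPartial

theorem higherPartial_lie {j j' : Module.End F (Alg F p n t)} (hj : j ∈ spanJ F p n t)
    (hj' : j' ∈ spanJ F p n t) : ⁅j, j'⁆ = 0 := by
  induction hj' using Submodule.span_induction with
  | mem x hx =>
    obtain ⟨i, r, _, _, rfl⟩ := hx
    rw [LieRing.of_associative_ring_bracket, sub_eq_zero]
    exact ((isHigherPartial_of_mem hj).commute (Sum.inl i)).pow_right _
  | zero => exact lie_zero j
  | add a b _ _ ha hb => rw [lie_add, ha, hb, add_zero]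
  | smul c a _ ha => rw [end_lie_smul, ha, smul_zero]

/-! ### The Lie algebra `𝒮̃` -/

/-- For an even variable the constant is 1, so a multiple of x_i D_i can absorb any constant
divergence. -/
theorem dv_torus (r : Var m n) : ∃ c : F,
    dv F p n t (mulD F p n t r (gen F p n t r)) = c • one F p n t ∧ (∀ i, r = Sum.inl i → c = 1) := by
  refine ⟨sgn F (tau r) (tau r), ?_, ?_⟩
  · rw [dv_evenField (mulD_mem_evenFields (gen_mem_homog r)), Finset.sum_eq_single r]
    · rw [mulD_gen, if_pos rfl, partial_gen, if_pos rfl]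
    · intro s _ hs
      rw [mulD_gen, if_neg (Ne.symm hs), map_zero, smul_zero]
    · simp
  · rintro i rfl
    simp [tau, sgn_zero_left]

/-- Every element of 𝒯 has constant divergence, and conversely subtracting c x_i D_i makes a field
of divergence c divergence-free. This is the working description of 𝒮̃; one even variable suffices.
-/
theorem mem_Stilde (i : Fin m) {E : Module.End F (Alg F p n t)} :
    E ∈ Stilde F p n t ↔ ∃ E₀ ∈ evenFields F p n t, ∃ c : F, dv F p n t E₀ = c • one F p n t ∧
      ∃ j ∈ spanJ F p n t, E = E₀ + j := by
  constructor
  · intro h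
    obtain ⟨a, ha, j, hj, rfl⟩ := Submodule.mem_sup.1 h
    obtain ⟨s, hs, τ, hτ, rfl⟩ := Submodule.mem_sup.1 ha
    have h1 : τ ∈ evenFields F p n t ∧ ∃ c : F, dv F p n t τ = c • one F p n t := by
      clear h ha
      induction hτ using Submodule.span_induction with
      | mem x hx =>
        obtain ⟨r, rfl⟩ := hx
        obtain ⟨c, hc, _⟩ := dv_torus (F := F) (p := p) (t := t) r
        exact ⟨mulD_mem_evenFields (gen_mem_homog r), c, hc⟩
      | zero => exact ⟨Submodule.zero_mem _, 0, by simp⟩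
      | add a b _ _ ha hb =>
        obtain ⟨h1, c, hc⟩ := ha
        obtain ⟨h2, d, hd⟩ := hb
        exact ⟨Submodule.add_mem _ h1 h2, c + d, by rw [map_add, hc, hd, add_smul]⟩
      | smul c a _ ha =>
        obtain ⟨h1, d, hd⟩ := ha
        exact ⟨Submodule.smul_mem _ _ h1, c * d, by rw [map_smul, hd, mul_smul]⟩
    obtain ⟨h1, c, hc⟩ := h1
    obtain ⟨h2, h3⟩ := mem_evenSbar.1 hs
    exact ⟨s + τ, Submodule.add_mem _ h2 h1, c, by rw [map_add, h3, hc, zero_add], j, hj, rfl⟩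
  · rintro ⟨E₀, hE, c, hc, j, hj, rfl⟩
    refine Submodule.add_mem_sup ?_ hj
    obtain ⟨d, hd, hd'⟩ := dv_torus (F := F) (p := p) (t := t) (Sum.inl i : Var m n)
    rw [hd' i rfl] at hd
    have h1 : E₀ = (E₀ - c • mulD F p n t (Sum.inl i) (gen F p n t (Sum.inl i))) +
        c • mulD F p n t (Sum.inl i) (gen F p n t (Sum.inl i)) := by abel
    rw [h1]
    refine Submodule.add_mem_sup (mem_evenSbar.2 ⟨Submodule.sub_mem _ hE (Submodule.smul_mem _ _
      (mulD_mem_evenFields (gen_mem_homog _))), ?_⟩)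
      (Submodule.smul_mem _ _ (Submodule.subset_span ⟨_, rfl⟩))
    rw [map_sub, map_smul, hc, hd, one_smul, sub_self]

theorem evenField_map_one {E : Module.End F (Alg F p n t)} (hE : E ∈ evenFields F p n t) :
    E (one F p n t) = 0 :=
  derivation_one (evenField_mul hE)

/-- 𝒥 is commutative, and the divergence of each remaining bracket is a derivation applied to a
constant, hence zero. So the bracket even lies in the even part of S̄. -/
theorem lie_mem_Stilde (i : Fin m) {E E' : Module.End F (Alg F p n t)} (hE : E ∈ Stilde F p n t)
    (hE' : E' ∈ Stilde F p n t) : ⁅E, E'⁆ ∈ Stilde F p n t := by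
  obtain ⟨A, hA, c, hc, j, hj, rfl⟩ := (mem_Stilde i).1 hE
  obtain ⟨B, hB, d, hd, k, hk, rfl⟩ := (mem_Stilde i).1 hE'
  have hj' := isHigherPartial_of_mem hj
  have hk' := isHigherPartial_of_mem hk
  rw [mem_Stilde i]
  refine ⟨⁅A, B⁆ + ⁅j, B⁆ - ⁅k, A⁆, Submodule.sub_mem _ (Submodule.add_mem _
    (lie_mem_evenFields hA hB) (hj'.lie_mem_evenFields hB)) (hk'.lie_mem_evenFields hA), 0, ?_,
    0, Submodule.zero_mem _, ?_⟩
  · rw [map_sub, map_add, dv_lie hA hB, hj'.dv_lie hB, hk'.dv_lie hA, hc, hd]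
    simp only [map_smul, evenField_map_one hA, evenField_map_one hB, derivation_one hj'.map_mul,
      derivation_one hk'.map_mul]
    simp
  · rw [lie_add, add_lie, add_lie, higherPartial_lie hj hk, ← lie_skew A k]
    abel

theorem lie_mem_evenS_of_mem_Stilde (h2 : (2 : F) ≠ 0) (i : Fin m)
    {E E' : Module.End F (Alg F p n t)} (hE : E ∈ Stilde F p n t)
    (hE' : E' ∈ evenS F p n t) : ⁅E, E'⁆ ∈ evenS F p n t := by
  obtain ⟨A, hA, c, hc, j, hj, rfl⟩ := (mem_Stilde i).1 hE
  rw [add_lie]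
  exact Submodule.add_mem _ (lie_mem_evenS hA hc hE')
    ((isHigherPartial_of_mem hj).lie_mem_evenS h2 hE')

theorem evenS_le_Stilde : evenS F p n t ≤ Stilde F p n t :=
  evenS_le_evenSbar.trans (le_sup_left.trans le_sup_left)

theorem Stilde_le_superDer (i : Fin m) : Stilde F p n t ≤ superDer F p n t 0 := by
  intro E hE
  obtain ⟨A, hA, c, hc, j, hj, rfl⟩ := (mem_Stilde i).1 hE
  have hj' := isHigherPartial_of_mem hj
  refine Submodule.add_mem _ (evenFields_le_superDer hA) ⟨fun μ f hf => ?_, fun μ f _ g => ?_⟩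
  · rw [zero_add]; exact hj'.mem_homog μ f hf
  · rw [sgn_zero_left, one_smul, hj'.map_mul]

end

/-! ### Polynomials in the even variables and constants -/

theorem partial_inr_coeff (k : Fin n) (f : Alg F p n t) (a : {α : Fin m → ℕ // ∀ i, α i < p ^ t i})
    (u : Finset (Fin n)) : partialD F p n t (Sum.inr k) f (a, u) =
      if k ∈ u then 0 else extSign F {k} u * f (a, insert k u) := by
  induction f using alg_ind with
  | zero => simp
  | add f f' hf hf' =>
    simp only [map_add, hf, hf', Finsupp.add_apply]
    split_ifs <;> ring
  | smul c f hf =>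
    simp only [map_smul, hf, Finsupp.smul_apply, smul_eq_mul]
    split_ifs <;> ring
  | mon β hβ v =>
    rw [partial_inr_mon, mon_of_mem hβ]
    by_cases hv : k ∈ v
    · rw [if_pos hv, mon_of_mem hβ, Finsupp.smul_apply, Finsupp.single_apply,
        Finsupp.single_apply]
      simp only [Prod.mk.injEq, smul_eq_mul, mul_ite, mul_one, mul_zero]
      by_cases hu : k ∈ u
      · rw [if_pos hu, if_neg]
        rintro ⟨-, rfl⟩
        exact Finset.notMem_erase k v hu
      · rw [if_neg hu]
        by_cases h : v = insert k u
        · subst h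
          rw [Finset.erase_insert hu, extSign_singleton, Finset.filter_insert,
            if_neg (lt_irrefl _)]
          simp
        · rw [if_neg, if_neg]
          · simp [h]
          · rintro ⟨-, rfl⟩
            exact h (Finset.insert_erase hv).symm
    · have h : ((⟨β, hβ⟩, v) : Idx p n t) ≠ (a, insert k u) := by
        rintro ⟨⟩
        exact hv (Finset.mem_insert_self k u)
      rw [if_neg hv, mon_of_mem hβ, Finsupp.single_apply, if_neg h]
      simp

variable (F p n t) in
/-- The polynomials in the even variables. -/
noncomputable def evenPoly : Submodule F (Alg F p n t) :=
  ⨅ k : Fin n, LinearMap.ker (partialD F p n t (Sum.inr k))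

variable (F p n t) in
/-- The polynomials in the odd variables. -/
noncomputable def oddPoly : Submodule F (Alg F p n t) :=
  ⨅ i : Fin m, LinearMap.ker (partialD F p n t (Sum.inl i))

theorem mem_evenPoly {f : Alg F p n t} :
    f ∈ evenPoly F p n t ↔ ∀ k, 𝔡 (Sum.inr k) f = 0 := by
  simp [evenPoly, Submodule.mem_iInf]

theorem mem_oddPoly {f : Alg F p n t} :
    f ∈ oddPoly F p n t ↔ ∀ i, 𝔡 (Sum.inl i) f = 0 := by
  simp [oddPoly, Submodule.mem_iInf]

theorem eq_empty_of_mem_evenPoly {f : Alg F p n t} (hf : f ∈ evenPoly F p n t) {b : Idx p n t}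
    (hb : f b ≠ 0) : b.2 = ∅ := by
  by_contra h
  obtain ⟨k, hk⟩ := Finset.nonempty_iff_ne_empty.2 h
  have h1 := partial_inr_coeff k f b.1 (b.2.erase k)
  rw [mem_evenPoly.1 hf k, if_neg (Finset.notMem_erase k _), Finset.insert_erase hk] at h1
  rcases mul_eq_zero.1 h1.symm with h2 | h2
  · have := extSign_mul_self (F := F) {k} (b.2.erase k)
    rw [h2] at this
    simp at this
  · exact hb h2

theorem evenPoly_le_homog : evenPoly F p n t ≤ homog F p n t 0 := by
  intro f hf
  rw [mem_homog]
  intro b hb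
  rw [par, eq_empty_of_mem_evenPoly hf hb]
  simp

theorem mon_mem_evenPoly (α : Fin m → ℕ) : mon F p n t α ∅ ∈ evenPoly F p n t :=
  mem_evenPoly.2 fun k => partial_inr_mon_empty k α

theorem one_mem_evenPoly : one F p n t ∈ evenPoly F p n t := mon_mem_evenPoly 0

theorem gen_mem_evenPoly (i : Fin m) : gen F p n t (Sum.inl i) ∈ evenPoly F p n t :=
  mon_mem_evenPoly _

theorem partial_inl_mem_evenPoly (i : Fin m) {f : Alg F p n t} (hf : f ∈ evenPoly F p n t) :
    𝔡 (Sum.inl i) f ∈ evenPoly F p n t :=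
  mem_evenPoly.2 fun k => by rw [← partial_inl_inr_comm, mem_evenPoly.1 hf, map_zero]

theorem partial_inr_evenPoly_mul (k : Fin n) {f : Alg F p n t} (hf : f ∈ evenPoly F p n t)
    (g : Alg F p n t) : 𝔡 (Sum.inr k) (f ⋆ g) = f ⋆ 𝔡 (Sum.inr k) g := by
  rw [partial_inr_mul, mem_evenPoly.1 hf, twist_of_mem (evenPoly_le_homog hf), sgn_zero_right]
  simp

theorem mul_mem_evenPoly {f g : Alg F p n t} (hf : f ∈ evenPoly F p n t)
    (hg : g ∈ evenPoly F p n t) : f ⋆ g ∈ evenPoly F p n t :=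
  mem_evenPoly.2 fun k => by rw [partial_inr_evenPoly_mul k hf, mem_evenPoly.1 hg, map_zero]

theorem mon_mem_oddPoly (u : Finset (Fin n)) : mon F p n t 0 u ∈ oddPoly F p n t := by
  rw [mem_oddPoly]
  intro i
  by_cases h : ∀ i, (0 : Fin m → ℕ) i < p ^ t i
  · rw [partial_inl_mon i h, if_pos (by simp)]
  · rw [mon_of_not h, map_zero]

theorem xi_mem_oddPoly (k : Fin n) : gen F p n t (Sum.inr k) ∈ oddPoly F p n t :=
  mon_mem_oddPoly _

theorem mon_eq_mul (α : Fin m → ℕ) (hα : ∀ i, α i < p ^ t i) (u : Finset (Fin n)) :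
    mon F p n t α u = mon F p n t α ∅ ⋆ mon F p n t 0 u := by
  rw [mul_mon _ _ _ _ hα (zero_lt_of_lt hα)]
  simp [dpCoeff_zero_right, extSign_empty_left]

theorem xi_mul_self (k : Fin n) : gen F p n t (Sum.inr k) ⋆ ξ k = 0 :=
  (xi_mul_mon k 0 {k}).trans (if_pos (Finset.mem_singleton_self k))

theorem xi_mul_xi_mul (k : Fin n) (f : Alg F p n t) : ξ k ⋆ (ξ k ⋆ f) = 0 := by
  rw [← alg_mul_assoc, xi_mul_self, map_zero, LinearMap.zero_apply]

theorem xi_mul_comm (k l : Fin n) : gen F p n t (Sum.inr k) ⋆ ξ l = -(ξ l ⋆ ξ k) :=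
  odd_mul_comm (xi_mem_homog k) (xi_mem_homog l)

theorem mon_pair {a b : Fin n} (hab : a ≠ b) :
    mon F p n t 0 {a, b} = extSign F {a} {b} • (ξ a ⋆ ξ b) :=
  mon_insert 0 (by simpa using hab)

section

variable [CharP F p] [Fact p.Prime]

theorem partial_inl_mul_oddPoly (i : Fin m) (f : Alg F p n t) {y : Alg F p n t}
    (hy : y ∈ oddPoly F p n t) : 𝔡 (Sum.inl i) (f ⋆ y) = 𝔡 (Sum.inl i) f ⋆ y := by
  rw [partial_inl_mul, mem_oddPoly.1 hy, map_zero, add_zero]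

theorem mul_mem_oddPoly {f g : Alg F p n t} (hf : f ∈ oddPoly F p n t)
    (hg : g ∈ oddPoly F p n t) : f ⋆ g ∈ oddPoly F p n t :=
  mem_oddPoly.2 fun i => by
    rw [partial_inl_mul_oddPoly i f hg, mem_oddPoly.1 hf, map_zero, LinearMap.zero_apply]

variable [Fact (∀ i, 1 ≤ t i)]

theorem partial_inr_mul_xi {θ : ZMod 2} (k : Fin n) {f : Alg F p n t} (hf : f ∈ homog F p n t θ)
    (h0 : 𝔡 (Sum.inr k) f = 0) : 𝔡 (Sum.inr k) (f ⋆ ξ k) = sgn F 1 θ • f := by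
  rw [partial_inr_mul, h0, partial_gen, if_pos rfl, mul_one', twist_of_mem hf]
  simp

theorem partial_inr_xi_of_ne {k l : Fin n} (h : k ≠ l) :
    𝔡 (Sum.inr k) (gen F p n t (Sum.inr l)) = 0 := by
  rw [partial_gen, if_neg (by simpa using h)]

theorem gen_mul_partial_mon (i : Fin m) {α : Fin m → ℕ} (hα : ∀ i, α i < p ^ t i)
    (u : Finset (Fin n)) : gen F p n t (Sum.inl i) ⋆ 𝔡 (Sum.inl i) (mon F p n t α u) =
      (α i : F) • mon F p n t α u := by
  rw [partial_inl_mon i hα]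
  split_ifs with h
  · simp [h]
  · have hle : ∀ j, (α - Pi.single i 1 : Fin m → ℕ) j < p ^ t j :=
      fun j => lt_of_le_of_lt (Nat.sub_le _ _) (hα j)
    have h1 : Pi.single i 1 + (α - Pi.single i 1 : Fin m → ℕ) = α := by
      refine add_tsub_cancel_of_le fun j => ?_
      by_cases hj : j = i
      · subst hj; simp; omega
      · simp [hj]
    rw [gen, mul_mon _ _ _ _ (single_range i) hle, if_pos (by simp), h1, extSign_empty_left,
      Finset.empty_union, mul_one]
    congr 1
    unfold dpCoeff
    rw [Finset.prod_eq_single i]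
    · simp only [Pi.single_eq_same, Pi.sub_apply, Nat.choose_one_right]
      congr 1; omega
    · intro j _ hj
      simp [hj]
    · simp

/-! ### Brackets of simple vector fields -/

theorem lie_mulD_gen (E : Module.End F (Alg F p n t)) (s : Var m n) (g : Alg F p n t)
    (r : Var m n) :
    ⁅E, mulD F p n t s g⁆ (gen F p n t r) =
      (if s = r then E g else 0) - g ⋆ 𝔡 s (E (gen F p n t r)) := by
  rw [end_lie_apply, mulD_gen, mulD_apply, apply_ite E, map_zero]

theorem lie_mulD_mulD {r s : Var m n} {f g : Alg F p n t} (hf : f ∈ homog F p n t (tau r))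
    (hg : g ∈ homog F p n t (tau s)) : ⁅mulD F p n t r f, mulD F p n t s g⁆ =
      mulD F p n t s (f ⋆ 𝔡 r g) - mulD F p n t r (g ⋆ 𝔡 s f) := by
  have h2 : ∀ a b : ZMod 2, a + (b + a) = b := by decide
  have h3 := mul_mem_homog hf (partial_mem_homog r hg)
  have h4 := mul_mem_homog hg (partial_mem_homog s hf)
  rw [h2] at h3 h4
  refine evenFields_ext (lie_mem_evenFields (mulD_mem_evenFields hf) (mulD_mem_evenFields hg))
    (Submodule.sub_mem _ (mulD_mem_evenFields h3) (mulD_mem_evenFields h4)) fun q => ?_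
  rw [lie_mulD_gen, LinearMap.sub_apply, mulD_gen, mulD_gen, mulD_gen,
    mulD_apply]
  split_ifs <;> simp

/-- The divergence-free field `f D_i + D_i(f) ξ_k D_k`, for an even `f` that does not involve
`ξ_k`. -/
noncomputable def cField (f : Alg F p n t) (i : Fin m) (k : Fin n) :
    Module.End F (Alg F p n t) :=
  mulD F p n t (Sum.inl i) f + mulD F p n t (Sum.inr k) (𝔡 (Sum.inl i) f ⋆ ξ k)

theorem Drs_xi_mul {f : Alg F p n t} (hf : f ∈ homog F p n t 0) {k : Fin n}
    (h0 : 𝔡 (Sum.inr k) f = 0) (i : Fin m) :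
    Drs F p n t (Sum.inl i) (Sum.inr k) (ξ k ⋆ f) = cField f i k := by
  have h1 : ξ k ⋆ f ∈ homog F p n t 1 := by
    have := mul_mem_homog (xi_mem_homog (p := p) (t := t) k) hf
    rwa [add_zero] at this
  have h2 : 𝔡 (Sum.inl i) f ∈ homog F p n t 0 := by
    have := partial_mem_homog (Sum.inl i) hf
    rwa [tau, Sum.elim_inl, add_zero] at this
  rw [Drs, partial_inl_xi_mul, twist_of_mem h1, map_smul, partial_inr_xi_mul, if_pos rfl, h0,
    ← even_mul_comm h2 (gen F p n t (Sum.inr k)), cField]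
  simp [tau, sgn_zero_left, sgn_one_one]
  abel

theorem cField_mem_evenS {f : Alg F p n t} (hf : f ∈ homog F p n t 0) {k : Fin n}
    (h0 : 𝔡 (Sum.inr k) f = 0) (i : Fin m) : cField f i k ∈ evenS F p n t := by
  rw [← Drs_xi_mul hf h0]
  refine Drs_mem_evenS ?_
  have := mul_mem_homog (xi_mem_homog (p := p) (t := t) k) hf
  simpa [tau] using this

/-- For an odd index D_kk does not vanish: D_kk(ξ_k g) = -2 g D_k when g is free of ξ_k. -/
theorem mulD_inr_mem_evenS (h2 : (2 : F) ≠ 0) {g : Alg F p n t} (hg : g ∈ homog F p n t 1)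
    {k : Fin n} (h0 : 𝔡 (Sum.inr k) g = 0) : mulD F p n t (Sum.inr k) g ∈ evenS F p n t := by
  have h1 : ξ k ⋆ g ∈ homog F p n t 0 := by
    have := mul_mem_homog (xi_mem_homog (p := p) (t := t) k) hg
    rwa [show (1 + 1 : ZMod 2) = 0 by decide] at this
  have h3 : Drs F p n t (Sum.inr k) (Sum.inr k) (ξ k ⋆ g) =
      (-2 : F) • mulD F p n t (Sum.inr k) g := by
    rw [Drs, twist_of_mem h1, map_smul, partial_inr_xi_mul, if_pos rfl, h0, sgn_zero_right]
    simp [tau, sgn_one_one, neg_smul, two_smul]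
    abel
  have h4 : Drs F p n t (Sum.inr k) (Sum.inr k) (ξ k ⋆ g) ∈ evenS F p n t := by
    refine Drs_mem_evenS ?_
    simpa [tau, show (1 + 1 : ZMod 2) = 0 by decide] using h1
  rw [h3] at h4
  exact (Submodule.smul_mem_iff _ (neg_ne_zero.2 h2)).1 h4

theorem partial_inl_mem_evenS (k : Fin n) (i : Fin m) :
    partialD F p n t (Sum.inl i) ∈ evenS F p n t := by
  have h := cField_mem_evenS (F := F) (p := p) (t := t) one_mem_homog
    (mem_evenPoly.1 one_mem_evenPoly k) i
  have h0 : 𝔡 (Sum.inl i) (one F p n t) = 0 := mem_oddPoly.1 (mon_mem_oddPoly _) i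
  rwa [cField, h0, map_zero, LinearMap.zero_apply, map_zero, add_zero, ← partialD_eq_mulD] at h

end

/-! ### Generators of `𝒮` -/

section

variable [CharP F p] [Fact p.Prime] [Fact (∀ i, 1 ≤ t i)]

theorem partial_inl_one (i : Fin m) : 𝔡 (Sum.inl i) (one F p n t) = 0 :=
  mem_oddPoly.1 (mon_mem_oddPoly _) i

theorem even_add_mul_mem {θ : ZMod 2} {f g : Alg F p n t} (hf : f ∈ homog F p n t 0)
    (hg : g ∈ homog F p n t θ) : f ⋆ g ∈ homog F p n t θ := by
  simpa using mul_mem_homog hf hg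

theorem partial_inl_mem_homog {θ : ZMod 2} (i : Fin m) {f : Alg F p n t}
    (hf : f ∈ homog F p n t θ) : 𝔡 (Sum.inl i) f ∈ homog F p n t θ :=
  evenField_mem_homog (partial_inl_mem_evenFields i) hf

theorem odd_mul_odd_mem {f g : Alg F p n t} (hf : f ∈ homog F p n t 1)
    (hg : g ∈ homog F p n t 1) : f ⋆ g ∈ homog F p n t 0 := by
  have := mul_mem_homog hf hg
  rwa [show (1 + 1 : ZMod 2) = 0 by decide] at this

/-- Produces the fields `cField` with coefficients that involve odd variables: the bracket trades
ξ_k for g ξ_c, and its D_k-part is the divergence correction. -/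
theorem lie_eq_neg_cField {z g : Alg F p n t} (hz : z ∈ oddPoly F p n t)
    (hz1 : z ∈ homog F p n t 1) {k c : Fin n} (hzk : 𝔡 (Sum.inr k) z = 0)
    (hg : g ∈ evenPoly F p n t) (i : Fin m) :
    ⁅mulD F p n t (Sum.inl i) (z ⋆ ξ k), mulD F p n t (Sum.inr k) (g ⋆ ξ c)⁆ =
      -cField (g ⋆ (z ⋆ ξ c)) i k := by
  have hg0 := evenPoly_le_homog hg
  have hg0' := evenPoly_le_homog (partial_inl_mem_evenPoly i hg)
  rw [lie_mulD_mulD (odd_mul_odd_mem hz1 (xi_mem_homog k)) (even_add_mul_mem hg0 (xi_mem_homog c)),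
    partial_inl_mul_oddPoly i g (xi_mem_oddPoly c), partial_inr_mul_xi k hz1 hzk, sgn_one_one,
    cField, partial_inl_mul_oddPoly i g (mul_mem_oddPoly hz (xi_mem_oddPoly c)),
    mul_left_comm_of_even hg0', alg_mul_assoc z, xi_mul_comm k c, alg_mul_assoc g (ξ c),
    map_smul (mul F p n t (ξ c)), odd_mul_comm (xi_mem_homog c) hz1, alg_mul_assoc _ (z ⋆ ξ c),
    alg_mul_assoc z (ξ c)]
  simp only [map_neg, map_smul]
  simp
  abel

/-- The D_i-part differentiates g, and the correction term differentiates f through ξ_k D_k, so the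
result is again vertical with the Wronskian of f and g as coefficient. -/
theorem lie_cField_mulD {f g y : Alg F p n t} (hf : f ∈ evenPoly F p n t)
    (hg : g ∈ evenPoly F p n t) (hy : y ∈ oddPoly F p n t) (hy0 : y ∈ homog F p n t 0)
    {k a : Fin n} (hyk : 𝔡 (Sum.inr k) y = 0) (hak : k ≠ a) (i : Fin m) :
    ⁅cField (f ⋆ y) i k, mulD F p n t (Sum.inr k) (g ⋆ ξ a)⁆ =
      mulD F p n t (Sum.inr k)
        ((f ⋆ 𝔡 (Sum.inl i) g - g ⋆ 𝔡 (Sum.inl i) f) ⋆ (y ⋆ ξ a)) := by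
  have hf0 := evenPoly_le_homog hf
  have hf' := partial_inl_mem_evenPoly i hf
  have hf0' := evenPoly_le_homog hf'
  have hg0 := evenPoly_le_homog hg
  have hg' := partial_inl_mem_evenPoly i hg
  have h1 : 𝔡 (Sum.inr k) (f ⋆ y) = 0 := by rw [partial_inr_evenPoly_mul k hf, hyk, map_zero]
  have h2 : 𝔡 (Sum.inr k) (𝔡 (Sum.inl i) f ⋆ y) = 0 := by
    rw [partial_inr_evenPoly_mul k hf', hyk, map_zero]
  have h3 : 𝔡 (Sum.inr k) (g ⋆ ξ a) = 0 := by
    rw [partial_inr_evenPoly_mul k hg, partial_inr_xi_of_ne hak, map_zero]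
  have hgx := even_add_mul_mem hg0 (xi_mem_homog a)
  rw [cField, add_lie, lie_mulD_mulD (even_add_mul_mem hf0 hy0) hgx,
    lie_mulD_mulD (r := Sum.inr k) (even_add_mul_mem (partial_inl_mem_homog i
      (even_add_mul_mem hf0 hy0)) (xi_mem_homog k)) hgx,
    h1, h3, partial_inl_mul_oddPoly i f hy, partial_inl_mul_oddPoly i g (xi_mem_oddPoly a),
    partial_inr_mul_xi k (even_add_mul_mem hf0' hy0) h2, sgn_zero_right, one_smul]
  rw [map_zero, map_zero, map_zero, map_zero, sub_zero, zero_sub, ← sub_eq_add_neg, ← map_sub,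
    LinearMap.map_sub₂]
  congr 2
  · rw [alg_mul_assoc f y, alg_mul_assoc f, mul_left_comm_of_even (evenPoly_le_homog hg') y]
  · rw [alg_mul_assoc g, alg_mul_assoc g, ← even_mul_comm (even_add_mul_mem hf0' hy0),
      alg_mul_assoc]

/-- The result is D_ij of f y ξ_k ξ_l, since ξ_k^2 = 0 removes one correction term. It serves the
case in which the coefficient contains every ξ, so that no free k is left for a `cField`. -/
theorem lie_cField_mulD_inl {f y : Alg F p n t} (hf : f ∈ evenPoly F p n t)
    (hy : y ∈ oddPoly F p n t) (hy0 : y ∈ homog F p n t 0)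
    {k l : Fin n} (hkl : k ≠ l) (i j : Fin m) :
    ⁅cField (f ⋆ y) i k, mulD F p n t (Sum.inl j) (ξ k ⋆ ξ l)⁆ =
      mulD F p n t (Sum.inl j) (𝔡 (Sum.inl i) f ⋆ (y ⋆ (ξ k ⋆ ξ l))) -
        mulD F p n t (Sum.inl i) (𝔡 (Sum.inl j) f ⋆ (y ⋆ (ξ k ⋆ ξ l))) := by
  have hf0 := evenPoly_le_homog hf
  have hf' := partial_inl_mem_evenPoly i hf
  have hf0' := evenPoly_le_homog hf'
  have hfy := even_add_mul_mem hf0 hy0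
  have hkl0 := odd_mul_odd_mem (xi_mem_homog (F := F) (p := p) (t := t) k) (xi_mem_homog l)
  have hklp := mul_mem_oddPoly (xi_mem_oddPoly (F := F) (p := p) (t := t) k) (xi_mem_oddPoly l)
  have h1 : 𝔡 (Sum.inr k) (gen F p n t (Sum.inr k) ⋆ ξ l) = ξ l := by
    rw [partial_inr_xi_mul, if_pos rfl, partial_inr_xi_of_ne hkl, map_zero, sub_zero]
  rw [cField, add_lie, lie_mulD_mulD hfy hkl0,
    lie_mulD_mulD (r := Sum.inr k) (even_add_mul_mem (partial_inl_mem_homog i hfy)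
      (xi_mem_homog k)) hkl0, mem_oddPoly.1 hklp, h1, partial_inl_mul_oddPoly i f hy,
    partial_inl_mul_oddPoly j f hy,
    partial_inl_mul_oddPoly j (𝔡 (Sum.inl i) f ⋆ y) (xi_mem_oddPoly k),
    partial_inl_mul_oddPoly j (𝔡 (Sum.inl i) f) hy, even_mul_comm hkl0 (_ ⋆ gen F p n t (Sum.inr k)),
    alg_mul_assoc _ (gen F p n t (Sum.inr k)) (ξ k ⋆ ξ l), xi_mul_xi_mul,
    even_mul_comm hkl0 (_ ⋆ y), alg_mul_assoc _ (gen F p n t (Sum.inr k)) (ξ l),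
    alg_mul_assoc _ y, alg_mul_assoc _ y, alg_mul_assoc _ y]
  simp only [map_zero]
  abel

theorem lie_mulD_xi_mul {f : Alg F p n t} (hf : f ∈ homog F p n t 0) {k l : Fin n}
    (hk : 𝔡 (Sum.inr k) f = 0) :
    ⁅mulD F p n t (Sum.inr l) (ξ k ⋆ f), mulD F p n t (Sum.inr k) (ξ l)⁆ =
      mulD F p n t (Sum.inr k) (ξ k ⋆ f) - mulD F p n t (Sum.inr l) (ξ l ⋆ f) := by
  have h1 : ξ k ⋆ f ∈ homog F p n t 1 := by
    have := mul_mem_homog (xi_mem_homog (p := p) (t := t) k) hf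
    rwa [add_zero] at this
  rw [lie_mulD_mulD h1 (xi_mem_homog l), partial_gen, if_pos rfl, mul_one', partial_inr_xi_mul,
    if_pos rfl, hk, map_zero, sub_zero]

theorem mon_erase {k : Fin n} (α : Fin m → ℕ) {u : Finset (Fin n)} (hk : k ∈ u) :
    mon F p n t α u = extSign F {k} (u.erase k) • (ξ k ⋆ mon F p n t α (u.erase k)) := by
  rw [← mon_insert α (Finset.notMem_erase k u), Finset.insert_erase hk]

theorem partial_inr_mon_of_notMem {k : Fin n} (α : Fin m → ℕ) {u : Finset (Fin n)} (hk : k ∉ u) :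
    𝔡 (Sum.inr k) (mon F p n t α u) = 0 := by
  rw [partial_inr_mon, if_neg hk]

/-- Every monomial is a multiple of a Wronskian in the i-th direction: of 1 and x^(α + ε_i) when the
latter exists, and of x_i and x^(α) otherwise. -/
theorem exists_mon_eq (h2 : (2 : F) ≠ 0) (i : Fin m) {α : Fin m → ℕ} (hα : ∀ j, α j < p ^ t j) :
    ∃ f ∈ evenPoly F p n t, ∃ g ∈ evenPoly F p n t, ∃ c : F,
      mon F p n t α ∅ = c • (f ⋆ 𝔡 (Sum.inl i) g - g ⋆ 𝔡 (Sum.inl i) f) := by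
  by_cases h : ∀ j, (α + Pi.single i 1 : Fin m → ℕ) j < p ^ t j
  · refine ⟨_, one_mem_evenPoly, _, mon_mem_evenPoly (α + Pi.single i 1), 1, ?_⟩
    rw [one_smul, one_mul', partial_inl_one,
      map_zero, sub_zero, partial_inl_mon i h, if_neg (by simp), add_tsub_cancel_right]
  -- At the top exponent α_i + 1 = p^t_i, so α_i = -1 in F and the Wronskian of x_i and x^(α) is -2
  -- x^(α).
  · refine ⟨_, gen_mem_evenPoly i, _, mon_mem_evenPoly α, -2⁻¹, ?_⟩
    have h1 : α i + 1 = p ^ t i := by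
      push Not at h
      obtain ⟨j, hj⟩ := h
      by_cases hji : j = i
      · subst hji
        have := hα j
        simp at hj
        omega
      · simp [hji] at hj
        exact absurd (hα j) (not_lt.2 hj)
    have h3 : (α i : F) = -1 := by
      rw [eq_neg_iff_add_eq_zero]
      have := congrArg (Nat.cast (R := F)) h1
      have ht0 : t i ≠ 0 := Nat.one_le_iff_ne_zero.1 (Fact.out (p := ∀ i, 1 ≤ t i) i)
      simpa [ht0] using this
    rw [gen_mul_partial_mon i hα, h3, partial_gen, if_pos rfl, mul_one', neg_one_smul,
      ← neg_add', ← two_smul F, neg_smul, smul_neg, neg_neg, smul_smul, inv_mul_cancel₀ h2,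
      one_smul]

end

/-! ### Bracket-closed spaces containing the vertical fields -/

theorem exists_ne_ne {N : ℕ} (hN : 3 ≤ N) (a b : Fin N) : ∃ c, c ≠ a ∧ c ≠ b := by
  have h : (({a, b} : Finset (Fin N))ᶜ).Nonempty := by
    rw [← Finset.card_pos, Finset.card_compl, Fintype.card_fin]
    have := Finset.card_le_two (a := a) (b := b)
    omega
  obtain ⟨c, hc⟩ := h
  exact ⟨c, by simpa using hc⟩

theorem zmod_two_natCast_eq_zero {N : ℕ} : (N : ZMod 2) = 0 ↔ Even N := by
  rw [ZMod.natCast_eq_zero_iff, even_iff_two_dvd]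

theorem zmod_two_natCast_eq_one {N : ℕ} : (N : ZMod 2) = 1 ↔ Odd N := by
  rw [ZMod.natCast_eq_one_iff_odd]

theorem cField_smul [CharP F p] [Fact p.Prime] [Fact (∀ i, 1 ≤ t i)] (c : F) (f : Alg F p n t)
    (i : Fin m) (k : Fin n) : cField (c • f) i k = c • cField f i k := by
  simp [cField]

/-- A space of operators that is closed under the bracket and contains the fields `f ξ_a D_b` and
`ξ_a ξ_b D_i`. -/
structure VerticalClosed (Q : Submodule F (Module.End F (Alg F p n t))) : Prop where
  lie_mem : ∀ E E', E ∈ Q → E' ∈ Q → ⁅E, E'⁆ ∈ Q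
  vert_mem : ∀ f ∈ evenPoly F p n t, ∀ a b, a ≠ b → mulD F p n t (Sum.inr b) (f ⋆ ξ a) ∈ Q
  pair_mem : ∀ a b, a ≠ b → ∀ i, mulD F p n t (Sum.inl i) (ξ a ⋆ ξ b) ∈ Q

namespace VerticalClosed

variable [CharP F p] [Fact p.Prime] [Fact (∀ i, 1 ≤ t i)]
  {Q : Submodule F (Module.End F (Alg F p n t))}

theorem cField_mul_mem (hQ : VerticalClosed Q) {z g : Alg F p n t} (hz : z ∈ oddPoly F p n t)
    (hz1 : z ∈ homog F p n t 1) {k c : Fin n} (hzk : 𝔡 (Sum.inr k) z = 0) (hck : c ≠ k)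
    (hg : g ∈ evenPoly F p n t) (i : Fin m) (h : mulD F p n t (Sum.inl i) (z ⋆ ξ k) ∈ Q) :
    cField (g ⋆ (z ⋆ ξ c)) i k ∈ Q := by
  have h1 := hQ.lie_mem _ _ h (hQ.vert_mem g hg c k hck)
  rw [lie_eq_neg_cField hz hz1 hzk hg] at h1
  exact (Submodule.neg_mem_iff _).1 h1

/-- Induction on the degree in steps of two: [ξ^v' D_i, x_i ξ_a ξ_b D_j] = ξ^v' ξ_a ξ_b D_j for i ≠
j. -/
theorem mulD_inl_mon_mem (hQ : VerticalClosed Q) (hm : 3 ≤ m) (hn : 3 ≤ n) (N : ℕ) :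
    ∀ v : Finset (Fin n), v.card = 2 * (N + 1) → ∀ i,
      mulD F p n t (Sum.inl i) (mon F p n t 0 v) ∈ Q := by
  induction N with
  | zero =>
    intro v hv i
    obtain ⟨a, b, hab, rfl⟩ := Finset.card_eq_two.1 hv
    rw [mon_pair hab, map_smul]
    exact Submodule.smul_mem _ _ (hQ.pair_mem a b hab i)
  | succ N ih =>
    intro v hv j
    obtain ⟨a, ha⟩ : v.Nonempty := Finset.card_pos.1 (by omega)
    have hc1 := Finset.card_erase_of_mem ha
    obtain ⟨b, hb⟩ : (v.erase a).Nonempty := Finset.card_pos.1 (by omega)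
    have hc2 := Finset.card_erase_of_mem hb
    obtain ⟨i, hij, -⟩ := exists_ne_ne hm j j
    obtain ⟨k, hka, hkb⟩ := exists_ne_ne hn a b
    have hab : a ≠ b := (Finset.ne_of_mem_erase hb).symm
    have hpp := mul_mem_oddPoly (xi_mem_oddPoly (F := F) (p := p) (t := t) a) (xi_mem_oddPoly b)
    have hp0 := odd_mul_odd_mem (xi_mem_homog (F := F) (p := p) (t := t) a) (xi_mem_homog b)
    -- Because D_j(x_i) = 0 the divergence correction disappears, and this `cField` is x_i ξ_a ξ_b
    -- D_j. The third odd index k only serves to form the bracket.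
    have h1 := hQ.cField_mul_mem (xi_mem_oddPoly a) (xi_mem_homog a) (partial_inr_xi_of_ne hka)
      hkb.symm (gen_mem_evenPoly i) j (hQ.pair_mem a k hka.symm j)
    rw [cField, partial_inl_mul_oddPoly j _ hpp, partial_gen, if_neg (by simpa using hij.symm),
      map_zero, LinearMap.zero_apply, map_zero, LinearMap.zero_apply, map_zero, add_zero] at h1
    set v' := (v.erase a).erase b with hv'
    have hv0 : mon F p n t 0 v' ∈ homog F p n t 0 := by
      have := mon_mem_homog (F := F) (p := p) (t := t) 0 v'
      rwa [zmod_two_natCast_eq_zero.2 ⟨N + 1, by omega⟩] at this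
    have h2 := hQ.lie_mem _ _ (ih v' (by omega) i) h1
    rw [lie_mulD_mulD hv0 (even_add_mul_mem (evenPoly_le_homog (gen_mem_evenPoly i)) hp0),
      mem_oddPoly.1 (mon_mem_oddPoly v'), map_zero, map_zero, sub_zero,
      partial_inl_mul_oddPoly i _ hpp, partial_gen, if_pos rfl, one_mul', even_mul_comm hv0,
      alg_mul_assoc] at h2
    rw [mon_erase 0 ha, mon_erase 0 hb]
    simp only [map_smul]
    exact Submodule.smul_mem _ _ (Submodule.smul_mem _ _ h2)

theorem mulD_inl_mon_mem' (hQ : VerticalClosed Q) (hm : 3 ≤ m) (hn : 3 ≤ n) {v : Finset (Fin n)}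
    (hv : Even v.card) (hne : v.Nonempty) (i : Fin m) :
    mulD F p n t (Sum.inl i) (mon F p n t 0 v) ∈ Q := by
  obtain ⟨N, hN⟩ := hv
  have := Finset.card_pos.2 hne
  exact hQ.mulD_inl_mon_mem hm hn (N - 1) v (by omega) i

/-- Split off ξ_c from ξ^v and let k take its place: the bracket of ξ^w ξ_k D_i with g ξ_c D_k puts
c back and creates the factor g. -/
theorem cField_mon_mem (hQ : VerticalClosed Q) (hm : 3 ≤ m) (hn : 3 ≤ n) {v : Finset (Fin n)}
    (hv : Even v.card) (hne : v.Nonempty) {k : Fin n} (hk : k ∉ v) (i : Fin m) {g : Alg F p n t}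
    (hg : g ∈ evenPoly F p n t) : cField (g ⋆ mon F p n t 0 v) i k ∈ Q := by
  obtain ⟨c, hc⟩ := hne
  have hck : c ≠ k := fun h => hk (h ▸ hc)
  set w := v.erase c with hw
  have hcw : w.card + 1 = v.card := Finset.card_erase_add_one hc
  have hkw : k ∉ w := fun h => hk (Finset.mem_of_mem_erase h)
  have hz1 : mon F p n t 0 w ∈ homog F p n t 1 := by
    have := mon_mem_homog (F := F) (p := p) (t := t) 0 w
    rwa [zmod_two_natCast_eq_one.2 ?_] at this
    rw [← hcw] at hv
    rwa [← Nat.not_even_iff_odd, ← Nat.even_add_one]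
  have h1 : mulD F p n t (Sum.inl i) (mon F p n t 0 w ⋆ ξ k) ∈ Q := by
    have h2 := hQ.mulD_inl_mon_mem' hm hn (v := insert k w)
      (by rwa [Finset.card_insert_of_notMem hkw, hcw]) (Finset.insert_nonempty _ _) i
    rw [odd_mul_comm hz1 (xi_mem_homog k), xi_mul_mon, if_neg hkw, map_neg, map_smul]
    exact Submodule.neg_mem _ (Submodule.smul_mem _ _ h2)
  have h3 := hQ.cField_mul_mem (mon_mem_oddPoly w) hz1 (partial_inr_mon_of_notMem 0 hkw) hck hg i h1
  rw [mon_erase 0 hc, ← hw, odd_mul_comm (xi_mem_homog c) hz1]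
  rw [map_smul, cField_smul, map_neg, ← neg_one_smul F, cField_smul]
  exact Submodule.smul_mem _ _ (Submodule.smul_mem _ _ h3)

/-- For |u| = 1 this is an assumed vertical field. Otherwise ξ^u = ± ξ_a ξ^v with v nonempty, and
bracketing a `cField` on ξ^v with g ξ_a D_k gives a Wronskian as coefficient; every x^(α) is a
multiple of one. -/
theorem mulD_inr_mon_mem (hQ : VerticalClosed Q) (hm : 3 ≤ m) (hn : 3 ≤ n) (h2 : (2 : F) ≠ 0)
    {α : Fin m → ℕ} (hα : ∀ i, α i < p ^ t i)
    {u : Finset (Fin n)} (hu : Odd u.card) {k : Fin n} (hk : k ∉ u) :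
    mulD F p n t (Sum.inr k) (mon F p n t α u) ∈ Q := by
  obtain ⟨a, ha⟩ : u.Nonempty := Finset.card_pos.1 hu.pos
  have hka : k ≠ a := fun h => hk (h ▸ ha)
  set v := u.erase a with hv
  have hcv : v.card + 1 = u.card := Finset.card_erase_add_one ha
  have hve : Even v.card := by
    rw [← hcv] at hu
    rwa [← Nat.not_odd_iff_even, ← Nat.odd_add_one]
  have hkv : k ∉ v := fun h => hk (Finset.mem_of_mem_erase h)
  have hv0 : mon F p n t 0 v ∈ homog F p n t 0 := by
    have := mon_mem_homog (F := F) (p := p) (t := t) 0 v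
    rwa [zmod_two_natCast_eq_zero.2 hve] at this
  rw [mon_eq_mul α hα, mon_erase 0 ha, ← hv]
  rcases v.eq_empty_or_nonempty with h0 | h0
  · rw [h0, ← one, mul_one', map_smul, map_smul]
    exact Submodule.smul_mem _ _ (hQ.vert_mem _ (mon_mem_evenPoly α) a k hka.symm)
  · let i : Fin m := ⟨0, by omega⟩
    obtain ⟨f, hf, g, hg, c, hc⟩ := exists_mon_eq h2 i hα
    have h1 := hQ.lie_mem _ _ (hQ.cField_mon_mem hm hn hve h0 hkv i hf)
      (hQ.vert_mem g hg a k hka.symm)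
    rw [lie_cField_mulD hf hg (mon_mem_oddPoly v) hv0 (partial_inr_mon_of_notMem 0 hkv) hka] at h1
    rw [hc, map_smul, map_smul, map_smul, LinearMap.smul_apply, map_smul,
      ← even_mul_comm hv0 (gen F p n t (Sum.inr a))]
    exact Submodule.smul_mem _ _ (Submodule.smul_mem _ _ h1)

theorem Drs_mon_mem (hQ : VerticalClosed Q) (hm : 3 ≤ m) (hn : 3 ≤ n) (h2 : (2 : F) ≠ 0)
    (hC : ∀ g ∈ evenPoly F p n t, ∀ i k, cField g i k ∈ Q) (r s : Var m n)
    {α : Fin m → ℕ} (hα : ∀ i, α i < p ^ t i) {u : Finset (Fin n)}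
    (hu : (u.card : ZMod 2) = tau r + tau s) : Drs F p n t r s (mon F p n t α u) ∈ Q := by
  have hle : ∀ i j, (α - Pi.single i 1 : Fin m → ℕ) j < p ^ t j :=
    fun i j => lt_of_le_of_lt (Nat.sub_le _ _) (hα j)
  have hC' : ∀ (β : Fin m → ℕ), (∀ i, β i < p ^ t i) → ∀ v : Finset (Fin n), Even v.card →
      ∀ i, ∀ k ∉ v, cField (mon F p n t β v) i k ∈ Q := by
    intro β hβ v hv i k hk
    rcases v.eq_empty_or_nonempty with h0 | h0
    · subst h0; exact hC _ (mon_mem_evenPoly β) i k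
    · rw [mon_eq_mul β hβ]
      exact hQ.cField_mon_mem hm hn hv h0 hk i (mon_mem_evenPoly β)
  have hCpartial : ∀ i j, Even u.card → ∀ k ∉ u,
      cField (𝔡 (Sum.inl i) (mon F p n t α u)) j k ∈ Q := by
    intro i j hu k hk
    rw [partial_inl_mon i hα]
    split_ifs
    · rw [cField]; simp
    · exact hC' _ (hle i) u hu j k hk
  have hmix : ∀ i k, Odd u.card →
      Drs F p n t (Sum.inl i) (Sum.inr k) (mon F p n t α u) ∈ Q := by
    intro i k hodd
    by_cases hk : k ∈ u
    · have hcv := Finset.card_erase_add_one hk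
      have hev : Even (u.erase k).card := by
        rw [← hcv] at hodd
        rwa [← Nat.not_odd_iff_even, ← Nat.odd_add_one]
      have hv0 : mon F p n t α (u.erase k) ∈ homog F p n t 0 := by
        have := mon_mem_homog (F := F) (p := p) (t := t) α (u.erase k)
        rwa [zmod_two_natCast_eq_zero.2 hev] at this
      have := Drs_xi_mul hv0 (partial_inr_mon_of_notMem α (Finset.notMem_erase k u)) i
      rw [mon_erase α hk]
      have h3 : ∀ (c : F) (f : Alg F p n t), Drs F p n t (Sum.inl i) (Sum.inr k) (c • f) =
          c • Drs F p n t (Sum.inl i) (Sum.inr k) f := by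
        intro c f
        simp only [Drs, map_smul, smul_sub, smul_comm c]
      rw [h3, this]
      exact Submodule.smul_mem _ _ (hC' α hα _ hev i k (Finset.notMem_erase k u))
    · have h1 := partial_inr_mon_of_notMem (F := F) (p := p) (t := t) α hk
      rw [Drs, twist_mon, map_smul, h1, smul_zero, map_zero, sub_zero, partial_inl_mon i hα]
      refine Submodule.smul_mem _ _ ?_
      split_ifs
      · simp
      · exact hQ.mulD_inr_mon_mem hm hn h2 (hle i) hodd hk
  rcases r with i | k <;> rcases s with j | l
  · have hev : Even u.card := by
      rw [← zmod_two_natCast_eq_zero, hu]; simp [tau]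
    by_cases hk : ∃ k, k ∉ u
    · obtain ⟨k, hk⟩ := hk
      have h1 : Drs F p n t (Sum.inl i) (Sum.inl j) (mon F p n t α u) =
          cField (𝔡 (Sum.inl i) (mon F p n t α u)) j k -
            cField (𝔡 (Sum.inl j) (mon F p n t α u)) i k := by
        rw [Drs, cField, cField, partial_inl_comm i j]
        simp [tau, sgn_zero_left, twist_zero]
      rw [h1]
      exact Submodule.sub_mem _ (hCpartial i j hev k hk) (hCpartial j i hev k hk)
    -- When u contains all odd variables, D_ij cannot be a difference of two `cField`s. Two factors
    -- ξ_k ξ_l are split off instead; n ≥ 3 and the parity of u keep the rest nonempty.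
    · push Not at hk
      let k : Fin n := ⟨0, by omega⟩
      let l : Fin n := ⟨1, by omega⟩
      have hkl : k ≠ l := by simp [k, l]
      have hl : l ∈ u.erase k := Finset.mem_erase.2 ⟨hkl.symm, hk l⟩
      set v := (u.erase k).erase l with hv
      have hc1 := Finset.card_erase_add_one (hk k)
      have hc2 := Finset.card_erase_add_one hl
      have huniv : u.card = n := by
        rw [Finset.eq_univ_iff_forall.2 hk, Finset.card_univ, Fintype.card_fin]
      have hve : Even v.card := by
        rw [← hc1, ← hc2, add_assoc] at hev
        simpa [Nat.even_add] using hev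
      have hkv : k ∉ v := fun h => Finset.notMem_erase k u (Finset.mem_of_mem_erase h)
      have hv0 : mon F p n t 0 v ∈ homog F p n t 0 := by
        have := mon_mem_homog (F := F) (p := p) (t := t) 0 v
        rwa [zmod_two_natCast_eq_zero.2 hve] at this
      have hvpos : 0 < v.card := by
        rw [huniv] at hc1
        change v.card + 1 = _ at hc2
        omega
      have hvne : v.Nonempty := Finset.card_pos.1 hvpos
      have h1 := hQ.lie_mem _ _ (hQ.cField_mon_mem hm hn hve hvne hkv i (mon_mem_evenPoly α))
        (hQ.pair_mem k l hkl j)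
      rw [lie_cField_mulD_inl (mon_mem_evenPoly α) (mon_mem_oddPoly v) hv0 hkl] at h1
      have hpp := mul_mem_oddPoly (mon_mem_oddPoly (F := F) (p := p) (t := t) v)
        (mul_mem_oddPoly (xi_mem_oddPoly k) (xi_mem_oddPoly l))
      obtain ⟨c, hc⟩ : ∃ c : F, mon F p n t α u =
          c • (mon F p n t α ∅ ⋆ (mon F p n t 0 v ⋆ (ξ k ⋆ ξ l))) := by
        rw [mon_eq_mul α hα u, mon_erase 0 (hk k), mon_erase 0 hl, ← hv, even_mul_comm hv0]
        refine ⟨extSign F {k} (u.erase k) * extSign F {l} v, ?_⟩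
        simp only [map_smul, smul_smul, alg_mul_assoc]
      rw [hc, Drs, twist_of_mem (even_add_mul_mem (mon_empty_mem_homog α) (even_add_mul_mem hv0
        (odd_mul_odd_mem (xi_mem_homog k) (xi_mem_homog l))) |> Submodule.smul_mem _ c)]
      simp only [map_smul]
      rw [partial_inl_mul_oddPoly i _ hpp, partial_inl_mul_oddPoly j _ hpp]
      simp only [tau, Sum.elim_inl, sgn_zero_left, add_zero, one_smul]
      rw [← smul_sub]
      exact Submodule.smul_mem _ _ h1
  · exact hmix i l (by rw [← zmod_two_natCast_eq_one, hu]; simp [tau])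
  · have hodd : Odd u.card := by rw [← zmod_two_natCast_eq_one, hu]; simp [tau]
    have h1 : Drs F p n t (Sum.inr k) (Sum.inl j) (mon F p n t α u) =
        Drs F p n t (Sum.inl j) (Sum.inr k) (mon F p n t α u) := by
      rw [Drs, Drs, twist_mon, twist_mon, zmod_two_natCast_eq_one.2 hodd]
      simp [tau, sgn_zero_left, sgn_zero_right, sgn_one_one]
      abel
    rw [h1]
    exact hmix j k hodd
  · have hev : Even u.card := by
      rw [← zmod_two_natCast_eq_zero, hu]; simp [tau]; decide
    have h1 : Drs F p n t (Sum.inr k) (Sum.inr l) (mon F p n t α u) =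
        -(mulD F p n t (Sum.inr l) (𝔡 (Sum.inr k) (mon F p n t α u)) +
          mulD F p n t (Sum.inr k) (𝔡 (Sum.inr l) (mon F p n t α u))) := by
      rw [Drs, twist_mon, zmod_two_natCast_eq_zero.2 hev]
      simp [tau, sgn_zero_right, sgn_one_one]
      abel
    rw [h1]
    refine Submodule.neg_mem _ ?_
    have hA : ∀ a b, (a = b ∨ b ∉ u) →
        mulD F p n t (Sum.inr b) (𝔡 (Sum.inr a) (mon F p n t α u)) ∈ Q := by
      intro a b hab
      rw [partial_inr_mon]
      split_ifs with ha
      · rw [map_smul]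
        refine Submodule.smul_mem _ _ (hQ.mulD_inr_mon_mem hm hn h2 hα ?_ ?_)
        · rw [← Finset.card_erase_add_one ha] at hev
          rwa [← Nat.not_even_iff_odd, ← Nat.even_add_one]
        · rcases hab with rfl | hb
          · exact Finset.notMem_erase _ _
          · exact fun h => hb (Finset.mem_of_mem_erase h)
      · simp
    by_cases hkl : k = l
    · subst hkl
      exact Submodule.add_mem _ (hA k k (Or.inl rfl)) (hA k k (Or.inl rfl))
    by_cases hk : k ∈ u
    swap
    · have : 𝔡 (Sum.inr k) (mon F p n t α u) = 0 := partial_inr_mon_of_notMem α hk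
      rw [this, map_zero, zero_add]
      exact hA l k (Or.inr hk)
    by_cases hl : l ∈ u
    swap
    · have : 𝔡 (Sum.inr l) (mon F p n t α u) = 0 := partial_inr_mon_of_notMem α hl
      rw [this, map_zero, add_zero]
      exact hA k l (Or.inr hl)
    -- With k and l both in u, each summand keeps its own odd variable in its coefficient, so
    -- neither can be treated alone; together they are a multiple of [ξ_k f D_l, ξ_l D_k].
    have hl' : l ∈ u.erase k := Finset.mem_erase.2 ⟨fun h => hkl h.symm, hl⟩
    set w := (u.erase k).erase l with hw
    have hc1 := Finset.card_erase_add_one hk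
    have hc2 := Finset.card_erase_add_one hl'
    have hwe : Even w.card := by
      rw [← hc1, ← hc2, add_assoc] at hev
      simpa [Nat.even_add] using hev
    have hkw : k ∉ w := fun h => Finset.notMem_erase k u (Finset.mem_of_mem_erase h)
    have hlw : l ∉ w := Finset.notMem_erase l _
    have hw0 : mon F p n t α w ∈ homog F p n t 0 := by
      have := mon_mem_homog (F := F) (p := p) (t := t) α w
      rwa [zmod_two_natCast_eq_zero.2 hwe] at this
    have hkx := partial_inr_mon_of_notMem (F := F) (p := p) (t := t) α hkw
    have hlx := partial_inr_mon_of_notMem (F := F) (p := p) (t := t) α hlw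
    have h3 : mulD F p n t (Sum.inr l) (ξ k ⋆ mon F p n t α w) ∈ Q := by
      rw [xi_mul_mon, if_neg hkw, map_smul]
      refine Submodule.smul_mem _ _ (hQ.mulD_inr_mon_mem hm hn h2 hα ?_ ?_)
      · rw [Finset.card_insert_of_notMem hkw]; exact hwe.add_one
      · rw [Finset.mem_insert]; rintro (h | h)
        · exact hkl h.symm
        · exact hlw h
    have h4 : mulD F p n t (Sum.inr k) (ξ l) ∈ Q := by
      have := hQ.vert_mem _ one_mem_evenPoly l k (fun h => hkl h.symm)
      rwa [one_mul'] at this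
    have h5 := hQ.lie_mem _ _ h3 h4
    rw [lie_mulD_xi_mul hw0 hkx] at h5
    rw [mon_erase α hk, mon_erase α hl', ← hw]
    simp only [map_smul]
    rw [partial_inr_xi_mul, if_pos rfl, partial_inr_xi_mul, if_neg hkl, partial_inr_xi_mul,
      if_neg (fun h => hkl h.symm), partial_inr_xi_mul, if_pos rfl, hkx, hlx]
    have h6 : ∀ (a b : F), a • b • mulD F p n t (Sum.inr l) (ξ l ⋆ mon F p n t α w - 
          gen F p n t (Sum.inr k) ⋆ (0 - gen F p n t (Sum.inr l) ⋆ 0)) +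
        a • b • mulD F p n t (Sum.inr k) (0 - gen F p n t (Sum.inr k) ⋆ (mon F p n t α w -
          gen F p n t (Sum.inr l) ⋆ 0)) =
        (-(a * b)) • (mulD F p n t (Sum.inr k) (ξ k ⋆ mon F p n t α w) -
          mulD F p n t (Sum.inr l) (ξ l ⋆ mon F p n t α w)) := by
      intro a b
      simp only [map_zero, sub_zero, zero_sub, map_neg]
      module
    rw [h6]
    exact Submodule.smul_mem _ _ h5

/-- The generation statement for 𝒮: beyond the vertical fields and the ξ_a ξ_b D_i, only the
`cField`s with purely even coefficients have to be checked. It is applied to the part of 𝒮 killed by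
a derivation. -/
theorem evenS_le (hQ : VerticalClosed Q) (hm : 3 ≤ m) (hn : 3 ≤ n) (h2 : (2 : F) ≠ 0)
    (hC : ∀ g ∈ evenPoly F p n t, ∀ i k, cField g i k ∈ Q) : evenS F p n t ≤ Q := by
  refine (evenS_le_span h2).trans (Submodule.span_le.2 ?_)
  rintro E ⟨r, s, f, hf, rfl⟩
  refine homog_ind (P := fun f => Drs F p n t r s f ∈ Q) hf ?_ ?_ ?_ ?_
  · simp [Drs]
  · intro f g hf hg
    have : Drs F p n t r s (f + g) = Drs F p n t r s f + Drs F p n t r s g := by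
      simp only [Drs, map_add, smul_add]; abel
    rw [this]
    exact Submodule.add_mem _ hf hg
  · intro c f hf
    have : Drs F p n t r s (c • f) = c • Drs F p n t r s f := by
      simp only [Drs, map_smul, smul_sub, smul_comm c]
    rw [this]
    exact Submodule.smul_mem _ _ hf
  · intro α hα u hu
    exact hQ.Drs_mon_mem hm hn h2 hC r s hα hu

end VerticalClosed

/-! ### Coefficients -/

instance finite_idx : Finite (Idx p n t) := by
  have : Finite {α : Fin m → ℕ // ∀ i, α i < p ^ t i} :=
    Finite.of_injective (fun a i => (⟨a.1 i, a.2 i⟩ : Fin (p ^ t i))) fun a b h =>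
      Subtype.ext (funext fun i => congrArg Fin.val (congrFun h i))
  exact inferInstanceAs (Finite (_ × _))

open scoped Classical in
/-- The coefficient of `x^(α) x^u`, which is zero if `α` is out of range. -/
noncomputable def coeffAt (α : Fin m → ℕ) (u : Finset (Fin n)) : Alg F p n t →ₗ[F] F :=
  if h : ∀ i, α i < p ^ t i then Finsupp.lapply (⟨α, h⟩, u) else 0

theorem coeffAt_of_mem {α : Fin m → ℕ} (h : ∀ i, α i < p ^ t i) (u : Finset (Fin n))
    (f : Alg F p n t) : coeffAt α u f = f (⟨α, h⟩, u) := by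
  rw [coeffAt, dif_pos h, Finsupp.lapply_apply]

theorem coeffAt_of_not {α : Fin m → ℕ} (h : ¬ ∀ i, α i < p ^ t i) (u : Finset (Fin n))
    (f : Alg F p n t) : coeffAt α u f = 0 := by
  rw [coeffAt, dif_neg h, LinearMap.zero_apply]

theorem range_of_coeffAt_ne_zero {α : Fin m → ℕ} {u : Finset (Fin n)} {f : Alg F p n t}
    (h : coeffAt α u f ≠ 0) : ∀ i, α i < p ^ t i := by
  by_contra h'
  exact h (coeffAt_of_not h' u f)

theorem alg_ext {f g : Alg F p n t} (h : ∀ α u, (∀ i, α i < p ^ t i) →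
    coeffAt α u f = coeffAt α u g) : f = g := by
  refine Finsupp.ext fun b => ?_
  have := h b.1.1 b.2 b.1.2
  rwa [coeffAt_of_mem b.1.2, coeffAt_of_mem b.1.2] at this

theorem coeffAt_mon {β : Fin m → ℕ} (hβ : ∀ i, β i < p ^ t i) (α : Fin m → ℕ)
    (u v : Finset (Fin n)) :
    coeffAt α u (mon F p n t β v) = if β = α ∧ v = u then 1 else 0 := by
  by_cases h : ∀ i, α i < p ^ t i
  · rw [coeffAt_of_mem h, mon_of_mem hβ, Finsupp.single_apply]
    simp
  · rw [coeffAt_of_not h, if_neg]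
    rintro ⟨rfl, -⟩
    exact h hβ

theorem exists_coeffAt (c : (Fin m → ℕ) → Finset (Fin n) → F) :
    ∃ f : Alg F p n t, ∀ α u, (∀ i, α i < p ^ t i) → coeffAt α u f = c α u :=
  ⟨Finsupp.equivFunOnFinite.symm fun b => c b.1.1 b.2, fun α u h => by
    rw [coeffAt_of_mem h]; rfl⟩

theorem mem_homog_iff_coeffAt {θ : ZMod 2} {f : Alg F p n t} :
    f ∈ homog F p n t θ ↔ ∀ α u, coeffAt α u f ≠ 0 → (u.card : ZMod 2) = θ := by
  rw [mem_homog]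
  constructor
  · intro h α u hu
    have hα := range_of_coeffAt_ne_zero hu
    rw [coeffAt_of_mem hα] at hu
    exact h _ hu
  · intro h b hb
    refine h b.1.1 b.2 ?_
    rwa [coeffAt_of_mem b.1.2]

theorem coeffAt_partial_inl (i : Fin m) (f : Alg F p n t) (α : Fin m → ℕ) (u : Finset (Fin n)) :
    coeffAt α u (𝔡 (Sum.inl i) f) = coeffAt (α + Pi.single i 1) u f := by
  by_cases h : ∀ j, (α + Pi.single i 1 : Fin m → ℕ) j < p ^ t j
  · have hα : ∀ j, α j < p ^ t j := fun j => lt_of_le_of_lt (Nat.le_add_right _ _) (h j)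
    rw [coeffAt_of_mem h, coeffAt_of_mem hα, partial_inl_coeff, dif_pos h]
  · rw [coeffAt_of_not h]
    by_cases hα : ∀ j, α j < p ^ t j
    · rw [coeffAt_of_mem hα, partial_inl_coeff, dif_neg h]
    · rw [coeffAt_of_not hα]

theorem coeffAt_partial_pow (i : Fin m) (N : ℕ) (f : Alg F p n t) (α : Fin m → ℕ)
    (u : Finset (Fin n)) : coeffAt α u ((partialD F p n t (Sum.inl i) ^ N) f) =
      coeffAt (α + Pi.single i N) u f := by
  induction N generalizing α with
  | zero => simp
  | succ N ih =>
    rw [pow_succ', Module.End.mul_apply, coeffAt_partial_inl, ih, add_assoc, ← Pi.single_add,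
      add_comm 1 N]

theorem partial_pow_eq_zero (i : Fin m) : partialD F p n t (Sum.inl i) ^ p ^ t i = 0 := by
  refine LinearMap.ext fun f => alg_ext fun α u _ => ?_
  rw [coeffAt_partial_pow, coeffAt_of_not, LinearMap.zero_apply, map_zero]
  intro h
  have := h i
  simp at this

theorem sub_add_single {α : Fin m → ℕ} {i : Fin m} (h : α i ≠ 0) :
    α - Pi.single i 1 + Pi.single i 1 = α := by
  refine tsub_add_cancel_of_le fun j => ?_
  by_cases hj : j = i
  · subst hj; simp; omega
  · simp [hj]

/-- Poincaré lemma for the truncated divided power algebra. -/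
theorem exists_partial_eq {θ : ZMod 2} (f : Fin m → Alg F p n t)
    (hf : ∀ i, f i ∈ homog F p n t θ)
    (hclosed : ∀ i j, 𝔡 (Sum.inl i) (f j) = 𝔡 (Sum.inl j) (f i))
    (htop : ∀ i, (partialD F p n t (Sum.inl i) ^ (p ^ t i - 1)) (f i) = 0) :
    ∃ g ∈ homog F p n t θ, ∀ i, 𝔡 (Sum.inl i) g = f i := by
  classical
  -- Integrate the coefficient at α along an arbitrarily chosen direction i with α_i ≠ 0; closedness
  -- makes the value independent of the choice. The constant terms are set to zero.
  obtain ⟨g, hg⟩ := exists_coeffAt (F := F) (p := p) (n := n) (t := t) fun α u =>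
    if h : ∃ i, α i ≠ 0 then coeffAt (α - Pi.single h.choose 1) u (f h.choose) else 0
  have key : ∀ (α : Fin m → ℕ) u, (∀ i, α i < p ^ t i) → ∀ i, α i ≠ 0 →
      coeffAt α u g = coeffAt (α - Pi.single i 1) u (f i) := by
    intro α u hα i hi
    have h : ∃ i, α i ≠ 0 := ⟨i, hi⟩
    rw [hg α u hα, dif_pos h]
    have hj := h.choose_spec
    generalize h.choose = j at hj
    by_cases hij : i = j
    · rw [hij]
    have hj' : (α - Pi.single i 1 : Fin m → ℕ) j ≠ 0 := by simpa [Ne.symm hij] using hj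
    have hi' : (α - Pi.single j 1 : Fin m → ℕ) i ≠ 0 := by simpa [hij] using hi
    have h1 := congrArg (coeffAt (α - Pi.single i 1 - Pi.single j 1) u) (hclosed i j)
    rw [coeffAt_partial_inl, coeffAt_partial_inl, sub_add_single hj',
      tsub_right_comm, sub_add_single hi'] at h1
    exact h1
  refine ⟨g, mem_homog_iff_coeffAt.2 fun α u h => ?_, fun i => alg_ext fun α u hα => ?_⟩
  · have hα := range_of_coeffAt_ne_zero h
    rw [hg α u hα] at h
    split_ifs at h with h'
    · exact mem_homog_iff_coeffAt.1 (hf _) _ _ h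
    · exact absurd rfl h
  · rw [coeffAt_partial_inl]
    by_cases h : ∀ j, (α + Pi.single i 1 : Fin m → ℕ) j < p ^ t j
    · rw [key _ u h i (by simp), add_tsub_cancel_right]
    · rw [coeffAt_of_not h]
      -- A monomial with top exponent in direction i has no antiderivative, and the hypothesis on
      -- D_i^(p^t_i - 1) says that f_i contains none.
      have h1 : α i + 1 = p ^ t i := by
        push Not at h
        obtain ⟨j, hj⟩ := h
        have := hα j
        by_cases hji : j = i
        · subst hji
          simp at hj
          omega
        · simp [hji] at hj
          omega
      have h2 := congrArg (coeffAt (α - Pi.single i (p ^ t i - 1)) u) (htop i)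
      rw [coeffAt_partial_pow, map_zero, tsub_add_cancel_of_le] at h2
      · exact h2.symm
      · intro j
        by_cases hji : j = i
        · subst hji; simp; omega
        · simp [hji]

/-- The constant term is the augmentation of 𝔄, hence multiplicative. -/
theorem coeffAt_zero_empty_mul (f g : Alg F p n t) :
    coeffAt 0 ∅ (f ⋆ g) = coeffAt 0 ∅ f * coeffAt 0 ∅ g := by
  induction f using alg_ind with
  | zero => simp
  | add f f' hf hf' => rw [map_add, LinearMap.add_apply, map_add, map_add, hf, hf', add_mul]
  | smul c f hf =>
    rw [map_smul, LinearMap.smul_apply, map_smul, map_smul, hf, smul_eq_mul, smul_eq_mul,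
      mul_assoc]
  | mon α hα u =>
    induction g using alg_ind with
    | zero => simp
    | add g g' hg hg' => rw [map_add, map_add, map_add, hg, hg', mul_add]
    | smul c g hg =>
      rw [map_smul, map_smul, map_smul, hg, smul_eq_mul, smul_eq_mul, mul_left_comm]
    | mon β hβ v =>
      rw [mul_mon _ _ _ _ hα hβ, coeffAt_mon hα, coeffAt_mon hβ]
      by_cases h : (α = 0 ∧ u = ∅) ∧ β = 0 ∧ v = ∅
      · obtain ⟨⟨rfl, rfl⟩, rfl, rfl⟩ := h
        simp [dpCoeff_zero_left, extSign_empty_left, coeffAt_mon hα]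
      · have h1 : ((if α = 0 ∧ u = ∅ then (1 : F) else 0) * if β = 0 ∧ v = ∅ then 1 else 0) = 0 := by
          by_cases h2 : α = 0 ∧ u = ∅
          · rw [if_neg (c := β = 0 ∧ v = ∅) (fun h3 => h ⟨h2, h3⟩), mul_zero]
          · rw [if_neg h2, zero_mul]
        rw [h1]
        split_ifs
        · rw [map_smul]
          by_cases h2 : ∀ i, (α + β) i < p ^ t i
          · rw [coeffAt_mon h2, if_neg, smul_zero]
            rintro ⟨h3, h4⟩
            refine h ?_
            rw [Finset.union_eq_empty] at h4
            rw [add_eq_zero] at h3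
            exact ⟨⟨h3.1, h4.1⟩, h3.2, h4.2⟩
          · rw [mon_of_not h2, map_zero, smul_zero]
        · rw [map_zero]

theorem eq_zero_of_coeffAt_ne_zero {f : Alg F p n t} (hf : f ∈ oddPoly F p n t) {α : Fin m → ℕ}
    {u : Finset (Fin n)} (h : coeffAt α u f ≠ 0) : α = 0 := by
  by_contra h0
  obtain ⟨i, hi⟩ := Function.ne_iff.1 h0
  rw [← sub_add_single hi, ← coeffAt_partial_inl, mem_oddPoly.1 hf, map_zero] at h
  exact h rfl

theorem mem_oddPoly_of_coeffAt {f : Alg F p n t}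
    (h : ∀ α u, coeffAt α u f ≠ 0 → α = 0) : f ∈ oddPoly F p n t := by
  refine mem_oddPoly.2 fun i => alg_ext fun α u _ => ?_
  rw [coeffAt_partial_inl, map_zero]
  by_contra h1
  have := congrFun (h _ _ h1) i
  simp at this

theorem eq_empty_of_coeffAt_ne_zero {f : Alg F p n t} (hf : f ∈ evenPoly F p n t)
    {α : Fin m → ℕ} {u : Finset (Fin n)} (h : coeffAt α u f ≠ 0) : u = ∅ := by
  have hα := range_of_coeffAt_ne_zero h
  rw [coeffAt_of_mem hα] at h
  exact eq_empty_of_mem_evenPoly hf h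

theorem exists_evenPoly_mul {f : Alg F p n t} {v : Finset (Fin n)}
    (h : ∀ α u, coeffAt α u f ≠ 0 → u = v) :
    ∃ g ∈ evenPoly F p n t, f = g ⋆ mon F p n t 0 v := by
  have h1 : f ∈ Finsupp.supported F F {b : Idx p n t | b.2 = v} := by
    rw [Finsupp.mem_supported]
    intro b hb
    refine h b.1.1 b.2 ?_
    rw [coeffAt_of_mem b.1.2]
    exact Finsupp.mem_support_iff.1 hb
  rw [Finsupp.supported_eq_span_single] at h1
  clear h
  induction h1 using Submodule.span_induction with
  | mem x hx =>
    obtain ⟨b, rfl, rfl⟩ := hx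
    refine ⟨_, mon_mem_evenPoly b.1.1, ?_⟩
    rw [← mon_eq_mul _ b.1.2]
    exact single_eq_mon b
  | zero => exact ⟨0, Submodule.zero_mem _, by simp⟩
  | add x y _ _ hx hy =>
    obtain ⟨g, hg, rfl⟩ := hx
    obtain ⟨g', hg', rfl⟩ := hy
    exact ⟨g + g', Submodule.add_mem _ hg hg', by rw [map_add, LinearMap.add_apply]⟩
  | smul c x _ hx =>
    obtain ⟨g, hg, rfl⟩ := hx
    exact ⟨c • g, Submodule.smul_mem _ _ hg, by rw [map_smul, LinearMap.smul_apply]⟩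

theorem exists_smul_mon {f : Alg F p n t} {v : Finset (Fin n)}
    (h : ∀ α u, coeffAt α u f ≠ 0 → α = 0 ∧ u = v) : ∃ c : F, f = c • mon F p n t 0 v := by
  refine ⟨coeffAt 0 v f, alg_ext fun α u hα => ?_⟩
  rw [map_smul, coeffAt_mon (zero_lt_of_lt hα), smul_eq_mul]
  split_ifs with h1
  · rw [h1.1, h1.2, mul_one]
  · rw [mul_zero]
    by_contra h2
    obtain ⟨rfl, rfl⟩ := h _ _ h2
    exact h1 ⟨rfl, rfl⟩
/-! ### Weights -/

section

variable [CharP F p] [Fact p.Prime] [Fact (∀ i, 1 ≤ t i)]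

/-- The eigenvalue of `x_r D_r` on `x^(α) x^u`. -/
def wt (F : Type*) [Field F] (r : Var m n) (α : Fin m → ℕ) (u : Finset (Fin n)) : F :=
  match r with
  | Sum.inl i => (α i : F)
  | Sum.inr k => if k ∈ u then 1 else 0

theorem gen_mul_partial_mon' (r : Var m n) {α : Fin m → ℕ} (hα : ∀ i, α i < p ^ t i)
    (u : Finset (Fin n)) :
    gen F p n t r ⋆ 𝔡 r (mon F p n t α u) = wt F r α u • mon F p n t α u := by
  rcases r with i | k
  · exact gen_mul_partial_mon i hα u
  · rw [wt]
    split_ifs with hk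
    · rw [mon_erase α hk, map_smul, partial_inr_xi_mul, if_pos rfl,
        partial_inr_mon_of_notMem α (Finset.notMem_erase k u), map_zero, sub_zero, map_smul,
        one_smul]
    · rw [partial_inr_mon_of_notMem α hk, map_zero, zero_smul]

theorem coeffAt_gen_mul_partial (r : Var m n) (f : Alg F p n t) (α : Fin m → ℕ)
    (u : Finset (Fin n)) :
    coeffAt α u (gen F p n t r ⋆ 𝔡 r f) = wt F r α u * coeffAt α u f := by
  induction f using alg_ind with
  | zero => simp
  | add f g hf hg => rw [map_add, map_add, map_add, hf, hg, map_add, mul_add]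
  | smul c f hf =>
    rw [map_smul, map_smul, map_smul, hf, map_smul, smul_eq_mul, smul_eq_mul, mul_left_comm]
  | mon β hβ v =>
    rw [gen_mul_partial_mon' r hβ, map_smul, coeffAt_mon hβ, smul_eq_mul]
    split_ifs with h
    · rw [h.1, h.2]
    · simp

/-- The monomial fields x^(α) x^u D_s are simultaneous eigenvectors of the torus, so an eigenvector
involves only monomial fields of its own weight. All weight arguments rest on this. -/
theorem coeffAt_lie_torus (r s : Var m n) (E : Module.End F (Alg F p n t)) (α : Fin m → ℕ)
    (u : Finset (Fin n)) :
    coeffAt α u (⁅mulD F p n t r (gen F p n t r), E⁆ (gen F p n t s)) =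
      (wt F r α u - if r = s then 1 else 0) * coeffAt α u (E (gen F p n t s)) := by
  rw [end_lie_apply, mulD_apply, map_sub, coeffAt_gen_mul_partial, mulD_gen]
  split_ifs with h
  · rw [h, sub_mul, one_mul]
  · simp

/-- The element `x_i D_i + ξ_k D_k` of the torus of `𝒮`. -/
noncomputable def hField (F : Type*) [Field F] (p : ℕ) {m n : ℕ} (t : Fin m → ℕ) (i : Fin m)
    (k : Fin n) : Module.End F (Alg F p n t) :=
  mulD F p n t (Sum.inl i) (gen F p n t (Sum.inl i)) +
    mulD F p n t (Sum.inr k) (gen F p n t (Sum.inr k))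

theorem hField_eq_cField (i : Fin m) (k : Fin n) :
    hField F p t i k = cField (gen F p n t (Sum.inl i)) i k := by
  rw [hField, cField, partial_gen, if_pos rfl, one_mul']

theorem hField_mem_evenS (i : Fin m) (k : Fin n) : hField F p t i k ∈ evenS F p n t := by
  rw [hField_eq_cField]
  exact cField_mem_evenS (mon_empty_mem_homog _) (mem_evenPoly.1 (gen_mem_evenPoly i) k) i

theorem coeffAt_lie_hField (i : Fin m) (k : Fin n) (s : Var m n) (E : Module.End F (Alg F p n t))
    (α : Fin m → ℕ) (u : Finset (Fin n)) :
    coeffAt α u (⁅hField F p t i k, E⁆ (gen F p n t s)) =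
      (wt F (Sum.inl i) α u + wt F (Sum.inr k) α u -
        ((if Sum.inl i = s then 1 else 0) + if Sum.inr k = s then 1 else 0)) *
        coeffAt α u (E (gen F p n t s)) := by
  rw [hField, add_lie, LinearMap.add_apply, map_add, coeffAt_lie_torus, coeffAt_lie_torus]
  ring

theorem weight_of_lie {i : Fin m} {k : Fin n} {E : Module.End F (Alg F p n t)} {c : F}
    (h : ⁅hField F p t i k, E⁆ = c • E) {s : Var m n} {α : Fin m → ℕ} {u : Finset (Fin n)}
    (hne : coeffAt α u (E (gen F p n t s)) ≠ 0) :
    (α i : F) + (if k ∈ u then 1 else 0) -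
      ((if Sum.inl i = s then 1 else 0) + if Sum.inr k = s then 1 else 0) = c := by
  have h1 := coeffAt_lie_hField i k s E α u
  rw [h, LinearMap.smul_apply, map_smul, smul_eq_mul] at h1
  exact (mul_right_cancel₀ hne h1).symm

theorem lie_partial_gen (i : Fin m) {E : Module.End F (Alg F p n t)} (hE : E ∈ evenFields F p n t)
    (s : Var m n) : ⁅partialD F p n t (Sum.inl i), E⁆ (gen F p n t s) =
      𝔡 (Sum.inl i) (E (gen F p n t s)) := by
  rw [end_lie_apply, partial_gen, apply_ite E, evenField_map_one hE, map_zero, ite_self, sub_zero]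

theorem lie_partial_eq_zero_iff {E : Module.End F (Alg F p n t)} (hE : E ∈ evenFields F p n t) :
    (∀ i, ⁅partialD F p n t (Sum.inl i), E⁆ = 0) ↔ ∀ s, E (gen F p n t s) ∈ oddPoly F p n t := by
  constructor
  · intro h s
    refine mem_oddPoly.2 fun i => ?_
    rw [← lie_partial_gen i hE, h, LinearMap.zero_apply]
  · intro h i
    refine evenFields_ext (lie_mem_evenFields (partial_inl_mem_evenFields i) hE)
      (Submodule.zero_mem _) fun s => ?_
    rw [lie_partial_gen i hE, LinearMap.zero_apply]
    exact mem_oddPoly.1 (h s) i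

/-! ### The centralizer of the linear part of `𝒮` -/

/-- With constant coefficients in the x_i, weight zero under h_ik reads [k ∈ u] = [i = j] at D_j,
contradictory as i varies, and [k ∈ u] = [k = l] at D_(ξ_l), which forces u = {l}. -/
theorem gen_of_lie_hField_eq_zero (hm : 3 ≤ m) {E : Module.End F (Alg F p n t)}
    (hV : ∀ s, E (gen F p n t s) ∈ oddPoly F p n t) (h : ∀ i (k : Fin n), ⁅hField F p t i k, E⁆ = 0) :
    (0 < n → ∀ j, E (gen F p n t (Sum.inl j)) = 0) ∧
      ∃ b : Fin n → F, ∀ l, E (ξ l) = b l • ξ l := by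
  have h0 : ∀ i (k : Fin n), ⁅hField F p t i k, E⁆ = (0 : F) • E := fun i k => by
    rw [h, zero_smul]
  constructor
  · intro hn j
    refine alg_ext fun α u _ => ?_
    rw [map_zero]
    by_contra hne
    have hα := eq_zero_of_coeffAt_ne_zero (hV _) hne
    obtain ⟨i, hij, -⟩ := exists_ne_ne hm j j
    have h1 := weight_of_lie (h0 i ⟨0, hn⟩) hne
    have h2 := weight_of_lie (h0 j ⟨0, hn⟩) hne
    rw [hα] at h1 h2
    simp [hij] at h1 h2
    simp [h1] at h2
  · have : ∀ l, ∃ c : F, E (ξ l) = c • ξ l := by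
      intro l
      refine exists_smul_mon fun α u hne => ?_
      have hα := eq_zero_of_coeffAt_ne_zero (hV _) hne
      refine ⟨hα, ?_⟩
      ext k
      have h1 := weight_of_lie (h0 ⟨0, by omega⟩ k) hne
      rw [hα] at h1
      rw [Finset.mem_singleton]
      by_cases hk : k ∈ u <;> by_cases hkl : k = l <;> simp_all
    exact ⟨fun l => (this l).choose, fun l => (this l).choose_spec⟩

/-- Commuting with the D_i and the torus leaves only ∑ b_k ξ_k D_k; the fields ξ_k D_l make all b_k
equal, and ξ_k ξ_l D_i gives 2 b_k = 0. -/
theorem eq_zero_of_centralizes (hm : 3 ≤ m) (hn : 3 ≤ n) (h2 : (2 : F) ≠ 0)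
    {E : Module.End F (Alg F p n t)} (hE : E ∈ evenFields F p n t)
    (hD : ∀ i, ⁅partialD F p n t (Sum.inl i), E⁆ = 0)
    (hh : ∀ i (k : Fin n), ⁅hField F p t i k, E⁆ = 0)
    (hv : ∀ k l, k ≠ l → ⁅E, mulD F p n t (Sum.inr l) (ξ k)⁆ = 0)
    (hp : ∀ k l, k ≠ l → ∀ i, ⁅E, mulD F p n t (Sum.inl i) (ξ k ⋆ ξ l)⁆ = 0) : E = 0 := by
  obtain ⟨h0, b, hb⟩ := gen_of_lie_hField_eq_zero hm ((lie_partial_eq_zero_iff hE).1 hD) hh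
  have h0 := h0 (by omega)
  have hxi : ∀ k, gen F p n t (Sum.inr k) ≠ 0 := fun k hk => by
    have := partial_gen (F := F) (p := p) (t := t) (Sum.inr k) (Sum.inr k)
    rw [hk, map_zero, if_pos rfl] at this
    exact one_ne_zero' this.symm
  have h1 : ∀ k l, k ≠ l → b k = b l := by
    intro k l hkl
    have := congrArg (fun A => A (ξ l)) (hv k l hkl)
    simp only [lie_mulD_gen, if_true, hb, map_smul, LinearMap.zero_apply, partial_gen, mul_one',
      ← sub_smul] at this
    exact sub_eq_zero.1 ((smul_eq_zero.1 this).resolve_right (hxi k))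
  refine evenFields_ext hE (Submodule.zero_mem _) fun r => ?_
  rw [LinearMap.zero_apply]
  rcases r with j | k
  · exact h0 j
  · obtain ⟨l, hl, -⟩ := exists_ne_ne hn k k
    let i : Fin m := ⟨0, by omega⟩
    have := congrArg (fun A => A (gen F p n t (Sum.inl i))) (hp k l hl.symm i)
    simp only [lie_mulD_gen, if_true, LinearMap.zero_apply, h0, map_zero, sub_zero,
      evenField_mul hE, hb, ← h1 k l hl.symm, map_smul, LinearMap.smul_apply, ← add_smul] at this
    have h3 : gen F p n t (Sum.inr k) ⋆ ξ l ≠ 0 := fun h => by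
      have h4 := partial_inr_xi_mul (p := p) (t := t) k k (gen F p n t (Sum.inr l))
      rw [h, map_zero, if_pos rfl, partial_inr_xi_of_ne hl.symm, map_zero, sub_zero] at h4
      exact hxi l h4.symm
    have h4 := (smul_eq_zero.1 this).resolve_right h3
    rw [← two_mul] at h4
    rw [hb, (mul_eq_zero.1 h4).resolve_left h2, zero_smul]

end

/-! ### Derivations of `𝒮` with values in the even vector fields -/

section

variable [CharP F p] [Fact p.Prime] [Fact (∀ i, 1 ≤ t i)]

/-- The inner derivation `⁅A, ·⁆` of `End 𝔄`. -/
noncomputable def adEnd (A : Module.End F (Alg F p n t)) :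
    Module.End F (Alg F p n t) →ₗ[F] Module.End F (Alg F p n t) :=
  LinearMap.mulLeft F A - LinearMap.mulRight F A

theorem adEnd_apply (A B : Module.End F (Alg F p n t)) : adEnd A B = ⁅A, B⁆ := rfl

/-- A linear map whose restriction to `𝒮` is a derivation with values in the even vector fields. -/
structure IsSDer (φ : Module.End F (Alg F p n t) →ₗ[F] Module.End F (Alg F p n t)) : Prop where
  map_lie : ∀ s ∈ evenS F p n t, ∀ s' ∈ evenS F p n t, φ ⁅s, s'⁆ = ⁅φ s, s'⁆ + ⁅s, φ s'⁆
  map_mem : ∀ s ∈ evenS F p n t, φ s ∈ evenFields F p n t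

variable {φ : Module.End F (Alg F p n t) →ₗ[F] Module.End F (Alg F p n t)}

namespace IsSDer

theorem sub_adEnd (hφ : IsSDer φ) {A : Module.End F (Alg F p n t)}
    (hA : ∀ E ∈ evenFields F p n t, ⁅A, E⁆ ∈ evenFields F p n t) : IsSDer (φ - adEnd A) where
  map_lie s hs s' hs' := by
    rw [LinearMap.sub_apply, LinearMap.sub_apply, LinearMap.sub_apply, hφ.map_lie s hs s' hs',
      adEnd_apply, adEnd_apply, adEnd_apply, sub_lie, lie_sub, leibniz_lie]
    abel
  map_mem s hs := Submodule.sub_mem _ (hφ.map_mem s hs) (hA s (evenS_le_evenFields hs))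

theorem sub_adEnd_of_mem (hφ : IsSDer φ) {A : Module.End F (Alg F p n t)}
    (hA : A ∈ evenFields F p n t) : IsSDer (φ - adEnd A) :=
  hφ.sub_adEnd fun _ hE => lie_mem_evenFields hA hE

end IsSDer

/-! ### Iterated brackets with D_i and the normalization of φ on the D_i -/

theorem adEnd_pow_gen (i : Fin m) {A : Module.End F (Alg F p n t)} (hA : A ∈ evenFields F p n t)
    (N : ℕ) : (adEnd (partialD F p n t (Sum.inl i)) ^ N) A ∈ evenFields F p n t ∧
      ∀ r, (adEnd (partialD F p n t (Sum.inl i)) ^ N) A (gen F p n t r) =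
        (partialD F p n t (Sum.inl i) ^ N) (A (gen F p n t r)) := by
  induction N with
  | zero => exact ⟨hA, fun r => rfl⟩
  | succ N ih =>
    rw [pow_succ', Module.End.mul_apply, adEnd_apply]
    refine ⟨lie_mem_evenFields (partial_inl_mem_evenFields i) ih.1, fun r => ?_⟩
    rw [lie_partial_gen i ih.1, ih.2, pow_succ', Module.End.mul_apply]

/-- Since (ad D)^2 s = 0, the binomial expansion of (ad D)^(N + 1) [X, s] has only two terms. -/
theorem adEnd_pow_lie (D X s : Module.End F (Alg F p n t)) (hs : ⁅D, ⁅D, s⁆⁆ = 0) (N : ℕ) :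
    (adEnd D ^ N) ⁅X, ⁅D, s⁆⁆ = ⁅(adEnd D ^ N) X, ⁅D, s⁆⁆ ∧
      (adEnd D ^ (N + 1)) ⁅X, s⁆ =
        ⁅(adEnd D ^ (N + 1)) X, s⁆ + ((N + 1 : ℕ) : F) • ⁅(adEnd D ^ N) X, ⁅D, s⁆⁆ := by
  have key : ∀ Y : Module.End F (Alg F p n t), ⁅D, ⁅Y, ⁅D, s⁆⁆⁆ = ⁅⁅D, Y⁆, ⁅D, s⁆⁆ := fun Y => by
    rw [leibniz_lie, hs, lie_zero, add_zero]
  have h1 : ∀ N, (adEnd D ^ N) ⁅X, ⁅D, s⁆⁆ = ⁅(adEnd D ^ N) X, ⁅D, s⁆⁆ := by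
    intro N
    induction N with
    | zero => rfl
    | succ N ih =>
      rw [pow_succ', Module.End.mul_apply, Module.End.mul_apply, ih, adEnd_apply, adEnd_apply, key]
  refine ⟨h1 N, ?_⟩
  induction N with
  | zero =>
    rw [zero_add, pow_one, pow_zero, adEnd_apply, adEnd_apply, leibniz_lie, Nat.cast_one, one_smul]
    rfl
  | succ N ih =>
    have h12 : ∀ N (Y : Module.End F (Alg F p n t)),
        (adEnd D ^ (N + 1)) Y = ⁅D, (adEnd D ^ N) Y⁆ := fun N Y => by
      rw [pow_succ', Module.End.mul_apply, adEnd_apply]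
    rw [h12 (N + 1) ⁅X, s⁆, ih, lie_add, end_lie_smul, key, leibniz_lie, ← h12, ← h12,
      Nat.cast_succ (N + 1), add_smul, one_smul]
    abel

theorem lie_lie_partial_eq_zero (i : Fin m) {s : Module.End F (Alg F p n t)}
    (hs : s ∈ evenFields F p n t)
    (h : ∀ r, 𝔡 (Sum.inl i) (𝔡 (Sum.inl i) (s (gen F p n t r))) = 0) :
    ⁅partialD F p n t (Sum.inl i), ⁅partialD F p n t (Sum.inl i), s⁆⁆ = 0 := by
  have hD := partial_inl_mem_evenFields (F := F) (p := p) (n := n) (t := t) i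
  refine evenFields_ext (lie_mem_evenFields hD (lie_mem_evenFields hD hs)) (Submodule.zero_mem _)
    fun r => ?_
  rw [lie_partial_gen i (lie_mem_evenFields hD hs), lie_partial_gen i hs, h, LinearMap.zero_apply]

theorem vert_mem_evenS (h2 : (2 : F) ≠ 0) {f : Alg F p n t} (hf : f ∈ evenPoly F p n t)
    {k l : Fin n} (hkl : k ≠ l) : mulD F p n t (Sum.inr l) (f ⋆ ξ k) ∈ evenS F p n t := by
  refine mulD_inr_mem_evenS h2 (even_add_mul_mem (evenPoly_le_homog hf) (xi_mem_homog k)) ?_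
  rw [partial_inr_evenPoly_mul l hf, partial_inr_xi_of_ne hkl.symm, map_zero]

theorem xi_partial_mem_evenS (h2 : (2 : F) ≠ 0) {k l : Fin n} (hkl : k ≠ l) :
    mulD F p n t (Sum.inr l) (ξ k) ∈ evenS F p n t :=
  mulD_inr_mem_evenS h2 (xi_mem_homog k) (partial_inr_xi_of_ne hkl.symm)

theorem pair_mem_evenS (hn : 3 ≤ n) (a b : Fin n) (i : Fin m) :
    mulD F p n t (Sum.inl i) (ξ a ⋆ ξ b) ∈ evenS F p n t := by
  obtain ⟨k, hka, hkb⟩ := exists_ne_ne hn a b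
  have h1 := cField_mem_evenS (f := gen F p n t (Sum.inr a) ⋆ ξ b)
    (odd_mul_odd_mem (xi_mem_homog a) (xi_mem_homog b)) (k := k)
    (by rw [partial_inr_xi_mul, if_neg hka, partial_inr_xi_of_ne hkb, map_zero, sub_zero]) i
  rwa [cField, mem_oddPoly.1 (mul_mem_oddPoly (xi_mem_oddPoly a) (xi_mem_oddPoly b)), map_zero,
    LinearMap.zero_apply, map_zero, add_zero] at h1

/-- Apply (ad D)^(q - 1), with q = p^t_i, to [φ(D), s] = φ([D, s]) - [D, φ(s)]. The last term dies
because D^q = 0, and [D, φ([D, s])] = -[φ(D), [D, s]]. Together with the two-term binomial formula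
this leaves -q [(ad D)^(q - 2) φ(D), [D, s]], which vanishes since q = 0 in F. -/
theorem IsSDer.adEnd_pow_lie_eq_zero (hφ : IsSDer φ) (i : Fin m) {s : Module.End F (Alg F p n t)}
    (h1 : partialD F p n t (Sum.inl i) ∈ evenS F p n t) (hs : s ∈ evenS F p n t)
    (h : ∀ r, 𝔡 (Sum.inl i) (𝔡 (Sum.inl i) (s (gen F p n t r))) = 0) :
    ⁅(adEnd (partialD F p n t (Sum.inl i)) ^ (p ^ t i - 1)) (φ (partialD F p n t (Sum.inl i))),
      s⁆ = 0 := by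
  set D := partialD F p n t (Sum.inl i) with hD
  have hDW := partial_inl_mem_evenFields (F := F) (p := p) (n := n) (t := t) i
  have hz := lie_lie_partial_eq_zero i (evenS_le_evenFields hs) h
  have hDs : ⁅D, s⁆ ∈ evenS F p n t := by
    obtain ⟨h3, h4⟩ := mem_evenSbar.1 (evenS_le_evenSbar h1)
    exact lie_mem_evenS (c := 0) h3 (by rw [h4, zero_smul]) hs
  obtain ⟨M, hM⟩ : ∃ M, p ^ t i = M + 2 :=
    ⟨p ^ t i - 2, by have := one_lt_pow (p := p) (t := t) i; omega⟩
  have h3 := hφ.map_lie D h1 s hs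
  have h4 := hφ.map_lie D h1 _ hDs
  rw [hz, map_zero] at h4
  obtain ⟨h5, h6⟩ := adEnd_pow_lie D (φ D) s hz M
  have h7 : (adEnd D ^ (M + 2)) (φ s) = 0 := by
    rw [← hM]
    refine (pow_commutator D (φ s) (t i)).symm.trans ?_
    rw [hD, partial_pow_eq_zero, zero_mul, mul_zero, sub_zero]
  have h8 : ⁅φ D, s⁆ = φ ⁅D, s⁆ - adEnd D (φ s) := by rw [h3, adEnd_apply]; abel
  have h9 : adEnd D (φ ⁅D, s⁆) = -⁅φ D, ⁅D, s⁆⁆ := by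
    rw [adEnd_apply]; exact (neg_eq_of_add_eq_zero_right h4.symm).symm
  have h11 : (adEnd D ^ (M + 1)) (adEnd D (φ s)) = 0 := by
    rw [← Module.End.mul_apply, ← pow_succ, h7]
  rw [h8, map_sub, h11, sub_zero, pow_succ,
    Module.End.mul_apply, h9, map_neg, h5] at h6
  rw [show p ^ t i - 1 = M + 1 by omega]
  have h10 : ⁅(adEnd D ^ (M + 1)) (φ D), s⁆ = -(((M + 2 : ℕ) : F) • ⁅(adEnd D ^ M) (φ D), ⁅D, s⁆⁆) := by
    rw [Nat.cast_succ, add_smul, one_smul, neg_add, h6]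
    abel
  have ht0 : t i ≠ 0 := Nat.one_le_iff_ne_zero.1 (Fact.out (p := ∀ i, 1 ≤ t i) i)
  rw [h10, ← hM, Nat.cast_pow, CharP.cast_eq_zero, zero_pow ht0, zero_smul, neg_zero]

theorem hField_gen (i : Fin m) (k : Fin n) (r : Var m n) : hField F p t i k (gen F p n t r) =
    (((if Sum.inl i = r then 1 else 0) + if Sum.inr k = r then 1 else 0 : F)) • gen F p n t r := by
  rw [hField, LinearMap.add_apply, mulD_gen, mulD_gen, add_smul]
  congr 1 <;> split_ifs with h <;> simp [h]

theorem hField_mem_evenFields (i : Fin m) (k : Fin n) : hField F p t i k ∈ evenFields F p n t :=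
  evenS_le_evenFields (hField_mem_evenS i k)

theorem mulD_inl_gen_mem_oddPoly {r : Var m n} {g : Alg F p n t} (hg : g ∈ oddPoly F p n t)
    (s : Var m n) : mulD F p n t r g (gen F p n t s) ∈ oddPoly F p n t := by
  rw [mulD_gen]
  split_ifs
  · exact hg
  · exact Submodule.zero_mem _

/-- A derivation agrees on the `D_i` with an inner one. -/
theorem IsSDer.exists_lie_partial_eq (hφ : IsSDer φ) (hm : 3 ≤ m) (hn : 3 ≤ n)
    (h2 : (2 : F) ≠ 0) : ∃ E ∈ evenFields F p n t, ∀ i,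
      φ (partialD F p n t (Sum.inl i)) = ⁅E, partialD F p n t (Sum.inl i)⁆ := by
  have hDS : ∀ i, partialD F p n t (Sum.inl i) ∈ evenS F p n t :=
    partial_inl_mem_evenS ⟨0, by omega⟩
  have hX := fun i => hφ.map_mem _ (hDS i)
  have hcl : ∀ i j r, 𝔡 (Sum.inl i) (φ (partialD F p n t (Sum.inl j)) (gen F p n t r)) =
      𝔡 (Sum.inl j) (φ (partialD F p n t (Sum.inl i)) (gen F p n t r)) := by
    intro i j r
    have h1 := hφ.map_lie _ (hDS i) _ (hDS j)
    have h3 : ⁅partialD F p n t (Sum.inl i), partialD F p n t (Sum.inl j)⁆ = 0 :=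
      (Commute.lie_eq (partial_commute i (Sum.inl j)))
    rw [h3, map_zero, ← lie_skew, eq_comm, neg_add_eq_zero] at h1
    have h4 := congrArg (fun A => A (gen F p n t r)) h1
    simp only [lie_partial_gen _ (hX _)] at h4
    exact h4.symm
  have htop : ∀ i r, (partialD F p n t (Sum.inl i) ^ (p ^ t i - 1))
      (φ (partialD F p n t (Sum.inl i)) (gen F p n t r)) = 0 := by
    intro i r
    -- The obstruction (ad D_i)^(p^t_i - 1) φ(D_i) is shown to centralize the torus and the D_j, ξ_k
    -- D_l and ξ_k ξ_l D_j, each of which has vanishing second bracket with D_i.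
    obtain ⟨hC, hC'⟩ := adEnd_pow_gen i (hX i) (p ^ t i - 1)
    rw [← hC', eq_zero_of_centralizes hm hn h2 hC, LinearMap.zero_apply]
    · rw [lie_partial_eq_zero_iff hC]
      intro s
      rw [hC', mem_oddPoly]
      intro j
      have h1 := congrArg (fun A => A (φ (partialD F p n t (Sum.inl i)) (gen F p n t s)))
        ((partial_commute (F := F) (p := p) (n := n) (t := t) i (Sum.inl j)).pow_left
          (p ^ t i - 1)).eq
      simp only [Module.End.mul_apply] at h1
      -- Closedness turns D_j φ(D_i) into D_i φ(D_j), and then D_i occurs p^t_i times.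
      rw [← h1, hcl j i, ← Module.End.mul_apply, ← pow_succ,
        Nat.sub_add_cancel (one_lt_pow (p := p) (t := t) i).le, partial_pow_eq_zero,
        LinearMap.zero_apply]
    · intro j k
      rw [← lie_skew, hφ.adEnd_pow_lie_eq_zero i (hDS i) (hField_mem_evenS j k), neg_zero]
      intro r
      rw [hField_gen, map_smul, map_smul, partial_gen, apply_ite (partialD F p n t (Sum.inl i)),
        partial_inl_one, map_zero, ite_self, smul_zero]
    · intro k l hkl
      refine hφ.adEnd_pow_lie_eq_zero i (hDS i) (xi_partial_mem_evenS h2 hkl) fun r => ?_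
      rw [mem_oddPoly.1 (mulD_inl_gen_mem_oddPoly (xi_mem_oddPoly k) r), map_zero]
    · intro k l _ j
      refine hφ.adEnd_pow_lie_eq_zero i (hDS i) (pair_mem_evenS hn k l j) fun r => ?_
      rw [mem_oddPoly.1 (mulD_inl_gen_mem_oddPoly
        (mul_mem_oddPoly (xi_mem_oddPoly k) (xi_mem_oddPoly l)) r), map_zero]
  have hex := fun r => exists_partial_eq
    (fun i => φ (partialD F p n t (Sum.inl i)) (gen F p n t r))
    (fun i => (mem_evenFields_iff.1 (hX i)).1 r) (fun i j => hcl i j r) (fun i => htop i r)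
  choose g hg hg' using hex
  have hE : vectorField F p n t g ∈ evenFields F p n t := mem_evenFields_iff_exists.2 ⟨g, hg, rfl⟩
  refine ⟨-vectorField F p n t g, Submodule.neg_mem _ hE, fun i => ?_⟩
  rw [neg_lie, lie_skew]
  refine evenFields_ext (hX i) (lie_mem_evenFields (partial_inl_mem_evenFields i) hE) fun r => ?_
  rw [lie_partial_gen i hE, vectorField_gen, hg']

end

/-! ### Normalisation on the torus -/

section

variable [CharP F p] [Fact p.Prime] [Fact (∀ i, 1 ≤ t i)]

theorem lie_diag_mulD {E : Module.End F (Alg F p n t)} {e : Var m n → F}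
    (hE : E ∈ evenFields F p n t) (he : ∀ r, E (gen F p n t r) = e r • gen F p n t r)
    {s : Var m n} {g : Alg F p n t} {w : F} (hg : E g = w • g)
    (hgs : g ∈ homog F p n t (tau s)) : ⁅E, mulD F p n t s g⁆ = (w - e s) • mulD F p n t s g := by
  refine evenFields_ext (lie_mem_evenFields hE (mulD_mem_evenFields hgs))
    (Submodule.smul_mem _ _ (mulD_mem_evenFields hgs)) fun r => ?_
  rw [lie_mulD_gen, he, map_smul, partial_gen, LinearMap.smul_apply, mulD_gen, hg]
  split_ifs with h
  · rw [map_smul, mul_one', h, sub_smul]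
  · simp

theorem lie_diag_partial {E : Module.End F (Alg F p n t)} {e : Var m n → F}
    (hE : E ∈ evenFields F p n t) (he : ∀ r, E (gen F p n t r) = e r • gen F p n t r) (i : Fin m) :
    ⁅E, partialD F p n t (Sum.inl i)⁆ = (-e (Sum.inl i)) • partialD F p n t (Sum.inl i) := by
  rw [partialD_eq_mulD, lie_diag_mulD hE he (w := 0), zero_sub]
  · rw [evenField_map_one hE, zero_smul]
  · exact one_mem_homog

theorem diag_gen_mul_gen {E : Module.End F (Alg F p n t)} {e : Var m n → F}
    (hE : E ∈ evenFields F p n t) (he : ∀ r, E (gen F p n t r) = e r • gen F p n t r)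
    (r s : Var m n) :
    E (gen F p n t r ⋆ gen F p n t s) = (e r + e s) • (gen F p n t r ⋆ gen F p n t s) := by
  rw [evenField_mul hE, he, he, map_smul, map_smul, LinearMap.smul_apply, add_smul]

theorem lie_diag_diag {E E' : Module.End F (Alg F p n t)} {e e' : Var m n → F}
    (hE : E ∈ evenFields F p n t) (he : ∀ r, E (gen F p n t r) = e r • gen F p n t r)
    (hE' : E' ∈ evenFields F p n t) (he' : ∀ r, E' (gen F p n t r) = e' r • gen F p n t r) :
    ⁅E, E'⁆ = 0 := by
  refine evenFields_ext (lie_mem_evenFields hE hE') (Submodule.zero_mem _) fun r => ?_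
  rw [end_lie_apply, he, he', map_smul, map_smul, he, he', smul_comm, sub_self,
    LinearMap.zero_apply]

theorem mulD_ne_zero {r : Var m n} {f : Alg F p n t} (hf : f ≠ 0) : mulD F p n t r f ≠ 0 := by
  intro h
  have := mulD_gen r r f
  rw [h, if_pos rfl] at this
  exact hf this.symm

theorem xi_ne_zero (k : Fin n) : gen F p n t (Sum.inr k) ≠ 0 := fun hk => by
  have := partial_gen (F := F) (p := p) (t := t) (Sum.inr k) (Sum.inr k)
  rw [hk, map_zero, if_pos rfl] at this
  exact one_ne_zero' this.symm

theorem xi_mul_xi_ne_zero {k l : Fin n} (hkl : k ≠ l) : gen F p n t (Sum.inr k) ⋆ ξ l ≠ 0 :=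
  fun h => by
    have h4 := partial_inr_xi_mul (p := p) (t := t) k k (gen F p n t (Sum.inr l))
    rw [h, map_zero, if_pos rfl, partial_inr_xi_of_ne hkl, map_zero, sub_zero] at h4
    exact xi_ne_zero l h4.symm

theorem exists_coeffAt_ne_zero {E : Module.End F (Alg F p n t)} (hE : E ∈ evenFields F p n t)
    (h : E ≠ 0) : ∃ s α u, coeffAt α u (E (gen F p n t s)) ≠ 0 := by
  by_contra hc
  push Not at hc
  refine h (evenFields_ext hE (Submodule.zero_mem _) fun r => alg_ext fun α u _ => ?_)
  rw [hc, LinearMap.zero_apply, map_zero]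

variable {φ : Module.End F (Alg F p n t) →ₗ[F] Module.End F (Alg F p n t)}

/-- As φ(D_i) = 0, the bracket [D_i, φ(s)] equals φ([D_i, s]); once this is zero, the coefficients
of φ(s) are constant in the x_i. -/
theorem IsSDer.map_gen_mem_oddPoly (hφ : IsSDer φ) (hn : 3 ≤ n)
    (hD : ∀ i, φ (partialD F p n t (Sum.inl i)) = 0) {s : Module.End F (Alg F p n t)}
    (hs : s ∈ evenS F p n t) (h : ∀ i, φ ⁅partialD F p n t (Sum.inl i), s⁆ = 0) (r : Var m n) :
    φ s (gen F p n t r) ∈ oddPoly F p n t := by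
  refine (lie_partial_eq_zero_iff (hφ.map_mem s hs)).1 (fun i => ?_) r
  have h1 := hφ.map_lie _ (partial_inl_mem_evenS ⟨0, by omega⟩ i) s hs
  rwa [h, hD, zero_lie, zero_add, eq_comm] at h1

theorem map_lie_partial_hField (hD : ∀ i, φ (partialD F p n t (Sum.inl i)) = 0) (i j : Fin m)
    (k : Fin n) : φ ⁅partialD F p n t (Sum.inl j), hField F p t i k⁆ = 0 := by
  rw [← lie_skew, lie_diag_partial (hField_mem_evenFields i k) (hField_gen i k), map_neg, map_smul,
    hD, smul_zero, neg_zero]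

/-- The first cohomology of a torus is concentrated in weight zero: in each nonzero weight the
cocycle h ↦ φ(h) is a coboundary. The primitive keeps coefficients constant in the x_i, so the
normalization on the D_i survives. -/
theorem IsSDer.exists_lie_hField_eq (hφ : IsSDer φ) (hn : 3 ≤ n)
    (hD : ∀ i, φ (partialD F p n t (Sum.inl i)) = 0) :
    ∃ E ∈ evenFields F p n t, (∀ i, ⁅E, partialD F p n t (Sum.inl i)⁆ = 0) ∧
      ∀ i j (k l : Fin n), ⁅hField F p t j l, φ (hField F p t i k) - ⁅E, hField F p t i k⁆⁆ = 0 := by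
  classical
  have hhS := fun i k => hField_mem_evenS (F := F) (p := p) (n := n) (t := t) i k
  have hhW := fun i k => hField_mem_evenFields (F := F) (p := p) (n := n) (t := t) i k
  have hY := fun i k => hφ.map_mem _ (hhS i k)
  have hYV : ∀ i k s, φ (hField F p t i k) (gen F p n t s) ∈ oddPoly F p n t := fun i k =>
    hφ.map_gen_mem_oddPoly hn hD (hhS i k) fun j => map_lie_partial_hField hD i j k
  have hcomm : ∀ i j (k l : Fin n), ⁅hField F p t i k, φ (hField F p t j l)⁆ =
      ⁅hField F p t j l, φ (hField F p t i k)⁆ := by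
    intro i j k l
    have h1 := hφ.map_lie _ (hhS i k) _ (hhS j l)
    rwa [lie_diag_diag (hhW i k) (hField_gen i k) (hhW j l) (hField_gen j l), map_zero, ← lie_skew,
      eq_comm, neg_add_eq_zero, eq_comm] at h1
  let lam : Fin m × Fin n → Var m n → (Fin m → ℕ) → Finset (Fin n) → F := fun q s α u =>
    wt F (Sum.inl q.1) α u + wt F (Sum.inr q.2) α u -
        ((if Sum.inl q.1 = s then 1 else 0) + if Sum.inr q.2 = s then 1 else 0)
  have hlam : ∀ q q' s α u, lam q s α u * coeffAt α u (φ (hField F p t q'.1 q'.2) (gen F p n t s)) =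
      lam q' s α u * coeffAt α u (φ (hField F p t q.1 q.2) (gen F p n t s)) := by
    intro q q' s α u
    have h1 := congrArg (fun A => coeffAt α u (A (gen F p n t s))) (hcomm q.1 q'.1 q.2 q'.2)
    simpa only [coeffAt_lie_hField] using h1
  -- On a weight component pick one h with nonzero eigenvalue and divide by it; the cocycle identity
  -- makes the quotient the same for every such h.
  have hg := fun s => exists_coeffAt (F := F) (p := p) (n := n) (t := t) fun α u =>
    if h : ∃ q, lam q s α u ≠ 0 then
      -(coeffAt α u (φ (hField F p t h.choose.1 h.choose.2) (gen F p n t s)) /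
        lam h.choose s α u) else 0
  choose g hg using hg
  have hgY : ∀ s α u, coeffAt α u (g s) ≠ 0 →
      ∃ i k, coeffAt α u (φ (hField F p t i k) (gen F p n t s)) ≠ 0 := by
    intro s α u h
    rw [hg s α u (range_of_coeffAt_ne_zero h)] at h
    split_ifs at h with h'
    · exact ⟨_, _, fun h0 => h (by rw [h0, zero_div, neg_zero])⟩
    · exact absurd rfl h
  have hghom : ∀ s, g s ∈ homog F p n t (tau s) := fun s => by
    refine mem_homog_iff_coeffAt.2 fun α u h => ?_
    obtain ⟨i, k, h1⟩ := hgY s α u h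
    exact mem_homog_iff_coeffAt.1 ((mem_evenFields_iff.1 (hY i k)).1 s) α u h1
  have hgodd : ∀ s, g s ∈ oddPoly F p n t := fun s => by
    refine mem_oddPoly_of_coeffAt fun α u h => ?_
    obtain ⟨i, k, h1⟩ := hgY s α u h
    exact eq_zero_of_coeffAt_ne_zero (hYV i k s) h1
  have hE : vectorField F p n t g ∈ evenFields F p n t :=
    mem_evenFields_iff_exists.2 ⟨g, hghom, rfl⟩
  refine ⟨vectorField F p n t g, hE, fun i => ?_, fun i j k l => ?_⟩
  · rw [← lie_skew, (lie_partial_eq_zero_iff hE).2, neg_zero]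
    intro s
    rw [vectorField_gen]
    exact hgodd s
  · refine evenFields_ext (lie_mem_evenFields (hhW j l) (Submodule.sub_mem _ (hY i k)
      (lie_mem_evenFields hE (hhW i k)))) (Submodule.zero_mem _) fun s => alg_ext fun α u hα => ?_
    rw [coeffAt_lie_hField, ← lie_skew, sub_neg_eq_add, LinearMap.add_apply, map_add,
      coeffAt_lie_hField, vectorField_gen, hg s α u hα, LinearMap.zero_apply, map_zero]
    change lam (j, l) s α u * (_ + lam (i, k) s α u * _) = 0
    split_ifs with h
    · have h1 := hlam h.choose (i, k) s α u
      have h2 := h.choose_spec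
      rw [mul_neg, mul_div_assoc', ← h1, mul_div_cancel_left₀ _ h2, add_neg_cancel, mul_zero]
    · push Not at h
      rw [h, zero_mul]

/-- In c φ(s) = d s + [h, φ(s)], compare coefficients at a monomial of s. There h acts on φ(s) by
the same eigenvalue c, so the term d s must vanish. -/
theorem IsSDer.eigenvalue_eq_zero (hφ : IsSDer φ) {i : Fin m} {k : Fin n}
    {s : Module.End F (Alg F p n t)} (hs : s ∈ evenS F p n t) (hs0 : s ≠ 0) {c d : F}
    (h1 : ⁅hField F p t i k, s⁆ = c • s) (h2 : ⁅φ (hField F p t i k), s⁆ = d • s) : d = 0 := by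
  obtain ⟨r, α, u, hne⟩ := exists_coeffAt_ne_zero (evenS_le_evenFields hs) hs0
  have h3 := congrArg (fun A => coeffAt α u (A (gen F p n t r)))
    (hφ.map_lie _ (hField_mem_evenS i k) s hs)
  have h4 := congrArg (fun A => coeffAt α u (A (gen F p n t r))) h1
  simp only [coeffAt_lie_hField, LinearMap.smul_apply, map_smul, smul_eq_mul] at h4
  simp only [h1, h2, map_smul, LinearMap.add_apply, LinearMap.smul_apply, map_add,
    coeffAt_lie_hField, smul_eq_mul, mul_right_cancel₀ hne h4] at h3
  exact (mul_eq_zero.1 (right_eq_add.1 h3)).resolve_right hne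

/-- A derivation that kills the `D_i` and maps the torus into its own centralizer kills the
torus. -/
theorem IsSDer.map_hField_eq_zero (hφ : IsSDer φ) (hm : 3 ≤ m) (hn : 3 ≤ n) (h2 : (2 : F) ≠ 0)
    (hD : ∀ i, φ (partialD F p n t (Sum.inl i)) = 0)
    (hh : ∀ i j (k l : Fin n), ⁅hField F p t j l, φ (hField F p t i k)⁆ = 0) (i : Fin m)
    (k : Fin n) : φ (hField F p t i k) = 0 := by
  have hY := hφ.map_mem _ (hField_mem_evenS i k)
  obtain ⟨h0, b, hb⟩ := gen_of_lie_hField_eq_zero hm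
    (hφ.map_gen_mem_oddPoly hn hD (hField_mem_evenS i k) fun j => map_lie_partial_hField hD i j k)
    (fun j l => hh i j k l)
  have h0 := h0 (by omega)
  have he : ∀ r, φ (hField F p t i k) (gen F p n t r) =
      (Sum.elim 0 b r : F) • gen F p n t r := by
    rintro (j | l)
    · rw [h0]; simp
    · exact hb l
  have hhW := hField_mem_evenFields (F := F) (p := p) (t := t) i k
  have h1 : ∀ a c, a ≠ c → b a = b c := by
    intro a c hac
    have := hφ.eigenvalue_eq_zero (xi_partial_mem_evenS h2 hac) (mulD_ne_zero (xi_ne_zero a))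
      (lie_diag_mulD hhW (hField_gen i k) (hField_gen i k _) (xi_mem_homog a))
      (lie_diag_mulD hY he (he _) (xi_mem_homog a))
    exact sub_eq_zero.1 this
  refine evenFields_ext hY (Submodule.zero_mem _) fun r => ?_
  rw [LinearMap.zero_apply]
  rcases r with j | a
  · exact h0 j
  · obtain ⟨c, hc, -⟩ := exists_ne_ne hn a a
    have h3 := odd_mul_odd_mem (xi_mem_homog (F := F) (p := p) (t := t) a) (xi_mem_homog c)
    have := hφ.eigenvalue_eq_zero (pair_mem_evenS hn a c i)
      (mulD_ne_zero (xi_mul_xi_ne_zero hc.symm))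
      (lie_diag_mulD hhW (hField_gen i k) (diag_gen_mul_gen hhW (hField_gen i k) _ _) h3)
      (lie_diag_mulD hY he (diag_gen_mul_gen hY he _ _) h3)
    simp only [Sum.elim_inr, Sum.elim_inl, Pi.zero_apply, sub_zero, ← h1 a c hc.symm,
      ← two_mul] at this
    rw [hb, (mul_eq_zero.1 this).resolve_left h2, zero_smul]

/-! ### Weights of the values of a derivation -/

theorem IsSDer.lie_hField_map (hφ : IsSDer φ) (hh : ∀ i (k : Fin n), φ (hField F p t i k) = 0)
    {s : Module.End F (Alg F p n t)} (hs : s ∈ evenS F p n t) {i : Fin m} {k : Fin n} {c : F}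
    (h : ⁅hField F p t i k, s⁆ = c • s) : ⁅hField F p t i k, φ s⁆ = c • φ s := by
  have h1 := hφ.map_lie _ (hField_mem_evenS i k) s hs
  rwa [h, hh, zero_lie, zero_add, map_smul, eq_comm] at h1

theorem weight_inl {i : Fin m} {k : Fin n} {E : Module.End F (Alg F p n t)} {c : F}
    (h : ⁅hField F p t i k, E⁆ = c • E) {j : Fin m} {α : Fin m → ℕ} {u : Finset (Fin n)}
    (hne : coeffAt α u (E (gen F p n t (Sum.inl j))) ≠ 0) :
    (α i : F) + (if k ∈ u then 1 else 0) - (if i = j then 1 else 0) = c := by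
  have := weight_of_lie h hne
  simpa using this

theorem weight_inr {i : Fin m} {k : Fin n} {E : Module.End F (Alg F p n t)} {c : F}
    (h : ⁅hField F p t i k, E⁆ = c • E) {l : Fin n} {α : Fin m → ℕ} {u : Finset (Fin n)}
    (hne : coeffAt α u (E (ξ l)) ≠ 0) :
    (α i : F) + (if k ∈ u then 1 else 0) - (if k = l then 1 else 0) = c := by
  have := weight_of_lie h hne
  simpa using this

theorem lie_hField_mulD {i : Fin m} {k : Fin n} {s : Var m n} {g : Alg F p n t} {w : F}
    (hg : hField F p t i k g = w • g) (hgs : g ∈ homog F p n t (tau s)) :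
    ⁅hField F p t i k, mulD F p n t s g⁆ =
      (w - ((if Sum.inl i = s then 1 else 0) + if Sum.inr k = s then 1 else 0)) •
        mulD F p n t s g :=
  lie_diag_mulD (hField_mem_evenFields i k) (hField_gen i k) hg hgs

end

/-! ### Values on linear fields -/

section

variable [CharP F p] [Fact p.Prime] [Fact (∀ i, 1 ≤ t i)]

theorem lie_partial_mulD (i : Fin m) (s : Var m n) (g : Alg F p n t) :
    ⁅partialD F p n t (Sum.inl i), mulD F p n t s g⁆ = mulD F p n t s (𝔡 (Sum.inl i) g) := by
  refine LinearMap.ext fun f => ?_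
  have h := congrArg (fun A => A f) (partial_commute (F := F) (p := p) (n := n) (t := t) i s).eq
  simp only [Module.End.mul_apply] at h
  rw [end_lie_apply, mulD_apply, mulD_apply, mulD_apply, partial_inl_mul, h, add_sub_cancel_right]

theorem x_partial_mem_evenS (k : Fin n) {i j : Fin m} (hij : i ≠ j) :
    mulD F p n t (Sum.inl j) (gen F p n t (Sum.inl i)) ∈ evenS F p n t := by
  have := cField_mem_evenS (F := F) (p := p) (t := t) (evenPoly_le_homog (gen_mem_evenPoly i))
    (mem_evenPoly.1 (gen_mem_evenPoly i) k) j
  rwa [cField, partial_gen, if_neg (by simpa using hij.symm), map_zero, LinearMap.zero_apply,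
    map_zero, add_zero] at this

theorem eq_smul_mulD {E : Module.End F (Alg F p n t)} (hE : E ∈ evenFields F p n t)
    {r : Var m n} {v : Finset (Fin n)} (hv : (v.card : ZMod 2) = tau r)
    (h : ∀ s α u, coeffAt α u (E (gen F p n t s)) ≠ 0 → s = r ∧ α = 0 ∧ u = v) :
    ∃ c : F, E = c • mulD F p n t r (mon F p n t 0 v) := by
  obtain ⟨c, hc⟩ := exists_smul_mon fun α u hne => (h r α u hne).2
  refine ⟨c, evenFields_ext hE (Submodule.smul_mem _ _ (mulD_mem_evenFields ?_)) fun s => ?_⟩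
  · rw [← hv]
    exact mon_mem_homog 0 v
  · rw [LinearMap.smul_apply, mulD_gen]
    split_ifs with hs
    · rw [← hs, hc]
    · rw [smul_zero]
      refine alg_ext fun α u _ => ?_
      rw [map_zero]
      by_contra hne
      exact hs (h s α u hne).1.symm

variable {φ : Module.End F (Alg F p n t) →ₗ[F] Module.End F (Alg F p n t)}

theorem IsSDer.exists_map_xi_partial (hφ : IsSDer φ) (hm : 3 ≤ m) (hn : 3 ≤ n)
    (h2 : (2 : F) ≠ 0) (hD : ∀ i, φ (partialD F p n t (Sum.inl i)) = 0)
    (hh : ∀ i (k : Fin n), φ (hField F p t i k) = 0) {k l : Fin n} (hkl : k ≠ l) :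
    ∃ c : F, φ (mulD F p n t (Sum.inr l) (ξ k)) = c • mulD F p n t (Sum.inr l) (ξ k) := by
  have hs := xi_partial_mem_evenS (F := F) (p := p) (t := t) h2 hkl
  have hV := hφ.map_gen_mem_oddPoly hn hD hs fun i => by
    rw [lie_partial_mulD, mem_oddPoly.1 (xi_mem_oddPoly k), map_zero, map_zero]
  have hw := fun i c => hφ.lie_hField_map hh hs
    (lie_hField_mulD (hField_gen i c (Sum.inr k)) (s := Sum.inr l) (xi_mem_homog k))
  refine eq_smul_mulD (hφ.map_mem _ hs) (by simp [tau]) fun s α u hne => ?_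
  have hα := eq_zero_of_coeffAt_ne_zero (hV s) hne
  subst hα
  rcases s with j | r
  · exfalso
    obtain ⟨i, hij, -⟩ := exists_ne_ne hm j j
    have h1 := weight_inl (hw i k) hne
    have h3 := weight_inl (hw j k) hne
    simp [hij, hkl] at h1 h3
    simp [h1] at h3
  · have h1 := fun c => weight_inr (hw ⟨0, by omega⟩ c) hne
    -- Under h_il the field ξ_k D_l has weight -1; for r ≠ l the weight would be 0 or 1, and 2 ≠ 0
    -- in F.
    have hrl : r = l := by
      by_contra hrl
      have h3 := h1 l
      simp [Ne.symm hrl, hkl.symm] at h3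
      grind
    subst hrl
    refine ⟨rfl, rfl, ?_⟩
    ext c
    have h3 := h1 c
    clear h1 hw hV hne hs
    by_cases hc : c ∈ u <;> by_cases hck : c = k <;> simp_all

/-- The weights of x_i D_j under h_ik and h_jk are 1 and -1. For a field constant in the x's they
differ by 0 or ±1, while 2 is none of these in characteristic different from 2 and 3. -/
theorem IsSDer.map_x_partial (hφ : IsSDer φ) (hn : 3 ≤ n)
    (h2 : (2 : F) ≠ 0) (h3 : (3 : F) ≠ 0) (hD : ∀ i, φ (partialD F p n t (Sum.inl i)) = 0)
    (hh : ∀ i (k : Fin n), φ (hField F p t i k) = 0) {i j : Fin m} (hij : i ≠ j) :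
    φ (mulD F p n t (Sum.inl j) (gen F p n t (Sum.inl i))) = 0 := by
  let k : Fin n := ⟨0, by omega⟩
  have hs := x_partial_mem_evenS (F := F) (p := p) (t := t) k hij
  have hV := hφ.map_gen_mem_oddPoly hn hD hs fun a => by
    rw [lie_partial_mulD, partial_gen]
    split_ifs
    · rw [← partialD_eq_mulD, hD]
    · rw [map_zero, map_zero]
  have hw := fun a c => hφ.lie_hField_map hh hs
    (lie_hField_mulD (hField_gen a c (Sum.inl i)) (s := Sum.inl j) (mon_empty_mem_homog _))
  refine evenFields_ext (hφ.map_mem _ hs) (Submodule.zero_mem _) fun s => alg_ext fun α u _ => ?_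
  rw [LinearMap.zero_apply, map_zero]
  by_contra hne
  have hα := eq_zero_of_coeffAt_ne_zero (hV s) hne
  subst hα
  rcases s with l | r
  · have h4 := weight_inl (hw i k) hne
    have h5 := weight_inl (hw j k) hne
    have h6 := hij.symm
    simp [hij, h6] at h4 h5
    grind
  · have h4 := weight_inr (hw i k) hne
    have h5 := weight_inr (hw j k) hne
    have h6 := hij.symm
    simp [hij, h6] at h4 h5
    grind

theorem IsSDer.exists_map_pair (hφ : IsSDer φ) (hm : 3 ≤ m) (hn : 3 ≤ n)
    (hD : ∀ i, φ (partialD F p n t (Sum.inl i)) = 0)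
    (hh : ∀ i (k : Fin n), φ (hField F p t i k) = 0) {a b : Fin n} (hab : a ≠ b) (i : Fin m) :
    ∃ c : F, φ (mulD F p n t (Sum.inl i) (ξ a ⋆ ξ b)) =
      c • mulD F p n t (Sum.inl i) (ξ a ⋆ ξ b) := by
  have hs := pair_mem_evenS (F := F) (p := p) (t := t) hn a b i
  have h0 := odd_mul_odd_mem (xi_mem_homog (F := F) (p := p) (t := t) a) (xi_mem_homog b)
  have hV := hφ.map_gen_mem_oddPoly hn hD hs fun j => by
    rw [lie_partial_mulD, mem_oddPoly.1 (mul_mem_oddPoly (xi_mem_oddPoly a) (xi_mem_oddPoly b)),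
      map_zero, map_zero]
  have hw := fun j c => hφ.lie_hField_map hh hs
    (lie_hField_mulD (diag_gen_mul_gen (hField_mem_evenFields j c) (hField_gen j c) (Sum.inr a)
      (Sum.inr b)) (s := Sum.inl i) h0)
  obtain ⟨c, hc⟩ : ∃ c : F, φ (mulD F p n t (Sum.inl i) (ξ a ⋆ ξ b)) =
      c • mulD F p n t (Sum.inl i) (mon F p n t 0 {a, b}) := by
    refine eq_smul_mulD (hφ.map_mem _ hs)
      (by rw [Finset.card_pair hab, tau, Sum.elim_inl]; rfl) fun s α u hne => ?_
    have hα := eq_zero_of_coeffAt_ne_zero (hV s) hne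
    subst hα
    obtain ⟨j, hji, -⟩ := exists_ne_ne hm i i
    rcases s with l | r
    · have h5 : l = i := by
        by_contra hli
        obtain ⟨q, hq, hq'⟩ := exists_ne_ne hm i l
        have h5 := weight_inl (hw i a) hne
        have h6 := weight_inl (hw q a) hne
        simp [hq, hq', hab, Ne.symm hli] at h5 h6
        grind
      subst h5
      refine ⟨rfl, rfl, ?_⟩
      ext c
      have h5 := weight_inl (hw l c) hne
      simp at h5
      rw [Finset.mem_insert, Finset.mem_singleton]
      by_cases hc : c ∈ u <;> by_cases hca : c = a <;> by_cases hcb : c = b <;> simp_all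
    · exfalso
      have h5 := weight_inr (hw i a) hne
      have h6 := weight_inr (hw j a) hne
      simp [hji, hab] at h5 h6
      grind
  refine ⟨c * extSign F {a} {b}, ?_⟩
  rw [hc, mon_pair hab, map_smul, smul_smul]

/-- With at least three indices, any two off-diagonal positions are joined by changing one index at
a time without touching the diagonal. -/
theorem offDiag_const {X : Type*} {N : ℕ} (hN : 3 ≤ N) (P : Fin N → Fin N → X)
    (h1 : ∀ k l c, k ≠ l → k ≠ c → P k l = P k c)
    (h2 : ∀ k l c, k ≠ l → c ≠ l → P k l = P c l) :
    ∃ x, ∀ k l, k ≠ l → P k l = x := by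
  let z : Fin N := ⟨0, by omega⟩
  let o : Fin N := ⟨1, by omega⟩
  have hzo : z ≠ o := by simp [z, o]
  refine ⟨P z o, fun k l hkl => ?_⟩
  obtain ⟨c, hck, hcz⟩ := exists_ne_ne hN k z
  rw [h1 k l c hkl hck.symm, h2 k c z hck.symm hcz.symm, h1 z c o hcz.symm hzo]

/-- The matrix-unit relation of gl_n over the even polynomials; it later yields the Leibniz rule for
the coefficients. -/
theorem lie_xi_partial_xi_partial {k l c : Fin n} (hkc : k ≠ c) {f g : Alg F p n t}
    (hf : f ∈ evenPoly F p n t) (hg : g ∈ evenPoly F p n t) :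
    ⁅mulD F p n t (Sum.inr l) (f ⋆ ξ k), mulD F p n t (Sum.inr c) (g ⋆ ξ l)⁆ =
      mulD F p n t (Sum.inr c) (f ⋆ g ⋆ ξ k) := by
  have hf0 := evenPoly_le_homog hf
  have hg0 := evenPoly_le_homog hg
  rw [lie_mulD_mulD (even_add_mul_mem hf0 (xi_mem_homog k))
    (even_add_mul_mem hg0 (xi_mem_homog l)), partial_inr_evenPoly_mul l hg, partial_gen,
    if_pos rfl, mul_one', partial_inr_evenPoly_mul c hf, partial_inr_xi_of_ne hkc.symm,
    map_zero, map_zero, map_zero, sub_zero, alg_mul_assoc, ← even_mul_comm hg0, alg_mul_assoc]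

end

/-! ### Removing the scalars on ξ_k D_l and ξ_a ξ_b D_i -/

section

variable [CharP F p] [Fact p.Prime] [Fact (∀ i, 1 ≤ t i)]
  {φ : Module.End F (Alg F p n t) →ₗ[F] Module.End F (Alg F p n t)}

theorem exists_diag (e : Var m n → F) :
    ∃ E ∈ evenFields F p n t, ∀ r, E (gen F p n t r) = e r • gen F p n t r :=
  ⟨_, mem_evenFields_iff_exists.2 ⟨_, fun r => Submodule.smul_mem _ (e r) (gen_mem_homog r), rfl⟩,
    fun r => vectorField_gen _ r⟩

theorem adEnd_add (A B : Module.End F (Alg F p n t)) : adEnd (A + B) = adEnd A + adEnd B := by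
  refine LinearMap.ext fun C => ?_
  rw [LinearMap.add_apply, adEnd_apply, adEnd_apply, adEnd_apply, add_lie]

theorem sub_adEnd_sub_adEnd (A B : Module.End F (Alg F p n t)) :
    φ - adEnd A - adEnd B = φ - adEnd (A + B) := by
  rw [adEnd_add, sub_sub]

/-- The eigenvalues satisfy c_kl + c_lq = c_kq by the matrix-unit relation, and a third index gives
c_kl + c_lk = 0; so c_kl = d_k - d_l, with d_k the value at a fixed base index. -/
theorem IsSDer.exists_lie_xi_partial_eq (hφ : IsSDer φ) (hm : 3 ≤ m) (hn : 3 ≤ n)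
    (h2 : (2 : F) ≠ 0) (hD : ∀ i, φ (partialD F p n t (Sum.inl i)) = 0)
    (hh : ∀ i (k : Fin n), φ (hField F p t i k) = 0) :
    ∃ d : Fin n → F, ∀ k l, k ≠ l → φ (mulD F p n t (Sum.inr l) (ξ k)) =
      (d k - d l) • mulD F p n t (Sum.inr l) (ξ k) := by
  have hex : ∀ k l, ∃ c : F, k ≠ l → φ (mulD F p n t (Sum.inr l) (ξ k)) =
      c • mulD F p n t (Sum.inr l) (ξ k) := by
    intro k l
    by_cases hkl : k = l
    · exact ⟨0, fun h => absurd hkl h⟩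
    · obtain ⟨c, hc⟩ := hφ.exists_map_xi_partial hm hn h2 hD hh hkl
      exact ⟨c, fun _ => hc⟩
  choose c hc using hex
  have hadd : ∀ k l q, k ≠ l → l ≠ q → k ≠ q → c k l + c l q = c k q := by
    intro k l q hkl hlq hkq
    have h1 := hφ.map_lie _ (xi_partial_mem_evenS h2 hkl) _ (xi_partial_mem_evenS h2 hlq)
    have h3 := lie_xi_partial_xi_partial (F := F) (p := p) (t := t) (l := l) hkq one_mem_evenPoly
      one_mem_evenPoly
    simp only [one_mul'] at h3
    rw [hc k l hkl, hc l q hlq, end_smul_lie, end_lie_smul, h3, hc k q hkq, ← add_smul] at h1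
    exact (smul_left_injective F (mulD_ne_zero (xi_ne_zero k)) h1).symm
  have hneg : ∀ k l, k ≠ l → c k l + c l k = 0 := by
    intro k l hkl
    obtain ⟨q, hqk, hql⟩ := exists_ne_ne hn k l
    linear_combination hadd k l q hkl hql.symm hqk.symm + hadd l k q hkl.symm hqk.symm hql.symm
  let z : Fin n := ⟨0, by omega⟩
  refine ⟨fun k => if k = z then 0 else c k z, fun k l hkl => ?_⟩
  rw [hc k l hkl]
  congr 1
  dsimp only
  split_ifs with h1 h3 h3
  · exact absurd (h1.trans h3.symm) hkl
  · have := hneg k l hkl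
    rw [← h1]
    linear_combination this
  · rw [h3, sub_zero]
  · have := hadd k l z hkl h3 h1
    linear_combination this

theorem lie_pair_x_partial {i j : Fin m} (a b : Fin n) :
    ⁅mulD F p n t (Sum.inl i) (ξ a ⋆ ξ b), mulD F p n t (Sum.inl j) (gen F p n t (Sum.inl i))⁆ =
      mulD F p n t (Sum.inl j) (ξ a ⋆ ξ b) := by
  rw [lie_mulD_mulD (odd_mul_odd_mem (xi_mem_homog a) (xi_mem_homog b)) (mon_empty_mem_homog _),
    partial_gen, if_pos rfl, mul_one',
    mem_oddPoly.1 (mul_mem_oddPoly (xi_mem_oddPoly a) (xi_mem_oddPoly b)), map_zero, map_zero,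
    sub_zero]

theorem lie_xi_partial_pair {a b c : Fin n} (hab : a ≠ b) (i : Fin m) :
    ⁅mulD F p n t (Sum.inr a) (ξ c), mulD F p n t (Sum.inl i) (ξ a ⋆ ξ b)⁆ =
      mulD F p n t (Sum.inl i) (ξ c ⋆ ξ b) := by
  rw [lie_mulD_mulD (xi_mem_homog c) (odd_mul_odd_mem (xi_mem_homog a) (xi_mem_homog b)),
    mem_oddPoly.1 (xi_mem_oddPoly c), map_zero, map_zero, sub_zero, partial_inr_xi_mul,
    if_pos rfl, partial_inr_xi_of_ne hab, map_zero, sub_zero]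

/-- Bracketing with the killed fields x_i D_j and ξ_c D_a carries any ξ_a ξ_b D_i to any other, so
all eigenvalues agree. -/
theorem IsSDer.exists_map_pair_eq (hφ : IsSDer φ) (hm : 3 ≤ m) (hn : 3 ≤ n)
    (h2 : (2 : F) ≠ 0) (h3 : (3 : F) ≠ 0) (hD : ∀ i, φ (partialD F p n t (Sum.inl i)) = 0)
    (hh : ∀ i (k : Fin n), φ (hField F p t i k) = 0)
    (hv : ∀ k l, k ≠ l → φ (mulD F p n t (Sum.inr l) (ξ k)) = 0) :
    ∃ e : F, ∀ a b i, a ≠ b → φ (mulD F p n t (Sum.inl i) (ξ a ⋆ ξ b)) =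
      e • mulD F p n t (Sum.inl i) (ξ a ⋆ ξ b) := by
  have hex : ∀ a b i, ∃ c : F, a ≠ b → φ (mulD F p n t (Sum.inl i) (ξ a ⋆ ξ b)) =
      c • mulD F p n t (Sum.inl i) (ξ a ⋆ ξ b) := by
    intro a b i
    by_cases hab : a = b
    · exact ⟨0, fun h => absurd hab h⟩
    · obtain ⟨c, hc⟩ := hφ.exists_map_pair hm hn hD hh hab i
      exact ⟨c, fun _ => hc⟩
  choose c hc using hex
  have hinj : ∀ a b i, a ≠ b → Function.Injective fun x : F =>
      x • mulD F p n t (Sum.inl i) (ξ a ⋆ ξ b) := fun a b i hab =>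
    smul_left_injective F (mulD_ne_zero (xi_mul_xi_ne_zero hab))
  have hi : ∀ a b i j, a ≠ b → c a b i = c a b j := by
    intro a b i j hab
    by_cases hij : i = j
    · rw [hij]
    have h1 := hφ.map_lie _ (pair_mem_evenS hn a b i) _ (x_partial_mem_evenS a hij)
    rw [hφ.map_x_partial hn h2 h3 hD hh hij, lie_zero, add_zero, lie_pair_x_partial, hc a b i hab,
      hc a b j hab, end_smul_lie, lie_pair_x_partial] at h1
    exact (hinj a b j hab h1).symm
  have hleft : ∀ a b q, a ≠ b → q ≠ b → c a b = c q b := by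
    intro a b q hab hqb
    by_cases haq : q = a
    · rw [haq]
    funext i
    have h1 := hφ.map_lie _ (xi_partial_mem_evenS h2 haq) _ (pair_mem_evenS hn a b i)
    rw [hv q a haq, zero_lie, zero_add, lie_xi_partial_pair hab, hc a b i hab, hc q b i hqb,
      end_lie_smul, lie_xi_partial_pair hab] at h1
    exact (hinj q b i hqb h1).symm
  have hsymm : ∀ a b, a ≠ b → c a b = c b a := by
    intro a b hab
    funext i
    have h1 := hc b a i hab.symm
    rw [xi_mul_comm b a, map_neg, map_neg, hc a b i hab, smul_neg, neg_inj] at h1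
    exact hinj a b i hab h1
  obtain ⟨x, hx⟩ := offDiag_const hn c (fun k l q hkl hkq => by
    rw [hsymm k l hkl, hleft l k q hkl.symm hkq.symm, hsymm q k hkq.symm]) hleft
  refine ⟨x ⟨0, by omega⟩, fun a b i hab => ?_⟩
  rw [hc a b i hab, hi a b i ⟨0, by omega⟩ hab, hx a b hab]

/-- A derivation of `𝒮` that kills the linear fields and the fields `D_i`, `ξ_a ξ_b D_i`. -/
structure IsNormalized (φ : Module.End F (Alg F p n t) →ₗ[F] Module.End F (Alg F p n t)) : Prop
    extends IsSDer φ where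
  partial_eq : ∀ i, φ (partialD F p n t (Sum.inl i)) = 0
  hField_eq : ∀ i (k : Fin n), φ (hField F p t i k) = 0
  xi_partial_eq : ∀ k l, k ≠ l → φ (mulD F p n t (Sum.inr l) (ξ k)) = 0
  x_partial_eq : ∀ i j, i ≠ j → φ (mulD F p n t (Sum.inl j) (gen F p n t (Sum.inl i))) = 0
  pair_eq : ∀ a b, a ≠ b → ∀ i, φ (mulD F p n t (Sum.inl i) (ξ a ⋆ ξ b)) = 0

theorem IsSDer.exists_isNormalized (hφ : IsSDer φ) (hm : 3 ≤ m) (hn : 3 ≤ n)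
    (h2 : (2 : F) ≠ 0) (h3 : (3 : F) ≠ 0) :
    ∃ E ∈ evenFields F p n t, IsNormalized (φ - adEnd E) := by
  obtain ⟨E₁, hE₁, hD₁⟩ := hφ.exists_lie_partial_eq hm hn h2
  have hφ₁ := hφ.sub_adEnd_of_mem hE₁
  have hD₁ : ∀ i, (φ - adEnd E₁) (partialD F p n t (Sum.inl i)) = 0 := fun i => by
    rw [LinearMap.sub_apply, hD₁, adEnd_apply, sub_self]
  obtain ⟨E₂, hE₂, hD₂, hh₂⟩ := hφ₁.exists_lie_hField_eq hn hD₁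
  have hφ₂ := hφ₁.sub_adEnd_of_mem hE₂
  have hD₂ : ∀ i, (φ - adEnd E₁ - adEnd E₂) (partialD F p n t (Sum.inl i)) = 0 := fun i => by
    rw [LinearMap.sub_apply, hD₁, adEnd_apply, hD₂, sub_self]
  have hh₂ := hφ₂.map_hField_eq_zero hm hn h2 hD₂ hh₂
  obtain ⟨d, hd⟩ := hφ₂.exists_lie_xi_partial_eq hm hn h2 hD₂ hh₂
  obtain ⟨E₃, hE₃, hd₃⟩ := exists_diag (F := F) (p := p) (t := t) (Sum.elim (0 : Fin m → F) d)
  have hφ₃ := hφ₂.sub_adEnd_of_mem hE₃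
  have hD₃ : ∀ i, (φ - adEnd E₁ - adEnd E₂ - adEnd E₃) (partialD F p n t (Sum.inl i)) = 0 :=
    fun i => by
      rw [LinearMap.sub_apply, hD₂, adEnd_apply, lie_diag_partial hE₃ hd₃]
      simp
  have hh₃ : ∀ i (k : Fin n), (φ - adEnd E₁ - adEnd E₂ - adEnd E₃) (hField F p t i k) = 0 :=
    fun i k => by
      rw [LinearMap.sub_apply, hh₂, adEnd_apply, lie_diag_diag hE₃ hd₃ (hField_mem_evenFields i k)
        (hField_gen i k), sub_self]
  have hv₃ : ∀ k l, k ≠ l →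
      (φ - adEnd E₁ - adEnd E₂ - adEnd E₃) (mulD F p n t (Sum.inr l) (ξ k)) = 0 :=
    fun k l hkl => by
      rw [LinearMap.sub_apply, hd k l hkl, adEnd_apply, lie_diag_mulD hE₃ hd₃ (hd₃ _)
        (xi_mem_homog k)]
      simp
  obtain ⟨e, he⟩ := hφ₃.exists_map_pair_eq hm hn h2 h3 hD₃ hh₃ hv₃
  -- The field (e/2) ∑ ξ_k D_k acts on ξ_a ξ_b D_i by e and commutes with everything normalized
  -- before.
  obtain ⟨E₄, hE₄, hd₄⟩ := exists_diag (F := F) (p := p) (t := t)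
    (Sum.elim (0 : Fin m → F) fun _ : Fin n => e / 2)
  have hφ₄ := hφ₃.sub_adEnd_of_mem hE₄
  have hD₄ : ∀ i, (φ - adEnd E₁ - adEnd E₂ - adEnd E₃ - adEnd E₄)
      (partialD F p n t (Sum.inl i)) = 0 := fun i => by
    rw [LinearMap.sub_apply, hD₃, adEnd_apply, lie_diag_partial hE₄ hd₄]
    simp
  have hh₄ : ∀ i (k : Fin n),
      (φ - adEnd E₁ - adEnd E₂ - adEnd E₃ - adEnd E₄) (hField F p t i k) = 0 := fun i k => by
    rw [LinearMap.sub_apply, hh₃, adEnd_apply, lie_diag_diag hE₄ hd₄ (hField_mem_evenFields i k)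
      (hField_gen i k), sub_self]
  refine ⟨E₁ + E₂ + E₃ + E₄, Submodule.add_mem _ (Submodule.add_mem _ (Submodule.add_mem _ hE₁ hE₂)
    hE₃) hE₄, ?_⟩
  rw [← sub_adEnd_sub_adEnd, ← sub_adEnd_sub_adEnd, ← sub_adEnd_sub_adEnd]
  refine ⟨hφ₄, hD₄, hh₄, fun k l hkl => ?_, fun i j hij => hφ₄.map_x_partial hn h2 h3 hD₄ hh₄ hij,
    fun a b hab i => ?_⟩
  · rw [LinearMap.sub_apply, hv₃ k l hkl, adEnd_apply, lie_diag_mulD hE₄ hd₄ (hd₄ _)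
      (xi_mem_homog k)]
    simp
  · rw [LinearMap.sub_apply, he a b i hab, adEnd_apply, lie_diag_mulD hE₄ hd₄
      (diag_gen_mul_gen hE₄ hd₄ _ _) (odd_mul_odd_mem (xi_mem_homog a) (xi_mem_homog b))]
    simp only [Sum.elim_inr, Sum.elim_inl, Pi.zero_apply, sub_zero]
    rw [← mul_two, div_mul_cancel₀ _ h2, sub_self]

end

/-! ### Derivations of the divided power algebra that commute with the `D_i` -/

section

variable [CharP F p] [Fact p.Prime] [Fact (∀ i, 1 ≤ t i)]

theorem evenPoly_ind {P : Alg F p n t → Prop} {f : Alg F p n t} (hf : f ∈ evenPoly F p n t)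
    (zero : P 0) (add : ∀ f g, P f → P g → P (f + g)) (smul : ∀ (c : F) f, P f → P (c • f))
    (mon : ∀ (α : Fin m → ℕ) (_ : ∀ i, α i < p ^ t i), P (mon F p n t α ∅)) : P f := by
  have h1 : f ∈ Finsupp.supported F F {b : Idx p n t | b.2 = ∅} := by
    rw [Finsupp.mem_supported]
    intro b hb
    exact eq_empty_of_mem_evenPoly hf (Finsupp.mem_support_iff.1 hb)
  rw [Finsupp.supported_eq_span_single] at h1
  clear hf
  induction h1 using Submodule.span_induction with
  | mem x hx =>
    obtain ⟨b, hb, rfl⟩ := hx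
    have := mon b.1.1 b.1.2
    rw [← show b.2 = ∅ from hb, ← single_eq_mon b] at this
    exact this
  | zero => exact zero
  | add x y _ _ hx hy => exact add x y hx hy
  | smul c x _ hx => exact smul c x hx

/-- Kummer's theorem: adding b - p^r to p^r, with p^r the leading power of p in b, produces no
carry, because the sum is below p^(r + 1). -/
theorem not_dvd_choose_pow_log {b : ℕ} (hb : b ≠ 0) :
    ¬ p ∣ (p ^ Nat.log p b + (b - p ^ Nat.log p b)).choose (p ^ Nat.log p b) := by
  have hp := Fact.out (p := p.Prime)
  set r := Nat.log p b with hr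
  have h1 : p ^ r ≤ b := Nat.pow_log_le_self p hb
  have h2 : b < p ^ (r + 1) := Nat.lt_pow_succ_log_self hp.one_lt b
  have hpos : 0 < (p ^ r + (b - p ^ r)).choose (p ^ r) := Nat.choose_pos (Nat.le_add_right _ _)
  rw [hp.dvd_iff_one_le_factorization hpos.ne', not_le, Nat.lt_one_iff, add_comm,
    Nat.factorization_choose' (p := p) (n := b - p ^ r) (k := p ^ r) hp
      (b := Nat.log p (b - p ^ r + p ^ r) + 1) (Nat.lt_succ_self _), Finset.card_eq_zero,
    Finset.filter_eq_empty_iff]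
  intro i _
  rw [not_le]
  rcases le_or_gt i r with h | h
  · rw [Nat.mod_eq_zero_of_dvd (pow_dvd_pow p h), zero_add]
    exact Nat.mod_lt _ (pow_pos hp.pos i)
  · calc p ^ r % p ^ i + (b - p ^ r) % p ^ i ≤ p ^ r + (b - p ^ r) :=
          add_le_add (Nat.mod_le _ _) (Nat.mod_le _ _)
      _ = b := Nat.add_sub_cancel' h1
      _ < p ^ (r + 1) := h2
      _ ≤ p ^ i := Nat.pow_le_pow_right hp.pos h

/-- So x^(β) is a nonzero multiple of a product of two nonconstant monomials unless β = p^r ε_i. If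
β involves several variables one is split off, and otherwise a leading power of p. -/
theorem exists_add_of_ne_single {β : Fin m → ℕ} (h0 : β ≠ 0)
    (h : ∀ i r, β ≠ Pi.single i (p ^ r)) :
    ∃ a b : Fin m → ℕ, a ≠ 0 ∧ b ≠ 0 ∧ a + b = β ∧ dpCoeff F a b ≠ 0 := by
  obtain ⟨i, hi⟩ := Function.ne_iff.1 h0
  by_cases hβ : β = Pi.single i (β i)
  · have h1 := Nat.pow_log_le_self p hi
    have h2 : β i ≠ p ^ Nat.log p (β i) := fun h' => h i _ (by rw [← h']; exact hβ)
    refine ⟨Pi.single i (p ^ Nat.log p (β i)), Pi.single i (β i - p ^ Nat.log p (β i)), ?_, ?_,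
      ?_, ?_⟩
    · rw [Ne, Pi.single_eq_zero_iff]
      exact (pow_pos (Fact.out (p := p.Prime)).pos _).ne'
    · rw [Ne, Pi.single_eq_zero_iff]
      omega
    · rw [← Pi.single_add, Nat.add_sub_cancel' h1]
      exact hβ.symm
    · rw [dpCoeff, Finset.prod_eq_single i]
      · rw [Pi.single_eq_same, Pi.single_eq_same, Ne, CharP.cast_eq_zero_iff F p]
        exact not_dvd_choose_pow_log hi
      · intro j _ hj
        simp [hj]
      · simp
  · have hle : (Pi.single i (β i) : Fin m → ℕ) ≤ β := by
      intro j
      by_cases hj : j = i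
      · subst hj; simp
      · simp [hj]
    refine ⟨Pi.single i (β i), β - Pi.single i (β i), ?_, ?_, add_tsub_cancel_of_le hle, ?_⟩
    · rw [Ne, Pi.single_eq_zero_iff]
      exact hi
    · intro h'
      exact hβ (le_antisymm (tsub_eq_zero_iff_le.1 h') hle)
    · rw [dpCoeff, Finset.prod_eq_one, Nat.cast_one]
      · exact one_ne_zero
      · intro j _
        by_cases hj : j = i
        · subst hj; simp
        · simp [hj]

theorem eq_zero_of_coeffAt_eq_zero {f : Alg F p n t} (hf : f ∈ evenPoly F p n t)
    (hf' : f ∈ oddPoly F p n t) (h : coeffAt 0 ∅ f = 0) : f = 0 := by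
  refine alg_ext fun α u _ => ?_
  rw [map_zero]
  by_contra hne
  rw [eq_zero_of_coeffAt_ne_zero hf' hne, eq_empty_of_coeffAt_ne_zero hf hne] at hne
  exact hne h

/-- By induction on the degree all D_i kill δ(x^(β)), so it is constant. Its constant term vanishes
by hypothesis on the indecomposables x^(p^r ε_i), and by the Leibniz rule on decomposable monomials,
whose factors have no constant term. -/
theorem eq_zero_of_commutes_partial {δ : Alg F p n t →ₗ[F] Alg F p n t}
    (hδ : ∀ f ∈ evenPoly F p n t, δ f ∈ evenPoly F p n t)
    (hmul : ∀ f ∈ evenPoly F p n t, ∀ g ∈ evenPoly F p n t, δ (f ⋆ g) = δ f ⋆ g + f ⋆ δ g)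
    (hpart : ∀ f ∈ evenPoly F p n t, ∀ i, δ (𝔡 (Sum.inl i) f) = 𝔡 (Sum.inl i) (δ f))
    (h : ∀ i r, coeffAt 0 ∅ (δ (mon F p n t (Pi.single i (p ^ r)) ∅)) = 0)
    {f : Alg F p n t} (hf : f ∈ evenPoly F p n t) : δ f = 0 := by
  refine evenPoly_ind (P := fun f => δ f = 0) hf (map_zero δ) (fun f g hf hg => ?_)
    (fun c f hf => ?_) fun β hβ => ?_
  · rw [map_add, hf, hg, add_zero]
  · rw [map_smul, hf, smul_zero]
  induction hN : ∑ i, β i using Nat.strong_induction_on generalizing β with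
  | _ N ih =>
    refine eq_zero_of_coeffAt_eq_zero (hδ _ (mon_mem_evenPoly β)) (mem_oddPoly.2 fun i => ?_) ?_
    · rw [← hpart _ (mon_mem_evenPoly β), partial_inl_mon i hβ]
      split_ifs with h0
      · exact map_zero δ
      · refine ih (∑ j, (β - Pi.single i 1 : Fin m → ℕ) j) ?_ _
          (fun j => lt_of_le_of_lt (Nat.sub_le _ _) (hβ j)) rfl
        rw [← hN]
        refine Finset.sum_lt_sum (fun j _ => Nat.sub_le _ _) ⟨i, Finset.mem_univ i, ?_⟩
        simp
        omega
    · by_cases h0 : β = 0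
      · have h1 := hmul _ one_mem_evenPoly _ (one_mem_evenPoly (F := F) (p := p) (t := t))
        rw [one_mul', one_mul', mul_one'] at h1
        rw [h0]
        change coeffAt 0 ∅ (δ (one F p n t)) = 0
        rw [left_eq_add.1 h1, map_zero]
      · by_cases h1 : ∃ i r, β = Pi.single i (p ^ r)
        · obtain ⟨i, r, rfl⟩ := h1
          exact h i r
        · push Not at h1
          obtain ⟨a, b, ha, hb, rfl, hc⟩ := exists_add_of_ne_single (F := F) h0 h1
          have ha' : ∀ i, a i < p ^ t i := fun i => lt_of_le_of_lt (Nat.le_add_right _ _) (hβ i)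
          have hb' : ∀ i, b i < p ^ t i := fun i => lt_of_le_of_lt (Nat.le_add_left _ _) (hβ i)
          have h2 := congrArg (fun x => coeffAt 0 ∅ (δ x))
            (mul_mon (F := F) a b (∅ : Finset (Fin n)) ∅ ha' hb')
          simp only [hmul _ (mon_mem_evenPoly a) _ (mon_mem_evenPoly b), map_add,
            coeffAt_zero_empty_mul, coeffAt_mon ha', coeffAt_mon hb', ha, hb, false_and, if_false,
            mul_zero, zero_mul, add_zero, Finset.disjoint_empty_left, if_true, map_smul,
            extSign_empty_left, mul_one, Finset.empty_union, smul_eq_mul] at h2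
          exact (mul_eq_zero.1 h2.symm).resolve_left hc

/-- The D_i^(p^r) are dual to the indecomposables: the constant term of D_i^(p^r)(x^(p^s ε_j)) is 1
if (i, r) = (j, s) and 0 otherwise. Subtracting the matching combination leaves a derivation with no
constant terms. The case r = 0 is excluded by δ(x_i) = 0, and r ≥ t_i by truncation. -/
theorem exists_mem_spanJ {δ : Alg F p n t →ₗ[F] Alg F p n t}
    (hδ : ∀ f ∈ evenPoly F p n t, δ f ∈ evenPoly F p n t)
    (hmul : ∀ f ∈ evenPoly F p n t, ∀ g ∈ evenPoly F p n t, δ (f ⋆ g) = δ f ⋆ g + f ⋆ δ g)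
    (hpart : ∀ f ∈ evenPoly F p n t, ∀ i, δ (𝔡 (Sum.inl i) f) = 𝔡 (Sum.inl i) (δ f))
    (hgen : ∀ i, δ (gen F p n t (Sum.inl i)) = 0) :
    ∃ j ∈ spanJ F p n t, ∀ f ∈ evenPoly F p n t, δ f = j f := by
  have hp := Fact.out (p := p.Prime)
  let j : Module.End F (Alg F p n t) := ∑ i, ∑ r ∈ Finset.Ico 1 (t i),
    coeffAt 0 ∅ (δ (mon F p n t (Pi.single i (p ^ r)) ∅)) • partialD F p n t (Sum.inl i) ^ p ^ r
  have hj : j ∈ spanJ F p n t := Submodule.sum_mem _ fun i _ => Submodule.sum_mem _ fun r hr =>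
    Submodule.smul_mem _ _ (Submodule.subset_span
      ⟨i, r, (Finset.mem_Ico.1 hr).1, (Finset.mem_Ico.1 hr).2, rfl⟩)
  have hj' := isHigherPartial_of_mem hj
  have hje : ∀ f ∈ evenPoly F p n t, j f ∈ evenPoly F p n t := fun f hf => by
    refine mem_evenPoly.2 fun k => ?_
    rw [← hj'.partial_apply, mem_evenPoly.1 hf, map_zero]
  refine ⟨j, hj, fun f hf => ?_⟩
  rw [← sub_eq_zero, ← LinearMap.sub_apply]
  refine eq_zero_of_commutes_partial (fun f hf => Submodule.sub_mem _ (hδ f hf) (hje f hf))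
    (fun f hf g hg => ?_) (fun f hf i => ?_) (fun i r => ?_) hf
  · simp only [LinearMap.sub_apply, hmul f hf g hg, hj'.map_mul, map_sub]
    abel
  · rw [LinearMap.sub_apply, LinearMap.sub_apply, hpart f hf, hj'.partial_apply, map_sub]
  · rcases Nat.eq_zero_or_pos r with rfl | hr
    · rw [pow_zero]
      change coeffAt 0 ∅ ((δ - j) (gen F p n t (Sum.inl i))) = 0
      rw [LinearMap.sub_apply, hgen, hj'.map_gen, sub_zero, map_zero]
    · by_cases hrt : r < t i
      · have hmem : ∀ a, (Pi.single i (p ^ r) : Fin m → ℕ) a < p ^ t a := by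
          intro a
          by_cases ha : a = i
          · subst ha; simpa using Nat.pow_lt_pow_right hp.one_lt hrt
          · simpa [ha] using pow_pos hp.pos _
        have hne : p ^ r ≠ 0 := (pow_pos hp.pos r).ne'
        rw [LinearMap.sub_apply, map_sub, sub_eq_zero]
        simp only [j, LinearMap.sum_apply, LinearMap.smul_apply, map_sum, map_smul,
          coeffAt_partial_pow, zero_add, coeffAt_mon hmem, and_true, smul_eq_mul]
        rw [Finset.sum_eq_single i, Finset.sum_eq_single r]
        · simp
        · intro s _ hs
          rw [if_neg, mul_zero]
          intro h
          have := congrFun h i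
          simp only [Pi.single_eq_same] at this
          exact hs (Nat.pow_right_injective hp.two_le this).symm
        · intro h
          exact absurd (Finset.mem_Ico.2 ⟨hr, hrt⟩) h
        · intro a _ ha
          refine Finset.sum_eq_zero fun s _ => ?_
          rw [if_neg, mul_zero]
          intro h
          have := congrFun h i
          rw [Pi.single_eq_same, Pi.single_eq_of_ne ha.symm] at this
          exact hne this
        · simp
      · rw [mon_of_not, map_zero, map_zero]
        intro h
        have := h i
        rw [Pi.single_eq_same] at this
        exact hrt ((Nat.pow_lt_pow_iff_right hp.one_lt).1 this)

end

/-! ### Values on the fields `f ξ_k D_l` -/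

section

variable [CharP F p] [Fact p.Prime] [Fact (∀ i, 1 ≤ t i)]
  {φ : Module.End F (Alg F p n t) →ₗ[F] Module.End F (Alg F p n t)}

/-- The element `ξ_c D_c - ξ_d D_d` of the torus of `𝒮`. -/
noncomputable def oddTorus (F : Type*) [Field F] (p : ℕ) {m n : ℕ} (t : Fin m → ℕ)
    (c d : Fin n) : Module.End F (Alg F p n t) :=
  mulD F p n t (Sum.inr c) (ξ c) - mulD F p n t (Sum.inr d) (ξ d)

theorem oddTorus_eq (i : Fin m) (c d : Fin n) :
    oddTorus F p t c d = hField F p t i c - hField F p t i d := by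
  rw [oddTorus, hField, hField]
  abel

theorem oddTorus_mem_evenS (i : Fin m) (c d : Fin n) : oddTorus F p t c d ∈ evenS F p n t := by
  rw [oddTorus_eq i]
  exact Submodule.sub_mem _ (hField_mem_evenS i c) (hField_mem_evenS i d)

theorem oddTorus_mem_evenFields (c d : Fin n) : oddTorus F p t c d ∈ evenFields F p n t :=
  Submodule.sub_mem _ (mulD_mem_evenFields (xi_mem_homog c)) (mulD_mem_evenFields (xi_mem_homog d))

theorem oddTorus_gen (c d : Fin n) (r : Var m n) : oddTorus F p t c d (gen F p n t r) =
    (((if Sum.inr c = r then 1 else 0) - if Sum.inr d = r then 1 else 0 : F)) • gen F p n t r := by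
  rw [oddTorus, LinearMap.sub_apply, mulD_gen, mulD_gen, sub_smul]
  congr 1 <;> split_ifs with h <;> simp [h]

theorem oddTorus_evenPoly (c d : Fin n) {f : Alg F p n t} (hf : f ∈ evenPoly F p n t) :
    oddTorus F p t c d f = 0 := by
  rw [oddTorus, LinearMap.sub_apply, mulD_apply, mulD_apply, mem_evenPoly.1 hf,
    mem_evenPoly.1 hf, map_zero, map_zero, sub_zero]

theorem oddTorus_evenPoly_mul (c d : Fin n) {f g : Alg F p n t} (hf : f ∈ evenPoly F p n t)
    {w : F} (hg : oddTorus F p t c d g = w • g) : oddTorus F p t c d (f ⋆ g) = w • (f ⋆ g) := by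
  rw [evenField_mul (oddTorus_mem_evenFields c d), oddTorus_evenPoly c d hf, hg, map_zero,
    LinearMap.zero_apply, zero_add, map_smul]

theorem weight_of_lie_oddTorus {c d : Fin n} {E : Module.End F (Alg F p n t)} {x : F}
    (h : ⁅oddTorus F p t c d, E⁆ = x • E) {s : Var m n} {α : Fin m → ℕ} {u : Finset (Fin n)}
    (hne : coeffAt α u (E (gen F p n t s)) ≠ 0) :
    ((if c ∈ u then 1 else 0) - (if Sum.inr c = s then 1 else 0)) -
      ((if d ∈ u then 1 else 0) - if Sum.inr d = s then 1 else 0) = x := by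
  have h1 := congrArg (fun A => coeffAt α u (A (gen F p n t s))) h
  simp only [oddTorus, sub_lie, LinearMap.sub_apply, map_sub, coeffAt_lie_torus,
    LinearMap.smul_apply, map_smul, smul_eq_mul, ← sub_mul, wt] at h1
  exact mul_right_cancel₀ hne h1

theorem IsSDer.lie_oddTorus_map (hφ : IsSDer φ) (hm : 3 ≤ m)
    (hh : ∀ i (k : Fin n), φ (hField F p t i k) = 0)
    {s : Module.End F (Alg F p n t)} (hs : s ∈ evenS F p n t) {c d : Fin n} {x : F}
    (h : ⁅oddTorus F p t c d, s⁆ = x • s) : ⁅oddTorus F p t c d, φ s⁆ = x • φ s := by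
  let i : Fin m := ⟨0, by omega⟩
  have h1 := hφ.map_lie _ (oddTorus_mem_evenS i c d) s hs
  have h2 : φ (oddTorus F p t c d) = 0 := by rw [oddTorus_eq i, map_sub, hh, hh, sub_zero]
  rwa [h, h2, zero_lie, zero_add, map_smul, eq_comm] at h1

theorem vert_mem_homog {f : Alg F p n t} (hf : f ∈ evenPoly F p n t) (k : Fin n) :
    f ⋆ ξ k ∈ homog F p n t 1 :=
  even_add_mul_mem (evenPoly_le_homog hf) (xi_mem_homog k)

theorem lie_oddTorus_vert (c d : Fin n) {k l : Fin n} {f : Alg F p n t}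
    (hf : f ∈ evenPoly F p n t) :
    ⁅oddTorus F p t c d, mulD F p n t (Sum.inr l) (f ⋆ ξ k)⁆ =
      (((if c = k then 1 else 0) - if d = k then 1 else 0) -
        ((if c = l then 1 else 0) - if d = l then 1 else 0) : F) •
        mulD F p n t (Sum.inr l) (f ⋆ ξ k) := by
  rw [lie_diag_mulD (s := Sum.inr l) (oddTorus_mem_evenFields c d) (oddTorus_gen c d)
    (oddTorus_evenPoly_mul c d hf (oddTorus_gen c d (Sum.inr k))) (vert_mem_homog hf k)]
  simp only [Sum.inr.injEq]

/-- The elements ξ_c D_c - ξ_d D_d do not see the exponents of the x_i, so f ξ_k D_l is an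
eigenvector for arbitrary f, and the weights determine the odd part of its image. -/
theorem IsNormalized.exists_map_vert (hφ : IsNormalized φ) (hm : 3 ≤ m) (h2 : (2 : F) ≠ 0)
    (h3 : (3 : F) ≠ 0) {k l : Fin n} (hkl : k ≠ l)
    {f : Alg F p n t} (hf : f ∈ evenPoly F p n t) : ∃ g ∈ evenPoly F p n t,
      φ (mulD F p n t (Sum.inr l) (f ⋆ ξ k)) = mulD F p n t (Sum.inr l) (g ⋆ ξ k) := by
  have hs := vert_mem_evenS h2 hf hkl
  have hw := fun c d => hφ.lie_oddTorus_map hm hφ.hField_eq hs (lie_oddTorus_vert c d hf)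
  have key : ∀ s α u,
      coeffAt α u (φ (mulD F p n t (Sum.inr l) (f ⋆ ξ k)) (gen F p n t s)) ≠ 0 →
        s = Sum.inr l ∧ u = {k} := by
    intro s α u hne
    -- The weight under ξ_k D_k - ξ_l D_l is 2, the largest of the integers from -2 to 2 that can
    -- occur. These are distinguished from 2 because 2, 3 and 4 are nonzero in F, so k ∈ u, l ∉ u
    -- and the direction is D_l.
    have h4 := weight_of_lie_oddTorus (hw k l) hne
    have h5 : (4 : F) ≠ 0 := by
      rw [show (4 : F) = 2 * 2 by norm_num]
      exact mul_ne_zero h2 h2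
    rcases s with j | r
    · exfalso
      simp [hkl, hkl.symm] at h4
      split_ifs at h4 <;> grind
    · have h6 : r = l ∧ k ∈ u ∧ l ∉ u := by
        simp [hkl, hkl.symm] at h4
        split_ifs at h4 <;> grind
      obtain ⟨rfl, hk, hl⟩ := h6
      refine ⟨rfl, ?_⟩
      ext c
      rw [Finset.mem_singleton]
      refine ⟨fun hc => ?_, fun hc => hc ▸ hk⟩
      by_contra hck
      have hcr : c ≠ r := fun h => hl (h ▸ hc)
      have h7 := weight_of_lie_oddTorus (hw k c) hne
      simp [hkl, hck, hcr, hk, hc] at h7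
  obtain ⟨g, hg, hg'⟩ := exists_evenPoly_mul fun α u hne => (key (Sum.inr l) α u hne).2
  refine ⟨g, hg, evenFields_ext (hφ.map_mem _ hs) (mulD_mem_evenFields (vert_mem_homog hg k))
    fun s => ?_⟩
  rw [mulD_gen]
  split_ifs with h
  · rw [← h]
    exact hg'
  · refine alg_ext fun α u _ => ?_
    rw [map_zero]
    by_contra hne
    exact h (key s α u hne).1.symm

theorem partial_vert (k : Fin n) {g : Alg F p n t} (hg : g ∈ evenPoly F p n t) :
    𝔡 (Sum.inr k) (g ⋆ ξ k) = g := by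
  rw [partial_inr_evenPoly_mul k hg, partial_gen, if_pos rfl, mul_one']

theorem eq_of_vert_eq {k l : Fin n} {f g : Alg F p n t} (hf : f ∈ evenPoly F p n t)
    (hg : g ∈ evenPoly F p n t)
    (h : mulD F p n t (Sum.inr l) (f ⋆ ξ k) = mulD F p n t (Sum.inr l) (g ⋆ ξ k)) : f = g := by
  have h1 := congrArg (fun A => 𝔡 (Sum.inr k) (A (ξ l))) h
  simp only [mulD_gen, if_true] at h1
  rwa [partial_vert k hf, partial_vert k hg] at h1

/-- The action of a derivation of `𝒮` on the coefficient `f` of `f ξ_k D_l`. -/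
noncomputable def vertCoeff (φ : Module.End F (Alg F p n t) →ₗ[F] Module.End F (Alg F p n t))
    (k l : Fin n) : Alg F p n t →ₗ[F] Alg F p n t :=
  partialD F p n t (Sum.inr k) ∘ₗ LinearMap.applyₗ (ξ l) ∘ₗ φ ∘ₗ mulD F p n t (Sum.inr l) ∘ₗ
    (mul F p n t).flip (ξ k)

theorem vertCoeff_apply (k l : Fin n) (f : Alg F p n t) : vertCoeff φ k l f =
    𝔡 (Sum.inr k) (φ (mulD F p n t (Sum.inr l) (f ⋆ ξ k)) (ξ l)) := rfl

/-- Inserting the constant 1, on which φ is already zero, into the matrix-unit relation shows that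
the coefficient map does not depend on k and l; the same relation for general f and g is then the
Leibniz rule. -/
theorem IsNormalized.exists_vertCoeff (hφ : IsNormalized φ) (hm : 3 ≤ m) (hn : 3 ≤ n)
    (h2 : (2 : F) ≠ 0) (h3 : (3 : F) ≠ 0) : ∃ δ : Alg F p n t →ₗ[F] Alg F p n t,
      (∀ f ∈ evenPoly F p n t, δ f ∈ evenPoly F p n t) ∧
      (∀ f ∈ evenPoly F p n t, ∀ k l, k ≠ l →
        φ (mulD F p n t (Sum.inr l) (f ⋆ ξ k)) = mulD F p n t (Sum.inr l) (δ f ⋆ ξ k)) ∧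
      (∀ f ∈ evenPoly F p n t, ∀ g ∈ evenPoly F p n t, δ (f ⋆ g) = δ f ⋆ g + f ⋆ δ g) ∧
      (∀ f ∈ evenPoly F p n t, ∀ i, δ (𝔡 (Sum.inl i) f) = 𝔡 (Sum.inl i) (δ f)) ∧
      ∀ i, δ (gen F p n t (Sum.inl i)) = 0 := by
  let P := fun k l (f : evenPoly F p n t) => vertCoeff φ k l f
  have hP : ∀ k l, k ≠ l → ∀ f ∈ evenPoly F p n t, vertCoeff φ k l f ∈ evenPoly F p n t ∧
      φ (mulD F p n t (Sum.inr l) (f ⋆ ξ k)) =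
        mulD F p n t (Sum.inr l) (vertCoeff φ k l f ⋆ ξ k) := by
    intro k l hkl f hf
    obtain ⟨g, hg, h⟩ := hφ.exists_map_vert hm h2 h3 hkl hf
    have h1 : vertCoeff φ k l f = g := by
      rw [vertCoeff_apply, h, mulD_gen, if_pos rfl, partial_vert k hg]
    rw [h1]
    exact ⟨hg, h⟩
  have hmul : ∀ k l c, k ≠ l → l ≠ c → k ≠ c → ∀ f ∈ evenPoly F p n t, ∀ g ∈ evenPoly F p n t,
      vertCoeff φ k c (f ⋆ g) = vertCoeff φ k l f ⋆ g + f ⋆ vertCoeff φ l c g := by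
    intro k l c hkl hlc hkc f hf g hg
    have h1 := hφ.map_lie _ (vert_mem_evenS h2 hf hkl) _ (vert_mem_evenS h2 hg hlc)
    obtain ⟨h4, h5⟩ := hP k l hkl f hf
    obtain ⟨h6, h7⟩ := hP l c hlc g hg
    obtain ⟨h8, h9⟩ := hP k c hkc _ (mul_mem_evenPoly hf hg)
    rw [lie_xi_partial_xi_partial hkc hf hg, h5, h7, h9, lie_xi_partial_xi_partial hkc h4 hg,
      lie_xi_partial_xi_partial hkc hf h6, ← map_add, ← LinearMap.add_apply, ← map_add] at h1
    exact eq_of_vert_eq h8 (Submodule.add_mem _ (mul_mem_evenPoly h4 hg) (mul_mem_evenPoly hf h6))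
      h1
  have hone : ∀ k l, k ≠ l → vertCoeff φ k l (one F p n t) = 0 := by
    intro k l hkl
    rw [vertCoeff_apply, one_mul', hφ.xi_partial_eq k l hkl, LinearMap.zero_apply, map_zero]
  obtain ⟨x, hx⟩ := offDiag_const hn P (fun k l c hkl hkc => by
      by_cases hlc : l = c
      · rw [hlc]
      funext f
      have := hmul k l c hkl hlc hkc f f.2 _ one_mem_evenPoly
      rw [mul_one', mul_one', hone l c hlc, map_zero, add_zero] at this
      exact this.symm) (fun k l c hkl hcl => by
      by_cases hkc : k = c
      · rw [hkc]
      funext f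
      have := hmul k c l hkc hcl hkl _ one_mem_evenPoly f f.2
      rw [one_mul', one_mul', hone k c hkc, map_zero, LinearMap.zero_apply, zero_add] at this
      exact this)
  let a : Fin n := ⟨0, by omega⟩
  let b : Fin n := ⟨1, by omega⟩
  have hab : a ≠ b := by simp [a, b]
  have hall : ∀ k l, k ≠ l → ∀ f ∈ evenPoly F p n t, vertCoeff φ k l f = vertCoeff φ a b f :=
    fun k l hkl f hf => congrFun ((hx k l hkl).trans (hx a b hab).symm) ⟨f, hf⟩
  have hpart : ∀ f ∈ evenPoly F p n t, ∀ i,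
      vertCoeff φ a b (𝔡 (Sum.inl i) f) = 𝔡 (Sum.inl i) (vertCoeff φ a b f) := by
    intro f hf i
    have h1 := hφ.map_lie _ (partial_inl_mem_evenS a i) _ (vert_mem_evenS h2 hf hab)
    obtain ⟨h4, h5⟩ := hP a b hab f hf
    obtain ⟨h6, h7⟩ := hP a b hab _ (partial_inl_mem_evenPoly i hf)
    rw [hφ.partial_eq, zero_lie, zero_add, h5, lie_partial_mulD, lie_partial_mulD,
      partial_inl_mul_oddPoly i f (xi_mem_oddPoly a), partial_inl_mul_oddPoly i _ (xi_mem_oddPoly a),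
      h7] at h1
    exact eq_of_vert_eq h6 (partial_inl_mem_evenPoly i h4) h1
  refine ⟨vertCoeff φ a b, fun f hf => (hP a b hab f hf).1, fun f hf k l hkl => ?_,
    fun f hf g hg => ?_, hpart, fun i => ?_⟩
  · rw [(hP k l hkl f hf).2, hall k l hkl f hf]
  · obtain ⟨c, hca, hcb⟩ := exists_ne_ne hn a b
    rw [← hall a c hca.symm f hf, ← hall c b hcb g hg]
    exact hmul a c b hca.symm hcb hab f hf g hg
  · obtain ⟨c, hca, hcb⟩ := exists_ne_ne hn a b
    have hg := gen_mem_evenPoly (F := F) (p := p) (n := n) (t := t) i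
    obtain ⟨h4, h5⟩ := hP a b hab _ hg
    have hodd : vertCoeff φ a b (gen F p n t (Sum.inl i)) ∈ oddPoly F p n t :=
      mem_oddPoly.2 fun j => by
        rw [← hpart _ hg, partial_gen]
        split_ifs
        · exact hone a b hab
        · exact map_zero _
    have h6 : ∀ g ∈ evenPoly F p n t, ∀ w : F, hField F p t i c g = w • g →
        ⁅hField F p t i c, mulD F p n t (Sum.inr b) (g ⋆ ξ a)⁆ =
          w • mulD F p n t (Sum.inr b) (g ⋆ ξ a) := by
      intro g hg w hw
      rw [lie_hField_mulD (w := w) ?_ (vert_mem_homog hg a)]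
      · simp [hcb]
      · rw [evenField_mul (hField_mem_evenFields i c), hw, hField_gen]
        simp [hca]
    -- The image of x_i is a constant. For c outside {a, b}, a constant times ξ_a D_b has weight 0
    -- under h_ic, whereas x_i ξ_a D_b has weight 1.
    have h7 := hφ.lie_hField_map hφ.hField_eq (vert_mem_evenS h2 hg hab)
      (h6 _ hg 1 (by rw [hField_gen]; simp))
    rw [h5, h6 _ h4 0, zero_smul, one_smul] at h7
    · refine eq_of_vert_eq (l := b) (k := a) h4 (Submodule.zero_mem _) ?_
      rw [← h7, map_zero, LinearMap.zero_apply, map_zero]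
    · rw [hField, LinearMap.add_apply, mulD_apply, mulD_apply, mem_oddPoly.1 hodd,
        mem_evenPoly.1 h4, map_zero, map_zero, zero_smul, add_zero]

/-- A normalized derivation that also kills the fields `f ξ_k D_l`. -/
structure IsReduced (φ : Module.End F (Alg F p n t) →ₗ[F] Module.End F (Alg F p n t)) : Prop
    extends IsNormalized φ where
  vert_eq : ∀ f ∈ evenPoly F p n t, ∀ k l, k ≠ l → φ (mulD F p n t (Sum.inr l) (f ⋆ ξ k)) = 0

theorem IsHigherPartial.map_one_eq_zero {j : Module.End F (Alg F p n t)} (hj : IsHigherPartial j) :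
    j (one F p n t) = 0 :=
  derivation_one hj.map_mul

/-- The element j kills 1, the variables and their pairwise odd products, so subtracting ad j does
not disturb the earlier normalization. -/
theorem IsNormalized.exists_isReduced (hφ : IsNormalized φ) (hm : 3 ≤ m) (hn : 3 ≤ n)
    (h2 : (2 : F) ≠ 0) (h3 : (3 : F) ≠ 0) : ∃ j ∈ spanJ F p n t, IsReduced (φ - adEnd j) := by
  obtain ⟨δ, h4, h5, h6, h7, h8⟩ := hφ.exists_vertCoeff hm hn h2 h3
  obtain ⟨j, hj, hjδ⟩ := exists_mem_spanJ h4 h6 h7 h8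
  have hj' := isHigherPartial_of_mem hj
  have h9 : ∀ r g, j g = 0 → φ (mulD F p n t r g) = 0 →
      (φ - adEnd j) (mulD F p n t r g) = 0 := by
    intro r g hg hr
    rw [LinearMap.sub_apply, hr, adEnd_apply, hj'.lie_mulD, hg, map_zero, sub_zero]
  refine ⟨j, hj, ⟨⟨hφ.sub_adEnd fun _ hE => hj'.lie_mem_evenFields hE, fun i => ?_, fun i k => ?_,
    fun k l hkl => h9 _ _ (hj'.map_gen _) (hφ.xi_partial_eq k l hkl),
    fun i k hik => h9 _ _ (hj'.map_gen _) (hφ.x_partial_eq i k hik),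
    fun a b hab i => h9 _ _ ?_ (hφ.pair_eq a b hab i)⟩, fun f hf k l hkl => ?_⟩⟩
  · rw [partialD_eq_mulD]
    refine h9 _ _ hj'.map_one_eq_zero ?_
    rw [← partialD_eq_mulD]
    exact hφ.partial_eq i
  · rw [LinearMap.sub_apply, hφ.hField_eq, adEnd_apply, hField, lie_add, hj'.lie_mulD,
      hj'.lie_mulD, hj'.map_gen, hj'.map_gen, map_zero, map_zero, add_zero, sub_zero]
  · rw [hj'.map_mul, hj'.map_gen, hj'.map_gen, map_zero, map_zero, LinearMap.zero_apply, add_zero]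
  · rw [LinearMap.sub_apply, h5 f hf k l hkl, adEnd_apply, hj'.lie_mulD, hj'.map_mul, hj'.map_gen,
      map_zero, add_zero, hjδ f hf, sub_self]

end

/-! ### Vanishing of reduced derivations -/

section

variable [CharP F p] [Fact p.Prime] [Fact (∀ i, 1 ≤ t i)]
  {φ : Module.End F (Alg F p n t) →ₗ[F] Module.End F (Alg F p n t)}

theorem coeffAt_xi_mul_of_notMem {a : Fin n} {u : Finset (Fin n)} (ha : a ∉ u) (α : Fin m → ℕ)
    (f : Alg F p n t) : coeffAt α u (ξ a ⋆ f) = 0 := by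
  induction f using alg_ind with
  | zero => simp
  | add f g hf hg => rw [map_add, map_add, hf, hg, add_zero]
  | smul c f hf => rw [map_smul, map_smul, hf, smul_zero]
  | mon β hβ v =>
    rw [xi_mul_mon]
    split_ifs
    · exact map_zero _
    · rw [map_smul, coeffAt_mon hβ, if_neg, smul_zero]
      rintro ⟨-, rfl⟩
      exact ha (Finset.mem_insert_self a v)

theorem lie_mem_evenS_of_mem {E E' : Module.End F (Alg F p n t)} (hE : E ∈ evenS F p n t)
    (hE' : E' ∈ evenS F p n t) : ⁅E, E'⁆ ∈ evenS F p n t := by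
  obtain ⟨h3, h4⟩ := mem_evenSbar.1 (evenS_le_evenSbar hE)
  exact lie_mem_evenS (c := 0) h3 (by rw [h4, zero_smul]) hE'

theorem IsReduced.verticalClosed (hφ : IsReduced φ) (hn : 3 ≤ n) (h2 : (2 : F) ≠ 0) :
    VerticalClosed (evenS F p n t ⊓ LinearMap.ker φ) where
  lie_mem E E' hE hE' := by
    have h3 : φ E = 0 := hE.2
    have h4 : φ E' = 0 := hE'.2
    refine ⟨lie_mem_evenS_of_mem hE.1 hE'.1, ?_⟩
    change φ ⁅E, E'⁆ = 0
    rw [hφ.map_lie E hE.1 E' hE'.1, h3, h4, zero_lie, lie_zero, add_zero]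
  vert_mem f hf a b hab := ⟨vert_mem_evenS h2 hf hab, hφ.vert_eq f hf a b hab⟩
  pair_mem a b hab i := ⟨pair_mem_evenS hn a b i, hφ.pair_eq a b hab i⟩

theorem cField_evenPoly_mem_evenS {f : Alg F p n t} (hf : f ∈ evenPoly F p n t) (i : Fin m)
    (k : Fin n) : cField f i k ∈ evenS F p n t :=
  cField_mem_evenS (evenPoly_le_homog hf) (mem_evenPoly.1 hf k) i

/-- The two fields differ by D_i(f)(ξ_k D_k - ξ_l D_l), a bracket of two killed fields. Hence the
odd index can be chosen freely in what follows. -/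
theorem IsReduced.map_cField_eq (hφ : IsReduced φ) (h2 : (2 : F) ≠ 0) {f : Alg F p n t}
    (hf : f ∈ evenPoly F p n t) (i : Fin m) (k l : Fin n) :
    φ (cField f i k) = φ (cField f i l) := by
  by_cases hkl : k = l
  · rw [hkl]
  have hf' := partial_inl_mem_evenPoly i hf
  have hf0 := evenPoly_le_homog hf'
  have h1 : cField f i k - cField f i l =
      ⁅mulD F p n t (Sum.inr l) (𝔡 (Sum.inl i) f ⋆ ξ k), mulD F p n t (Sum.inr k) (ξ l)⁆ := by
    rw [even_mul_comm hf0, lie_mulD_xi_mul hf0 (mem_evenPoly.1 hf' k), cField, cField,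
      even_mul_comm hf0, even_mul_comm hf0]
    abel
  rw [← sub_eq_zero, ← map_sub, h1, hφ.map_lie _ (vert_mem_evenS h2 hf' hkl) _
    (xi_partial_mem_evenS h2 (Ne.symm hkl)), hφ.vert_eq _ hf' k l hkl,
    hφ.xi_partial_eq l k (Ne.symm hkl), zero_lie, lie_zero, add_zero]

theorem lie_cField_mulD_of_oddPoly {f y : Alg F p n t} (hf : f ∈ evenPoly F p n t)
    (hy : y ∈ oddPoly F p n t) (hy0 : y ∈ homog F p n t 0) {k : Fin n}
    (hyk : 𝔡 (Sum.inr k) y = 0) (i j : Fin m) :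
    ⁅cField f i k, mulD F p n t (Sum.inl j) y⁆ = -cField (𝔡 (Sum.inl j) f ⋆ y) i k := by
  have hf0 := evenPoly_le_homog hf
  have hf' := partial_inl_mem_evenPoly i hf
  have h1 : ⁅mulD F p n t (Sum.inl i) f, mulD F p n t (Sum.inl j) y⁆ =
      -mulD F p n t (Sum.inl i) (𝔡 (Sum.inl j) f ⋆ y) := by
    rw [lie_mulD_mulD hf0 hy0, mem_oddPoly.1 hy, map_zero, map_zero, zero_sub, even_mul_comm hy0]
  have h2 : ⁅mulD F p n t (Sum.inr k) (𝔡 (Sum.inl i) f ⋆ ξ k), mulD F p n t (Sum.inl j) y⁆ =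
      -mulD F p n t (Sum.inr k) (𝔡 (Sum.inl i) (𝔡 (Sum.inl j) f ⋆ y) ⋆ ξ k) := by
    rw [lie_mulD_mulD (vert_mem_homog hf' k) hy0, hyk, map_zero, map_zero, zero_sub,
      partial_inl_mul_oddPoly j _ (xi_mem_oddPoly k), partial_inl_mul_oddPoly i _ hy,
      partial_inl_comm j i, even_mul_comm hy0, alg_mul_assoc, alg_mul_assoc,
      even_mul_comm hy0 (gen F p n t (Sum.inr k))]
  rw [cField, cField, add_lie, h1, h2, neg_add]

theorem lie_cField_pair {f : Alg F p n t} (hf : f ∈ evenPoly F p n t) {a b k : Fin n}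
    (hka : k ≠ a) (hkb : k ≠ b) (i j : Fin m) :
    ⁅cField f i k, mulD F p n t (Sum.inl j) (ξ a ⋆ ξ b)⁆ =
      -cField (𝔡 (Sum.inl j) f ⋆ (ξ a ⋆ ξ b)) i k := by
  refine lie_cField_mulD_of_oddPoly hf (mul_mem_oddPoly (xi_mem_oddPoly a) (xi_mem_oddPoly b))
    (odd_mul_odd_mem (xi_mem_homog a) (xi_mem_homog b)) ?_ i j
  rw [partial_inr_xi_mul, if_neg hka, partial_inr_xi_of_ne hkb, map_zero, sub_zero]

/-- After changing the odd index to b, the bracket of the `cField` with g ξ_a D_b is again a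
vertical field, and all vertical fields are killed. -/
theorem IsReduced.lie_map_cField_vert (hφ : IsReduced φ) (h2 : (2 : F) ≠ 0) {f g : Alg F p n t}
    (hf : f ∈ evenPoly F p n t) (hg : g ∈ evenPoly F p n t) (i : Fin m) (k : Fin n) {a b : Fin n}
    (hab : a ≠ b) : ⁅φ (cField f i k), mulD F p n t (Sum.inr b) (g ⋆ ξ a)⁆ = 0 := by
  have h1 := hφ.map_lie _ (cField_evenPoly_mem_evenS hf i b) _ (vert_mem_evenS h2 hg hab)
  have h3 := lie_cField_mulD hf hg (mon_mem_oddPoly ∅) one_mem_homog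
    (mem_evenPoly.1 one_mem_evenPoly b) hab.symm i
  rw [← one, mul_one', one_mul'] at h3
  rw [h3, hφ.vert_eq _ (Submodule.sub_mem _ (mul_mem_evenPoly hf (partial_inl_mem_evenPoly i hg))
    (mul_mem_evenPoly hg (partial_inl_mem_evenPoly i hf))) a b hab, hφ.vert_eq g hg a b hab,
    lie_zero, add_zero, hφ.map_cField_eq h2 hf i b k] at h1
  exact h1.symm

/-- With an odd index outside {a, b}, the bracket is a `cField` on D_j(f) ξ_a ξ_b, which already
lies in the closed space generated by killed fields. -/
theorem IsReduced.lie_map_cField_pair (hφ : IsReduced φ) (hn : 3 ≤ n) (h2 : (2 : F) ≠ 0)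
    {f : Alg F p n t} (hf : f ∈ evenPoly F p n t) (i j : Fin m) (k : Fin n) {a b : Fin n}
    (hab : a ≠ b) : ⁅φ (cField f i k), mulD F p n t (Sum.inl j) (ξ a ⋆ ξ b)⁆ = 0 := by
  obtain ⟨c, hca, hcb⟩ := exists_ne_ne hn a b
  have h1 := hφ.map_lie _ (cField_evenPoly_mem_evenS hf i c) _ (pair_mem_evenS hn a b j)
  have h3 : φ (cField (𝔡 (Sum.inl j) f ⋆ (ξ a ⋆ ξ b)) i c) = 0 :=
    ((hφ.verticalClosed hn h2).cField_mul_mem (xi_mem_oddPoly a) (xi_mem_homog a)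
      (partial_inr_xi_of_ne hca) hcb.symm (partial_inl_mem_evenPoly j hf) i
      ⟨pair_mem_evenS hn a c i, hφ.pair_eq a c hca.symm i⟩).2
  rw [lie_cField_pair hf hca hcb, map_neg, h3, hφ.pair_eq a b hab, lie_zero, add_zero, neg_zero,
    hφ.map_cField_eq h2 hf i c k] at h1
  exact h1.symm

theorem lie_oddTorus_cField (c d : Fin n) {f : Alg F p n t} (hf : f ∈ evenPoly F p n t)
    (i : Fin m) (k : Fin n) : ⁅oddTorus F p t c d, cField f i k⁆ = 0 := by
  rw [cField, lie_add, lie_oddTorus_vert c d (partial_inl_mem_evenPoly i hf), sub_self, zero_smul,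
    lie_diag_mulD (s := Sum.inl i) (w := 0) (oddTorus_mem_evenFields c d) (oddTorus_gen c d) ?_
      (evenPoly_le_homog hf)]
  · simp
  · rw [oddTorus_evenPoly c d hf, zero_smul]

/-- The centralizer of the fields `g ξ_a D_b` and `ξ_a ξ_b D_j`. -/
theorem gen_of_centralizes_vert (hm : 3 ≤ m) (hn : 3 ≤ n) (h2 : (2 : F) ≠ 0)
    {E : Module.End F (Alg F p n t)} (hE : E ∈ evenFields F p n t)
    (hT : ∀ c d : Fin n, ⁅oddTorus F p t c d, E⁆ = 0)
    (hv : ∀ g ∈ evenPoly F p n t, ∀ a b, a ≠ b → ⁅E, mulD F p n t (Sum.inr b) (g ⋆ ξ a)⁆ = 0)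
    (hp : ∀ a b, a ≠ b → ∀ j, ⁅E, mulD F p n t (Sum.inl j) (ξ a ⋆ ξ b)⁆ = 0) :
    (∀ l, E (ξ l) = 0) ∧
      ∀ j α u, coeffAt α u (E (gen F p n t (Sum.inl j))) ≠ 0 → u = Finset.univ := by
  have hgen : ∀ r, ∃ g ∈ evenPoly F p n t, E (ξ r) = g ⋆ ξ r := by
    intro r
    refine exists_evenPoly_mul fun α u hne => ?_
    have hw : ∀ c, c ≠ r → r ∈ u ∧ c ∉ u := by
      intro c hc
      have h1 := weight_of_lie_oddTorus (x := 0) (by rw [hT r c, zero_smul]) hne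
      simp [hc] at h1
      split_ifs at h1 <;> grind
    obtain ⟨c, hc, -⟩ := exists_ne_ne hn r r
    ext d
    rw [Finset.mem_singleton]
    refine ⟨fun hd => ?_, fun hd => hd ▸ (hw c hc).1⟩
    by_contra hdr
    exact (hw d hdr).2 hd
  choose g hg hg' using hgen
  have hv' : ∀ f ∈ evenPoly F p n t, ∀ a b, a ≠ b →
      E f ⋆ ξ a + f ⋆ (g a ⋆ ξ a) = f ⋆ (g b ⋆ ξ a) := by
    intro f hf a b hab
    have h1 := congrArg (fun A => A (ξ b)) (hv f hf a b hab)
    simp only [lie_mulD_gen, if_true, evenField_mul hE, hg', partial_vert b (hg b),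
      LinearMap.zero_apply, sub_eq_zero] at h1
    rw [h1, alg_mul_assoc, even_mul_comm (evenPoly_le_homog (hg b))]
  have hgg : ∀ a b, a ≠ b → g a = g b := by
    intro a b hab
    have h1 := hv' _ one_mem_evenPoly a b hab
    rw [evenField_map_one hE, map_zero, LinearMap.zero_apply, zero_add, one_mul', one_mul'] at h1
    rw [← partial_vert a (hg a), h1, partial_vert a (hg b)]
  -- Commuting with x_j ξ_a D_b, once g_a = g_b, gives E(x_j) ξ_a = 0; so E(x_j) is divisible by
  -- every ξ_a, that is, by ξ_1⋯ξ_n.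
  have hxi : ∀ a j, E (gen F p n t (Sum.inl j)) =
      ξ a ⋆ 𝔡 (Sum.inr a) (E (gen F p n t (Sum.inl j))) := by
    intro a j
    obtain ⟨b, hb, -⟩ := exists_ne_ne hn a a
    have h1 := hv' _ (gen_mem_evenPoly j) a b hb.symm
    have h0 : E (gen F p n t (Sum.inl j)) ∈ homog F p n t 0 :=
      evenField_mem_homog hE (mon_empty_mem_homog _)
    rw [hgg a b hb.symm, add_eq_right, even_mul_comm h0] at h1
    have h3 := partial_inr_xi_mul a a (E (gen F p n t (Sum.inl j)))
    rw [h1, map_zero, if_pos rfl, eq_comm, sub_eq_zero] at h3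
    exact h3
  refine ⟨fun l => ?_, fun j α u hne => ?_⟩
  · obtain ⟨b, hb, -⟩ := exists_ne_ne hn l l
    let j : Fin m := ⟨0, by omega⟩
    have h1 := congrArg (fun A => A (gen F p n t (Sum.inl j))) (hp l b hb.symm j)
    -- Divisibility of E(x_j) by ξ_l removes this term, and the commutation with ξ_l ξ_b D_j becomes
    -- 2 g_l ξ_l ξ_b = 0.
    have h3 : gen F p n t (Sum.inr l) ⋆ ξ b ⋆ 𝔡 (Sum.inl j) (E (gen F p n t (Sum.inl j))) = 0 := by
      rw [hxi l j, partial_inl_xi_mul, xi_mul_comm, map_neg, LinearMap.neg_apply, alg_mul_assoc,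
        xi_mul_xi_mul, map_zero, neg_zero]
    have hg0 := evenPoly_le_homog (hg l)
    simp only [lie_mulD_gen, if_true, h3, sub_zero, LinearMap.zero_apply, evenField_mul hE, hg',
      ← hgg l b hb.symm, mul_left_comm_of_even hg0, alg_mul_assoc, ← two_smul F] at h1
    have h4 := (smul_eq_zero.1 h1).resolve_left h2
    have h5 := congrArg (fun x => 𝔡 (Sum.inr b) (𝔡 (Sum.inr l) x)) h4
    simp only [partial_inr_evenPoly_mul _ (hg l), partial_inr_xi_mul, if_true,
      partial_inr_xi_of_ne hb.symm, map_zero, sub_zero, partial_gen, mul_one'] at h5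
    rw [hg', h5, map_zero, LinearMap.zero_apply]
  · rw [Finset.eq_univ_iff_forall]
    intro a
    by_contra ha
    rw [hxi a j, coeffAt_xi_mul_of_notMem ha] at hne
    exact hne rfl

theorem lie_partial_cField (i j : Fin m) (k : Fin n) (f : Alg F p n t) :
    ⁅partialD F p n t (Sum.inl j), cField f i k⁆ = cField (𝔡 (Sum.inl j) f) i k := by
  rw [cField, cField, lie_add, lie_partial_mulD, lie_partial_mulD,
    partial_inl_mul_oddPoly j _ (xi_mem_oddPoly k), partial_inl_comm]

theorem lie_hField_cField {i a : Fin m} {k c : Fin n} {f : Alg F p n t}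
    (hf : f ∈ evenPoly F p n t) {w : F} (hw : hField F p t a c f = w • f) :
    ⁅hField F p t a c, cField f i k⁆ = (w - if a = i then 1 else 0) • cField f i k := by
  have hh := hField_mem_evenFields (F := F) (p := p) (t := t) a c
  have h1 : hField F p t a c (𝔡 (Sum.inl i) f) =
      (w - if a = i then 1 else 0) • 𝔡 (Sum.inl i) f := by
    have := congrArg (fun A => A f) (lie_diag_partial hh (hField_gen a c) i)
    simp only [end_lie_apply, hw, map_smul, LinearMap.smul_apply, Sum.inl.injEq, reduceCtorEq,
      if_false, add_zero] at this
    rw [sub_smul, sub_eq_add_neg (w • _), ← neg_smul, ← this]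
    abel
  have h2 : hField F p t a c (𝔡 (Sum.inl i) f ⋆ ξ k) =
      ((w - if a = i then 1 else 0) + if c = k then 1 else 0) • (𝔡 (Sum.inl i) f ⋆ ξ k) := by
    rw [evenField_mul hh, h1, hField_gen, map_smul, map_smul, LinearMap.smul_apply]
    simp only [reduceCtorEq, Sum.inr.injEq, if_false, zero_add]
    rw [← add_smul]
  rw [cField, lie_add, smul_add, lie_hField_mulD (s := Sum.inl i) hw (evenPoly_le_homog hf),
    lie_hField_mulD (s := Sum.inr k) h2 (vert_mem_homog (partial_inl_mem_evenPoly i hf) k)]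
  simp

theorem hField_mon (a : Fin m) (c : Fin n) {β : Fin m → ℕ} (hβ : ∀ i, β i < p ^ t i) :
    hField F p t a c (mon F p n t β ∅) = (β a : F) • mon F p n t β ∅ := by
  rw [hField, LinearMap.add_apply, mulD_apply, mulD_apply, gen_mul_partial_mon a hβ,
    mem_evenPoly.1 (mon_mem_evenPoly β), map_zero, add_zero]

theorem lie_x_partial_cField {a l i : Fin m} (hai : a ≠ i) (k : Fin n) {f : Alg F p n t}
    (hf : f ∈ evenPoly F p n t) :
    ⁅mulD F p n t (Sum.inl l) (gen F p n t (Sum.inl a)), cField f i k⁆ =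
      cField (gen F p n t (Sum.inl a) ⋆ 𝔡 (Sum.inl l) f) i k := by
  have hg0 := evenPoly_le_homog (gen_mem_evenPoly (F := F) (p := p) (n := n) (t := t) a)
  have h1 : 𝔡 (Sum.inl i) (gen F p n t (Sum.inl a)) = 0 := by
    rw [partial_gen, if_neg (by simpa using hai.symm)]
  rw [cField, lie_add, lie_mulD_mulD hg0 (evenPoly_le_homog hf),
    lie_mulD_mulD hg0 (vert_mem_homog (partial_inl_mem_evenPoly i hf) k), h1,
    mem_evenPoly.1 (gen_mem_evenPoly a), map_zero, map_zero, map_zero, map_zero, sub_zero,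
    sub_zero, partial_inl_mul_oddPoly l _ (xi_mem_oddPoly k), ← alg_mul_assoc, cField,
    partial_inl_mul i, h1, map_zero, LinearMap.zero_apply, zero_add, partial_inl_comm l i]

/-- The image centralizes the killed fields and the D_j, so it is a combination of the ξ_1⋯ξ_n D_j.
Such a field has weight 1 - δ_aj under h_ac, which must equal the weight β_a - δ_ai of the argument.
-/
theorem IsReduced.weight_of_map_cField_ne_zero (hφ : IsReduced φ) (hm : 3 ≤ m) (hn : 3 ≤ n)
    (h2 : (2 : F) ≠ 0) {β : Fin m → ℕ} (hβ : ∀ i, β i < p ^ t i) {i : Fin m} {k : Fin n}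
    (hpart : ∀ j, φ (cField (𝔡 (Sum.inl j) (mon F p n t β ∅)) i k) = 0)
    (hne : φ (cField (mon F p n t β ∅) i k) ≠ 0) :
    ∃ j, ∀ a, (1 : F) - (if a = j then 1 else 0) = (β a : F) - if a = i then 1 else 0 := by
  have hf := mon_mem_evenPoly (F := F) (p := p) (n := n) (t := t) β
  have hS := cField_evenPoly_mem_evenS hf i k
  have hE := hφ.map_mem _ hS
  obtain ⟨hxi, hx⟩ := gen_of_centralizes_vert hm hn h2 hE
    (fun c d => by
      have := hφ.lie_oddTorus_map hm hφ.hField_eq hS (c := c) (d := d) (x := 0)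
        (by rw [lie_oddTorus_cField c d hf, zero_smul])
      rwa [zero_smul] at this)
    (fun g hg a b hab => hφ.lie_map_cField_vert h2 hf hg i k hab)
    (fun a b hab j => hφ.lie_map_cField_pair hn h2 hf i j k hab)
  have hV := hφ.map_gen_mem_oddPoly hn hφ.partial_eq hS fun j => by
    rw [lie_partial_cField, hpart]
  obtain ⟨s, α, u, hc⟩ := exists_coeffAt_ne_zero hE hne
  rcases s with j | l
  · refine ⟨j, fun a => ?_⟩
    have hα := eq_zero_of_coeffAt_ne_zero (hV _) hc
    have hu := hx j α u hc
    subst hα hu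
    have := weight_inl (hφ.lie_hField_map hφ.hField_eq hS
      (lie_hField_cField hf (hField_mon a ⟨0, by omega⟩ hβ))) hc
    simpa using this
  · rw [hxi, map_zero] at hc
    exact absurd rfl hc

/-- Induction on the degree. If the value at x^(β) were nonzero, then β_a = 1 in F for some a ≠ i.
Moving one unit of exponent from a to l gives γ of the same degree whose weight admits no nonzero
value, and the killed field x_a D_l carries the `cField` of x^(γ) back to that of x^(β). -/
theorem IsReduced.map_cField_mon (hφ : IsReduced φ) (hm : 3 ≤ m) (hn : 3 ≤ n)
    (h2 : (2 : F) ≠ 0) (h3 : (3 : F) ≠ 0) {β : Fin m → ℕ} (hβ : ∀ i, β i < p ^ t i) (i : Fin m)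
    (k : Fin n) : φ (cField (mon F p n t β ∅) i k) = 0 := by
  have hz : φ (cField (0 : Alg F p n t) i k) = 0 := by simp [cField]
  induction hN : ∑ i, β i using Nat.strong_induction_on generalizing β with
  | _ N ih =>
    have hpart : ∀ γ : Fin m → ℕ, (∀ i, γ i < p ^ t i) → ∑ i, γ i = N → ∀ j,
        φ (cField (𝔡 (Sum.inl j) (mon F p n t γ ∅)) i k) = 0 := by
      intro γ hγ hγN j
      rw [partial_inl_mon j hγ]
      split_ifs with h0
      · exact hz
      · refine ih (∑ l, (γ - Pi.single j 1 : Fin m → ℕ) l) ?_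
          (fun l => lt_of_le_of_lt (Nat.sub_le _ _) (hγ l)) rfl
        rw [← hγN]
        refine Finset.sum_lt_sum (fun l _ => Nat.sub_le _ _) ⟨j, Finset.mem_univ j, ?_⟩
        simp
        omega
    by_contra hne
    obtain ⟨j, hj⟩ := hφ.weight_of_map_cField_ne_zero hm hn h2 hβ (hpart β hβ hN) hne
    obtain ⟨a, hai, haj⟩ := exists_ne_ne hm i j
    obtain ⟨l, hla, hlj⟩ := exists_ne_ne hm a j
    have hβa : (β a : F) = 1 := by simpa [hai, haj] using (hj a).symm
    have hβl := hj l
    rw [if_neg hlj, sub_zero] at hβl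
    have ha0 : β a ≠ 0 := fun h => by simp [h] at hβa
    set γ : Fin m → ℕ := β - Pi.single a 1 + Pi.single l 1 with hγdef
    have hγl : γ l = β l + 1 := by simp [hγdef, hla]
    have hγ : ∀ b, γ b < p ^ t b := by
      intro b
      by_cases hbl : b = l
      · rw [hbl, hγl]
        -- If β_l + 1 were p^t_l, then β_l = -1 in F, but the weight condition makes β_l equal to 1
        -- or 2 in F.
        refine lt_of_le_of_ne (hβ l) fun h => ?_
        have h4 := congrArg (Nat.cast (R := F)) h
        have ht0 : t l ≠ 0 := Nat.one_le_iff_ne_zero.1 (Fact.out (p := ∀ i, 1 ≤ t i) l)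
        rw [Nat.cast_succ, Nat.cast_pow, CharP.cast_eq_zero F p, zero_pow ht0] at h4
        split_ifs at hβl <;> grind
      · simp only [hγdef, Pi.add_apply, Pi.single_eq_of_ne hbl, add_zero]
        exact lt_of_le_of_lt (Nat.sub_le _ _) (hβ b)
    have hγN : ∑ b, γ b = N := by
      have h4 : ∑ b, (β - Pi.single a 1 : Fin m → ℕ) b + 1 = N := by
        rw [← hN]
        conv_rhs => rw [← sub_add_single ha0]
        simp [Finset.sum_add_distrib]
      rw [← h4]
      simp [hγdef, Finset.sum_add_distrib]
    have hγ0 : φ (cField (mon F p n t γ ∅) i k) = 0 := by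
      by_contra hne'
      obtain ⟨j', hj'⟩ := hφ.weight_of_map_cField_ne_zero hm hn h2 hγ (hpart γ hγ hγN) hne'
      -- The weight condition for γ at l would read 1 - [l = j'] = 2 in F.
      have h4 := hj' l
      rw [hγl, Nat.cast_succ] at h4
      split_ifs at h4 hβl <;> grind
    have hγS := cField_evenPoly_mem_evenS (mon_mem_evenPoly (F := F) (p := p) (n := n) (t := t) γ)
      i k
    have h5 := hφ.map_lie _ (x_partial_mem_evenS k hla.symm) _ hγS
    have h6 : gen F p n t (Sum.inl a) ⋆ 𝔡 (Sum.inl l) (mon F p n t γ ∅) =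
        mon F p n t β ∅ := by
      have h7 := gen_mul_partial_mon (F := F) (n := n) a hβ ∅
      rw [hβa, one_smul, partial_inl_mon a hβ, if_neg ha0] at h7
      rw [partial_inl_mon l hγ, if_neg (by omega), hγdef, add_tsub_cancel_right, h7]
    rw [lie_x_partial_cField hai k (mon_mem_evenPoly γ), h6, hγ0,
      hφ.x_partial_eq a l hla.symm, zero_lie, lie_zero, add_zero] at h5
    exact hne h5

theorem IsReduced.eq_zero (hφ : IsReduced φ) (hm : 3 ≤ m) (hn : 3 ≤ n) (h2 : (2 : F) ≠ 0)
    (h3 : (3 : F) ≠ 0) {s : Module.End F (Alg F p n t)} (hs : s ∈ evenS F p n t) : φ s = 0 := by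
  refine ((hφ.verticalClosed hn h2).evenS_le hm hn h2 (fun g hg i k => ?_) hs).2
  refine ⟨cField_evenPoly_mem_evenS hg i k, ?_⟩
  refine evenPoly_ind (P := fun g => φ (cField g i k) = 0) hg ?_ (fun f g hf hg => ?_)
    (fun c f hf => ?_) fun β hβ => hφ.map_cField_mon hm hn h2 h3 hβ i k
  · simp [cField]
  · have : cField (f + g) i k = cField f i k + cField g i k := by
      simp only [cField, map_add, LinearMap.add_apply]
      abel
    rw [this, map_add, hf, hg, add_zero]
  · rw [cField_smul, map_smul, hf, smul_zero]

/-- Every derivation of `𝒮` with values in the even vector fields is the restriction of an inner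
derivation by an even vector field plus an element of `𝒥`. -/
theorem IsSDer.exists_eq_lie (hφ : IsSDer φ) (hm : 3 ≤ m) (hn : 3 ≤ n) (h2 : (2 : F) ≠ 0)
    (h3 : (3 : F) ≠ 0) : ∃ E ∈ evenFields F p n t, ∃ j ∈ spanJ F p n t,
      ∀ s ∈ evenS F p n t, φ s = ⁅E + j, s⁆ := by
  obtain ⟨E, hE, hN⟩ := hφ.exists_isNormalized hm hn h2 h3
  obtain ⟨j, hj, hR⟩ := hN.exists_isReduced hm hn h2 h3
  refine ⟨E, hE, j, hj, fun s hs => ?_⟩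
  have := hR.eq_zero hm hn h2 h3 hs
  rwa [sub_adEnd_sub_adEnd, LinearMap.sub_apply, sub_eq_zero, adEnd_apply] at this

end

/-! ### Outer derivations -/

section

variable {R L : Type*} [CommRing R] [LieRing L] [LieAlgebra R L] {S T : LieSubalgebra R L}

/-- The derivation of `S` induced by an element that normalizes `S`. -/
def adOn (h : ∀ x ∈ T, ∀ s ∈ S, ⁅x, s⁆ ∈ S) (x : T) : LieDerivation R S S where
  toFun s := ⟨⁅(x : L), (s : L)⁆, h x x.2 s s.2⟩
  map_add' a b := Subtype.ext (lie_add _ _ _)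
  map_smul' c a := Subtype.ext (lie_smul _ _ _)
  leibniz' a b := Subtype.ext <| by
    change ⁅(x : L), ⁅(a : L), (b : L)⁆⁆ = ⁅(a : L), ⁅(x : L), (b : L)⁆⁆ - ⁅(b : L), ⁅(x : L), (a : L)⁆⁆
    rw [leibniz_lie, ← lie_skew ⁅(x : L), (a : L)⁆]
    abel

/-- The homomorphism to the outer derivations of `S` from a subalgebra that normalizes `S`. -/
def outerOn (h : ∀ x ∈ T, ∀ s ∈ S, ⁅x, s⁆ ∈ S) : T →ₗ⁅R⁆ OuterDer R S where
  toFun x := LieSubmodule.Quotient.mk (adOn h x)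
  map_add' x y := by
    change _ = LieSubmodule.Quotient.mk (N := innerDer R S) (adOn h x + adOn h y)
    congr 1
    exact LieDerivation.ext fun s => Subtype.ext (add_lie _ _ _)
  map_smul' c x := by
    change _ = LieSubmodule.Quotient.mk (N := innerDer R S) (c • adOn h x)
    congr 1
    exact LieDerivation.ext fun s => Subtype.ext (smul_lie _ _ _)
  map_lie' {x y} := by
    rw [← LieSubmodule.Quotient.mk_bracket]
    congr 1
    refine LieDerivation.ext fun s => Subtype.ext ?_
    rw [LieDerivation.commutator_apply]
    exact lie_lie (x : L) (y : L) (s : L)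

theorem outerOn_apply (h : ∀ x ∈ T, ∀ s ∈ S, ⁅x, s⁆ ∈ S) (x : T) :
    outerOn h x = LieSubmodule.Quotient.mk (adOn h x) := rfl

/-- The first isomorphism theorem for T → Der(S)/ad S. If ad x agrees on S with ad s, then x - s
centralizes S, so x = s and the kernel is exactly S. -/
theorem exists_outerDer_equiv (hle : S ≤ T) (h : ∀ x ∈ T, ∀ s ∈ S, ⁅x, s⁆ ∈ S)
    (hcent : ∀ x ∈ T, (∀ s ∈ S, ⁅x, s⁆ = 0) → x = 0)
    (hsurj : ∀ d : LieDerivation R S S, ∃ x ∈ T, ∀ s : S, ((d s : S) : L) = ⁅x, (s : L)⁆) :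
    ∃ I : LieIdeal R T, (∀ x : T, x ∈ I ↔ (x : L) ∈ S) ∧
      ∃ e : (T ⧸ I) ≃ₗ⁅R⁆ OuterDer R S, ∀ (x : T) (d : LieDerivation R S S),
        (∀ s : S, ((d s : S) : L) = ⁅(x : L), (s : L)⁆) →
          e (LieSubmodule.Quotient.mk x) = LieSubmodule.Quotient.mk d := by
  have hrange : (outerOn h).range = ⊤ := by
    rw [LieHom.range_eq_top]
    intro y
    obtain ⟨d, rfl⟩ := LieSubmodule.Quotient.surjective_mk' _ y
    obtain ⟨x, hx, hd⟩ := hsurj d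
    refine ⟨⟨x, hx⟩, ?_⟩
    have : adOn h ⟨x, hx⟩ = d := LieDerivation.ext fun s => Subtype.ext (hd s).symm
    rw [outerOn_apply, this]
    rfl
  have had : ∀ s a : S, ((LieDerivation.ad R S s a : S) : L) = ⁅(s : L), (a : L)⁆ := fun s a =>
    lie_skew (s : L) (a : L)
  refine ⟨(outerOn h).ker, fun x => ?_, (outerOn h).quotKerEquivRange.trans
    ((LieEquiv.ofEq _ _ (congrArg _ hrange)).trans LieSubalgebra.topEquiv), fun x d hd => ?_⟩
  · rw [LieHom.mem_ker, outerOn_apply, LieSubmodule.Quotient.mk_eq_zero']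
    constructor
    · rintro ⟨s, hs⟩
      have h1 := hcent _ (T.sub_mem x.2 (hle s.2)) fun a ha => by
        have := congrArg (fun D => ((D ⟨a, ha⟩ : S) : L)) hs
        rw [sub_lie, sub_eq_zero]
        exact (this.symm.trans (had s ⟨a, ha⟩))
      rw [sub_eq_zero.1 h1]
      exact s.2
    · intro hx
      exact ⟨⟨x, hx⟩, LieDerivation.ext fun s => Subtype.ext (had ⟨x, hx⟩ s)⟩
  · have : adOn h x = d := LieDerivation.ext fun s => Subtype.ext (hd s).symm
    rw [← this]
    rfl

end

/-! ### The normalizer and the centralizer of `𝒮` -/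

section

variable [CharP F p] [Fact p.Prime] [Fact (∀ i, 1 ≤ t i)]

/-- Since 𝒮 is divergence-free, div [E, s] = -s(div E), so 𝒮 annihilates div E. The D_i exclude the
even variables, and h_ik, of weight 1 on a monomial in the ξ's containing ξ_k, excludes ξ_k. -/
theorem exists_dv_eq_smul_one (hm : 3 ≤ m) (hn : 3 ≤ n) {E : Module.End F (Alg F p n t)}
    (hE : E ∈ evenFields F p n t) (h : ∀ s ∈ evenS F p n t, ⁅E, s⁆ ∈ evenS F p n t) :
    ∃ c : F, dv F p n t E = c • one F p n t := by
  have h0 : ∀ s ∈ evenS F p n t, s (dv F p n t E) = 0 := by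
    intro s hs
    have h1 := (mem_evenSbar.1 (evenS_le_evenSbar (h s hs))).2
    rwa [dv_lie hE (evenS_le_evenFields hs), (mem_evenSbar.1 (evenS_le_evenSbar hs)).2, map_zero,
      zero_sub, neg_eq_zero] at h1
  refine exists_smul_mon fun α u hne => ?_
  have hα := eq_zero_of_coeffAt_ne_zero (mem_oddPoly.2 fun i =>
    h0 _ (partial_inl_mem_evenS ⟨0, by omega⟩ i)) hne
  subst hα
  refine ⟨rfl, Finset.eq_empty_of_forall_notMem fun k hk => ?_⟩
  have h1 := congrArg (coeffAt 0 u) (h0 _ (hField_mem_evenS ⟨0, by omega⟩ k))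
  rw [hField, LinearMap.add_apply, mulD_apply, mulD_apply, map_add, coeffAt_gen_mul_partial,
    coeffAt_gen_mul_partial, map_zero] at h1
  simp [wt, hk] at h1
  exact hne h1

theorem IsHigherPartial.eq_zero {j : Module.End F (Alg F p n t)} (hj : IsHigherPartial j)
    (h : ∀ f ∈ evenPoly F p n t, j f = 0) : j = 0 := by
  refine LinearMap.ext fun f => ?_
  rw [LinearMap.zero_apply]
  induction f using xi_ind with
  | zero => exact map_zero j
  | add f g hf hg => rw [map_add, hf, hg, add_zero]
  | smul c f hf => rw [map_smul, hf, smul_zero]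
  | mon α hα => exact h _ (mon_mem_evenPoly α)
  | xi k f hf =>
    rw [hj.map_mul, hj.map_gen, hf, map_zero, map_zero, LinearMap.zero_apply, add_zero]

/-- 𝒥 commutes with the D_i, the h_ik, the ξ_k D_l and the ξ_k ξ_l D_i, so the even-field part
centralizes these and vanishes. The 𝒥-part is then detected on f ξ_k D_l, which it sends to j(f) ξ_k
D_l. -/
theorem eq_zero_of_mem_Stilde (hm : 3 ≤ m) (hn : 3 ≤ n) (h2 : (2 : F) ≠ 0)
    {E : Module.End F (Alg F p n t)} (hE : E ∈ Stilde F p n t)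
    (h : ∀ s ∈ evenS F p n t, ⁅E, s⁆ = 0) : E = 0 := by
  obtain ⟨A, hA, -, -, j, hj, rfl⟩ := (mem_Stilde ⟨0, by omega⟩).1 hE
  have hj' := isHigherPartial_of_mem hj
  have hz : ∀ s ∈ evenS F p n t, ⁅j, s⁆ = 0 → ⁅A, s⁆ = 0 := by
    intro s hs hjs
    have := h s hs
    rwa [add_lie, hjs, add_zero] at this
  have hA0 : A = 0 := by
    refine eq_zero_of_centralizes hm hn h2 hA (fun i => ?_) (fun i k => ?_) (fun k l hkl => ?_)
      fun k l hkl i => ?_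
    · rw [← lie_skew, hz _ (partial_inl_mem_evenS ⟨0, by omega⟩ i), neg_zero]
      rw [partialD_eq_mulD, hj'.lie_mulD, hj'.map_one_eq_zero, map_zero]
    · rw [← lie_skew, hz _ (hField_mem_evenS i k), neg_zero]
      rw [hField, lie_add, hj'.lie_mulD, hj'.lie_mulD, hj'.map_gen, hj'.map_gen, map_zero,
        map_zero, add_zero]
    · refine hz _ (xi_partial_mem_evenS h2 hkl) ?_
      rw [hj'.lie_mulD, hj'.map_gen, map_zero]
    · refine hz _ (pair_mem_evenS hn k l i) ?_
      rw [hj'.lie_mulD, hj'.map_mul, hj'.map_gen, hj'.map_gen, map_zero, map_zero,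
        LinearMap.zero_apply, add_zero, map_zero]
  subst hA0
  rw [zero_add] at h ⊢
  refine hj'.eq_zero fun f hf => ?_
  let k : Fin n := ⟨0, by omega⟩
  let l : Fin n := ⟨1, by omega⟩
  have hkl : k ≠ l := by simp [k, l]
  have h1 := h _ (vert_mem_evenS h2 hf hkl)
  rw [hj'.lie_mulD, hj'.map_mul, hj'.map_gen, map_zero, add_zero] at h1
  refine eq_of_vert_eq (k := k) (l := l) ?_ (Submodule.zero_mem _) ?_
  · refine mem_evenPoly.2 fun k => ?_
    rw [← hj'.partial_apply, mem_evenPoly.1 hf, map_zero]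
  · rw [h1, map_zero, LinearMap.zero_apply, map_zero]

end

variable (F p n t) in
/-- The Lie algebra `𝒮`. -/
noncomputable def evenSLie [CharP F p] [Fact p.Prime] [Fact (∀ i, 1 ≤ t i)] :
    LieSubalgebra F (Module.End F (Alg F p n t)) where
  toSubmodule := evenS F p n t
  lie_mem' := lie_mem_evenS_of_mem

variable (F p n t) in
/-- The Lie algebra `𝒮̃`. -/
noncomputable def StildeLie [CharP F p] [Fact p.Prime] [Fact (∀ i, 1 ≤ t i)] (i : Fin m) :
    LieSubalgebra F (Module.End F (Alg F p n t)) where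
  toSubmodule := Stilde F p n t
  lie_mem' := lie_mem_Stilde i

/-! ### Derivations of 𝒮 as brackets with elements of 𝒮̃ -/

theorem exists_mem_Stilde_eq_lie [CharP F p] [Fact p.Prime] [Fact (∀ i, 1 ≤ t i)] (hm : 3 ≤ m)
    (hn : 3 ≤ n) (h2 : (2 : F) ≠ 0) (h3 : (3 : F) ≠ 0)
    (d : LieDerivation F (evenSLie F p n t) (evenSLie F p n t)) :
    ∃ E ∈ Stilde F p n t, ∀ s : evenSLie F p n t, ((d s : evenSLie F p n t) :
      Module.End F (Alg F p n t)) = ⁅E, (s : Module.End F (Alg F p n t))⁆ := by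
  let i : Fin m := ⟨0, by omega⟩
  -- The linear extension beyond 𝒮 is arbitrary; it only makes it possible to subtract brackets by
  -- operators outside 𝒮 within one space of maps.
  obtain ⟨φ, hφ⟩ := LinearMap.exists_extend (p := evenS F p n t)
    ((evenS F p n t).subtype ∘ₗ (d : evenSLie F p n t →ₗ[F] evenSLie F p n t))
  have hφd : ∀ s : evenSLie F p n t, φ (s : Module.End F (Alg F p n t)) =
      (d s : evenSLie F p n t) := fun s => congrArg (fun A => A s) hφ
  have hder : IsSDer φ := by
    refine ⟨fun s hs s' hs' => ?_, fun s hs => ?_⟩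
    · have h1 := congrArg Subtype.val (d.apply_lie_eq_sub ⟨s, hs⟩ ⟨s', hs'⟩)
      have h4 := hφd ⟨s, hs⟩
      have h5 := hφd ⟨s', hs'⟩
      have h6 := hφd ⁅(⟨s, hs⟩ : evenSLie F p n t), (⟨s', hs'⟩ : evenSLie F p n t)⁆
      rw [h1] at h6
      change φ ⁅s, s'⁆ = ⁅s, ((d ⟨s', hs'⟩ : evenSLie F p n t) : Module.End F (Alg F p n t))⁆ -
        ⁅s', ((d ⟨s, hs⟩ : evenSLie F p n t) : Module.End F (Alg F p n t))⁆ at h6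
      rw [h6, ← h4, ← h5, ← lie_skew s']
      change ⁅s, φ s'⁆ - -⁅φ s, s'⁆ = _
      abel
    · have h4 := hφd ⟨s, hs⟩
      change φ s = _ at h4
      rw [h4]
      exact evenS_le_evenFields (d ⟨s, hs⟩).2
  obtain ⟨A, hA, j, hj, hd⟩ := hder.exists_eq_lie hm hn h2 h3
  -- Both A + j and j normalize 𝒮, hence so does A, which forces its divergence to be constant.
  obtain ⟨c, hc⟩ := exists_dv_eq_smul_one hm hn hA fun s hs => by
    have h1 := hd s hs
    have h4 := hφd ⟨s, hs⟩
    have h5 : φ s ∈ evenS F p n t := by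
      change φ s = _ at h4
      rw [h4]
      exact (d ⟨s, hs⟩).2
    rw [add_lie] at h1
    rw [← sub_eq_iff_eq_add.2 h1]
    exact Submodule.sub_mem _ h5 ((isHigherPartial_of_mem hj).lie_mem_evenS h2 hs)
  exact ⟨A + j, (mem_Stilde i).2 ⟨A, hA, c, hc, j, hj, rfl⟩, fun s => by
    rw [← hφd s]; exact hd s s.2⟩

end ModularCartan

open ModularCartan in
theorem proposition5p2p3 {F : Type*} [Field F] (p : ℕ) [CharP F p] (hp : 3 < p)
    {m n : ℕ} (hm : 3 ≤ m) (hn : 3 ≤ n) (t : Fin m → ℕ) (ht : ∀ i, 1 ≤ t i) :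
    ∃ (S St : LieSubalgebra F (Module.End F (Alg F p n t))) (I : LieIdeal F St),
      S.toSubmodule = evenS F p n t ∧
      St.toSubmodule = Stilde F p n t ∧
      (∀ E ∈ St, E ∈ superDer F p n t 0) ∧
      (∀ E : St, E ∈ I ↔ (E : Module.End F (Alg F p n t)) ∈ S) ∧
      (∀ E ∈ St, (∀ s ∈ S, ⁅E, s⁆ = 0) → E = 0) ∧
      ∃ e : (St ⧸ I) ≃ₗ⁅F⁆ OuterDer F S,
        ∀ (E : St) (d : LieDerivation F S S),
          (∀ s : S, ((d s : S) : Module.End F (Alg F p n t)) =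
            ⁅(E : Module.End F (Alg F p n t)), (s : Module.End F (Alg F p n t))⁆) →
          e (LieSubmodule.Quotient.mk E) = LieSubmodule.Quotient.mk d := by
  have h0 : p ≠ 0 := by omega
  have hprime : Fact p.Prime := ⟨(CharP.char_is_prime_or_zero F p).resolve_right h0⟩
  have ht' : Fact (∀ i, 1 ≤ t i) := ⟨ht⟩
  have hcast : ∀ a : ℕ, a ≠ 0 → a < p → (a : F) ≠ 0 := fun a ha hap h =>
    Nat.not_dvd_of_pos_of_lt (Nat.pos_of_ne_zero ha) hap ((CharP.cast_eq_zero_iff F p a).1 h)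
  have h2 : (2 : F) ≠ 0 := by exact_mod_cast hcast 2 two_ne_zero (by omega)
  have h3 : (3 : F) ≠ 0 := by exact_mod_cast hcast 3 three_ne_zero hp
  let i : Fin m := ⟨0, by omega⟩
  obtain ⟨I, hI, he⟩ := exists_outerDer_equiv (S := evenSLie F p n t) (T := StildeLie F p n t i)
    evenS_le_Stilde (fun x hx s hs => lie_mem_evenS_of_mem_Stilde h2 i hx hs)
    (fun x hx h => eq_zero_of_mem_Stilde hm hn h2 hx h)
    (fun d => exists_mem_Stilde_eq_lie hm hn h2 h3 d)
  exact ⟨evenSLie F p n t, StildeLie F p n t i, I, rfl, rfl,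
    fun E hE => Stilde_le_superDer i hE, hI,
    fun E hE h => eq_zero_of_mem_Stilde hm hn h2 hE h, he⟩
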